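/- Let $(M,\nu)$ be a $\sigma$-finite measure space such that $\mathfrak h=L^2(M,\nu)$ (complex) is separable. Let $h$ be a densely defined, essentially self-adjoint operator on $\mathfrak h$ with $h+m\ge 0$ for some $m\in\mathbb R$, let $\mu\in\mathbb R$, and let $V:M\times M\to\mathbb R$ be measurable with $V\ge 0$ almost everywhere, acting by multiplication on $\mathfrak h\otimes\mathfrak h=L^2(M\times M)$. Let $\mathfrak F=\bigoplus_{N\ge 0}\bigwedge^N\mathfrak h$ be the fermion Fock space, with creation and annihilation operators $c^*(f),c(f)$, number operator $\mathbb N$, and $\mathbb H=\bigoplus_N H_N$, $H_N=\sum_{i} h_i+\sum_{i<k}V(x_i,x_k)$. Energies of unbounded operators are understood in the sense of closed quadratic forms (with $H_N$ a form sum), with values in $(-\infty,\infty]$, and infima are taken in $[-\infty,\infty]$. A quasifree density matrix is an even operator $\rho\ge0$ on $\mathfrak F$ with $\mathrm{Tr}\,\rho=1$ and $\mathrm{Tr}(\rho\,\mathbb N)<\infty$ that satisfies Wick's formula $$\langle A_1\cdots A_{2k}\rangle=\sum_{\pi}(-1)^\pi\langle A_{\pi(1)}A_{\pi(2)}\rangle\cdots\langle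 A_{\pi(2k-1)}A_{\pi(2k)}\rangle,\qquad \langle B\rangle:=\mathrm{Tr}(\rho B),$$ for all $k\ge 2$ and all $A_i=c^*(f_i)+c(g_i)$, the sum being over the permutations with $\pi(1)<\pi(3)<\dots<\pi(2k-1)$ and $\pi(2i-1)<\pi(2i)$. Put $$E_{\rm BHF}=\inf\{\mathrm{Tr}(\rho(\mathbb H-\mu\mathbb N)) : \rho \text{ a quasifree density matrix of finite energy}\},$$ $$E_{\rm HF}=\inf_{N\ge 0}\{E_{\rm HF}(N)-\mu N\},\qquad E_{\rm HF}(N)=\inf\{\langle\Phi,H_N\Phi\rangle:\Phi=f_1\wedge\dots\wedge f_N,\ \langle f_i,f_k\rangle=\delta_{ik}\}.$$ Fix an antiunitary involution $j$ of $\mathfrak h$, put $J(f_1\oplus jf_2)=f_2\oplus jf_1$ on $\mathfrak h\oplus\mathfrak h$, and let $\mathfrak G$ be the set of bounded operators $\Gamma=\begin{pmatrix}\gamma&\alpha\\ \alpha^*&1-j\gamma j\end{pmatrix}$ on $\mathfrak h\oplus\mathfrak h$ with $\Gamma=J(1-\Gamma)J\ge0$ and $\gamma$ trace class. Let $$\mathcal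 E_{\rm HF}(\gamma)=\mathrm{Tr}[(h-\mu)\gamma]+\tfrac12\mathrm{Tr}[V(1-\mathrm{Ex})(\gamma\otimes\gamma)],\qquad \mathcal E_{\rm BHF}(\Gamma)=\mathcal E_{\rm HF}(\gamma)+\tfrac12\mathrm{Tr}[V\,\mathrm{Ex}(\alpha^*\otimes\alpha)],$$ where $\mathrm{Ex}(f\otimes g)=g\otimes f$ and the traces over $\mathfrak h\otimes\mathfrak h$ are the integrals of $V$ against the integral kernels on the diagonal. Then: 1. For every $\Gamma\in\mathfrak G$ the operator $\alpha$ has a square-integrable kernel $\alpha(x,y)$ and $$\mathrm{Tr}[V\,\mathrm{Ex}(\alpha^*\otimes\alpha)]=\int V(x,y)\,|\alpha(x,y)|^2\,d\nu(x)\,d\nu(y)\ \ge\ 0 .$$ 2. For every $\Gamma\in\mathfrak G$, both $\widetilde\Gamma=\mathrm{diag}(1,-1)\,\Gamma\,\mathrm{diag}(1,-1)$ and $\widehat\Gamma=\frac12(\Gamma+\widetilde\Gamma)$ belong to $\mathfrak G$; $\widehat\Gamma$ has the same entry $\gamma$ and pairing operator $0$, and $\mathcal E_{\rm BHF}(\widehat\Gamma)=\mathcal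 E_{\rm HF}(\gamma)\le\mathcal E_{\rm BHF}(\Gamma)$. 3. $$E_{\rm BHF}=E_{\rm HF}=\inf\{\mathcal E_{\rm HF}(\gamma):\gamma\text{ trace class},\ 0\le\gamma\le1\},\qquad E_{\rm BHF}=\inf\{\mathcal E_{\rm BHF}(\Gamma):\Gamma\in\mathfrak G\}.$$ -/

import Mathlib

open MeasureTheory
open scoped ENNReal InnerProductSpace

namespace BHF

/-! ### Traces on a Hilbert space -/

section Trace

variable {H : Type*} [NormedAddCommGroup H] [InnerProductSpace ℂ H] [CompleteSpace H]

variable (H) in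
/-- Index type of a fixed Hilbert basis of `H`. -/
def BasisIndex : Type _ := ↥(exists_hilbertBasis ℂ H).choose

variable (H) in
/-- A fixed Hilbert basis, used to write traces; none of the traces below depends on it. -/
noncomputable def stdBasis : HilbertBasis (BasisIndex H) ℂ H :=
  (exists_hilbertBasis ℂ H).choose_spec.choose

/-- The trace in `[0,∞]` of a nonnegative bounded operator `T`. -/
noncomputable def posTrace (T : H →L[ℂ] H) : ℝ≥0∞ :=
  ∑' i, ENNReal.ofReal (⟪stdBasis H i, T (stdBasis H i)⟫_ℂ).re

/-- The square root of a nonnegative bounded operator. -/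
noncomputable def opSqrt (T : H →L[ℂ] H) : H →L[ℂ] H := CFC.sqrt T

/-- `Tr[T^{1/2} Q T^{1/2}] ∈ [0,∞]` for a nonnegative bounded operator `T` and a closed
nonnegative quadratic form `Q` (with the value `∞` off its form domain). -/
noncomputable def formTrace (Q : H → ℝ≥0∞) (T : H →L[ℂ] H) : ℝ≥0∞ :=
  ∑' i, Q (opSqrt T (stdBasis H i))

/-- `Tr[ρ B]` for a trace-class operator `ρ` and a bounded operator `B`. -/
noncomputable def trExp (ρ B : H →L[ℂ] H) : ℂ :=
  ∑' i, ⟪stdBasis H i, ρ (B (stdBasis H i))⟫_ℂ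

/-- The closed quadratic form of the operator `h + m ≥ 0`: the lower semicontinuous hull of
`g ↦ ⟨g, h g⟩ + m ‖g‖²`, `g` in the domain of `h`, with the value `∞` off the form domain. -/
noncomputable def opForm (h : H →ₗ.[ℂ] H) (m : ℝ) (f : H) : ℝ≥0∞ :=
  Filter.liminf
    (fun g : h.domain => ENNReal.ofReal ((⟪(g : H), h g⟫_ℂ).re + m * ‖(g : H)‖ ^ 2))
    (Filter.comap (fun g : h.domain => (g : H)) (nhds f))

end Trace

/-! ### Generalized one-particle density matrices on `H ⊕ H` -/

section Generalized

variable {H : Type*} [NormedAddCommGroup H] [InnerProductSpace ℂ H] [CompleteSpace H]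

variable (H) in
/-- The Hilbert space sum `H ⊕ H`. -/
abbrev Dbl : Type _ := WithLp 2 (H × H)

/-- The upper left entry `γ` of an operator matrix on `H ⊕ H`. -/
noncomputable def gammaBlock (Γ : Dbl H →L[ℂ] Dbl H) : H →L[ℂ] H :=
  (ContinuousLinearMap.fst ℂ H H) ∘L (WithLp.prodContinuousLinearEquiv 2 ℂ H H : _ →L[ℂ] _) ∘L Γ ∘L
    ((WithLp.prodContinuousLinearEquiv 2 ℂ H H).symm : _ →L[ℂ] _) ∘L ContinuousLinearMap.inl ℂ H H

/-- The upper right entry `α` (the pairing operator) of an operator matrix on `H ⊕ H`. -/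
noncomputable def pairingBlock (Γ : Dbl H →L[ℂ] Dbl H) : H →L[ℂ] H :=
  (ContinuousLinearMap.fst ℂ H H) ∘L (WithLp.prodContinuousLinearEquiv 2 ℂ H H : _ →L[ℂ] _) ∘L Γ ∘L
    ((WithLp.prodContinuousLinearEquiv 2 ℂ H H).symm : _ →L[ℂ] _) ∘L ContinuousLinearMap.inr ℂ H H

/-- The antiunitary involution `J (f₁ ⊕ j f₂) = f₂ ⊕ j f₁` built from an antiunitary
involution `j`. -/
def dblConj (j : H →ₗᵢ⋆[ℂ] H) (F : Dbl H) : Dbl H := WithLp.toLp 2 (j F.snd, j F.fst)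

/-- The set `𝔊` of generalized one-particle density matrices:
`Γ = J (1 - Γ) J ≥ 0` with trace-class upper left entry. -/
structure IsGenOnePDM (j : H →ₗᵢ⋆[ℂ] H) (Γ : Dbl H →L[ℂ] Dbl H) : Prop where
  nonneg : 0 ≤ Γ
  conj : ∀ F, Γ F = dblConj j (dblConj j F - Γ (dblConj j F))
  traceClass : posTrace (gammaBlock Γ) ≠ ∞

/-- One-particle density matrices: trace class and `0 ≤ γ ≤ 1`. -/
structure IsOnePDM (γ : H →L[ℂ] H) : Prop where
  nonneg : 0 ≤ γ
  le_one : γ ≤ 1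
  traceClass : posTrace γ ≠ ∞

variable (H) in
/-- The operator matrix `diag(1, -1)`. -/
noncomputable def signFlip : Dbl H →L[ℂ] Dbl H :=
  ((WithLp.prodContinuousLinearEquiv 2 ℂ H H).symm : _ →L[ℂ] _) ∘L
    ((ContinuousLinearMap.fst ℂ H H).prod (-ContinuousLinearMap.snd ℂ H H)) ∘L
    (WithLp.prodContinuousLinearEquiv 2 ℂ H H : _ →L[ℂ] _)

/-- The sign-flipped conjugate `diag(1, -1) Γ diag(1, -1)`. -/
noncomputable def flipped (Γ : Dbl H →L[ℂ] Dbl H) : Dbl H →L[ℂ] Dbl H :=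
  signFlip H ∘L Γ ∘L signFlip H

/-- The average of `Γ` and its sign-flipped conjugate. -/
noncomputable def averaged (Γ : Dbl H →L[ℂ] Dbl H) : Dbl H →L[ℂ] Dbl H :=
  (1 / 2 : ℂ) • (Γ + flipped Γ)

end Generalized

variable {M : Type*} [MeasurableSpace M]

/-- The one-particle space `𝔥 = L²(M, ν)`. -/
abbrev OneP (ν : Measure M) : Type _ := Lp ℂ 2 ν

/-! ### The Hartree–Fock and Bogoliubov–Hartree–Fock functionals -/

section Functionals

variable (ν : Measure M)

/-- `k ∈ L²(M × M)` is the integral kernel of the operator `T`. -/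
def IsIntegralKernel (k : M → M → ℂ) (T : OneP ν →L[ℂ] OneP ν) : Prop :=
  MemLp (Function.uncurry k) 2 (ν.prod ν) ∧
    ∀ f : OneP ν, (T f : M → ℂ) =ᵐ[ν] fun x => ∫ y, k x y * f y ∂ν

open Classical in
/-- The square-integrable integral kernel `T(x,y)` of a Hilbert–Schmidt operator `T`. -/
noncomputable def hsKernel (T : OneP ν →L[ℂ] OneP ν) : M → M → ℂ :=
  if hk : ∃ k, IsIntegralKernel ν k T then hk.choose else 0

/-- The integral kernel `γ(x,y) = ∑ᵢ (γ^{1/2}eᵢ)(x) conj (γ^{1/2}eᵢ)(y)` of a nonnegative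
trace-class operator; in this version the diagonal `γ(x,x)` is the one-particle density. -/
noncomputable def posKernel (γ : OneP ν →L[ℂ] OneP ν) (x y : M) : ℂ :=
  ∑' i, (opSqrt γ (stdBasis (OneP ν) i) : M → ℂ) x *
    (starRingEnd ℂ) ((opSqrt γ (stdBasis (OneP ν) i) : M → ℂ) y)

/-- Kernel of the adjoint `a*`. -/
def adjKernel (a : M → M → ℂ) (x y : M) : ℂ := (starRingEnd ℂ) (a y x)

/-- Kernel of `a ⊗ b`. -/
def tensorKernel (a b : M → M → ℂ) (p q : M × M) : ℂ := a p.1 q.1 * b p.2 q.2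

/-- Kernel of `Ex K`, where `Ex (f ⊗ g) = g ⊗ f`. -/
def exKernel (K : M × M → M × M → ℂ) (p q : M × M) : ℂ := K p.swap q

/-- `Tr[V K] = ∫ V(p) K(p,p) dp` for the multiplication operator `V` and an operator with kernel
`K` on `L²(M × M)`, as an extended integral (positive part minus negative part). -/
noncomputable def mulTrace (V : M × M → ℝ) (K : M × M → M × M → ℂ) : EReal :=
  ((∫⁻ p, ENNReal.ofReal (V p * (K p p).re) ∂(ν.prod ν) : ℝ≥0∞) : EReal) -
    ((∫⁻ p, ENNReal.ofReal (-(V p * (K p p).re)) ∂(ν.prod ν) : ℝ≥0∞) : EReal)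

/-- `Tr[(h - μ) γ]`, where `h + m ≥ 0` and `γ ≥ 0` is trace class. -/
noncomputable def oneBodyEnergy (h : OneP ν →ₗ.[ℂ] OneP ν) (m μ : ℝ)
    (γ : OneP ν →L[ℂ] OneP ν) : EReal :=
  (formTrace (opForm h m) γ : EReal) - (((m + μ) * (posTrace γ).toReal : ℝ) : EReal)

/-- The Hartree–Fock functional
`Tr[(h - μ) γ] + ½ Tr[V (1 - Ex)(γ ⊗ γ)]`. -/
noncomputable def hfFunctional (h : OneP ν →ₗ.[ℂ] OneP ν) (m μ : ℝ) (V : M × M → ℝ)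
    (γ : OneP ν →L[ℂ] OneP ν) : EReal :=
  oneBodyEnergy ν h m μ γ +
    ((1 / 2 : ℝ) : EReal) * mulTrace ν V (fun p q =>
      tensorKernel (posKernel ν γ) (posKernel ν γ) p q -
        exKernel (tensorKernel (posKernel ν γ) (posKernel ν γ)) p q)

/-- The pairing term `Tr[V Ex (α* ⊗ α)]`. -/
noncomputable def pairingTerm (V : M × M → ℝ) (α : OneP ν →L[ℂ] OneP ν) : EReal :=
  mulTrace ν V (exKernel (tensorKernel (adjKernel (hsKernel ν α)) (hsKernel ν α)))

/-- The Bogoliubov–Hartree–Fock functional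
`Tr[(h - μ) γ] + ½ Tr[V (1 - Ex)(γ ⊗ γ)] + ½ Tr[V Ex (α* ⊗ α)]`. -/
noncomputable def bhfFunctional (h : OneP ν →ₗ.[ℂ] OneP ν) (m μ : ℝ) (V : M × M → ℝ)
    (Γ : Dbl (OneP ν) →L[ℂ] Dbl (OneP ν)) : EReal :=
  hfFunctional ν h m μ V (gammaBlock Γ) +
    ((1 / 2 : ℝ) : EReal) * pairingTerm ν V (pairingBlock Γ)

end Functionals

/-! ### Fock space and the Hamiltonian -/

section Fock

variable (ν : Measure M)

/-- The Slater determinant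
`(f₁ ∧ ⋯ ∧ f_N)(x) = (N!)^{-1/2} ∑_π (-1)^π f_{π(1)}(x₁) ⋯ f_{π(N)}(x_N)`. -/
noncomputable def slater {N : ℕ} (f : Fin N → OneP ν) (x : Fin N → M) : ℂ :=
  ((Real.sqrt (N.factorial : ℝ))⁻¹ : ℂ) * (Matrix.of fun i k => (f i : M → ℂ) (x k)).det

/-- `L²(M^N)`. -/
abbrev L2N (N : ℕ) : Type _ := Lp ℂ 2 (Measure.pi fun _ : Fin N => ν)

/-- The `N`-particle space: the closed span of the Slater determinants in `L²(M^N)`. -/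
noncomputable def antisym (N : ℕ) : Submodule ℂ (L2N ν N) :=
  (Submodule.span ℂ {Ψ : L2N ν N | ∃ f : Fin N → OneP ν,
    (Ψ : (Fin N → M) → ℂ) =ᵐ[Measure.pi fun _ : Fin N => ν] slater ν f}).topologicalClosure

noncomputable instance instCompleteAntisym (N : ℕ) : CompleteSpace ↥(antisym ν N) :=
  Submodule.topologicalClosure.completeSpace _

/-- The fermion Fock space, the Hilbert sum of the `N`-particle spaces, `N ≥ 0`. -/
abbrev Fock : Type _ := lp (fun N : ℕ => ↥(antisym ν N)) 2

/-- The function on `M^N` given by the `N`-particle component of a Fock vector. -/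
noncomputable def comp (Ψ : Fock ν) (N : ℕ) : (Fin N → M) → ℂ := ((Ψ N : L2N ν N) : (Fin N → M) → ℂ)

/-- `Ψ` is the `N`-particle vector `f₁ ∧ ⋯ ∧ f_N`. -/
def IsWedge {N : ℕ} (f : Fin N → OneP ν) (Ψ : Fock ν) : Prop :=
  (∀ n, n ≠ N → Ψ n = 0) ∧ comp ν Ψ N =ᵐ[Measure.pi fun _ : Fin N => ν] slater ν f

open Classical in
/-- The creation operator `c*(f)`: the bounded operator on Fock space with
`c*(f) [f₁ ∧ ⋯ ∧ f_N] = f ∧ f₁ ∧ ⋯ ∧ f_N` for all `N ≥ 0`. -/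
noncomputable def creation (f : OneP ν) : Fock ν →L[ℂ] Fock ν :=
  if hT : ∃ T : Fock ν →L[ℂ] Fock ν, ∀ (N : ℕ) (g : Fin N → OneP ν) (Ψ : Fock ν),
      IsWedge ν g Ψ → IsWedge ν (Fin.cons f g : Fin (N + 1) → OneP ν) (T Ψ)
  then hT.choose else 0

/-- The annihilation operator `c(f) = c*(f)*`. -/
noncomputable def annihilation (f : OneP ν) : Fock ν →L[ℂ] Fock ν :=
  ContinuousLinearMap.adjoint (creation ν f)

/-- The field operator `c*(f) + c(g)`. -/
noncomputable def field (f g : OneP ν) : Fock ν →L[ℂ] Fock ν :=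
  creation ν f + annihilation ν g

open Classical in
/-- `opForm h m` on functions. -/
noncomputable def opFormFn (h : OneP ν →ₗ.[ℂ] OneP ν) (m : ℝ) (u : M → ℂ) : ℝ≥0∞ :=
  if hu : MemLp u 2 ν then opForm h m (hu.toLp u) else ∞

/-- The form of `∑ᵢ (h + m)ᵢ` on `N`-particle functions; the `i`-th summand acts on the `i`-th
variable, the others being integrated over. -/
noncomputable def kineticForm (h : OneP ν →ₗ.[ℂ] OneP ν) (m : ℝ) :
    (N : ℕ) → ((Fin N → M) → ℂ) → ℝ≥0∞
  | 0, _ => 0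
  | n + 1, ψ => ∑ i : Fin (n + 1), ∫⁻ x : Fin n → M,
      opFormFn ν h m (fun y => ψ (i.insertNth (α := fun _ => M) y x))
        ∂(Measure.pi fun _ : Fin n => ν)

/-- The form of `½ V_N = ∑_{i<k} V(xᵢ, x_k)` on `N`-particle functions. -/
noncomputable def pairForm (V : M × M → ℝ) (N : ℕ) (ψ : (Fin N → M) → ℂ) : ℝ≥0∞ :=
  ∑ i : Fin N, ∑ k ∈ Finset.Ioi i, ∫⁻ x : Fin N → M,
    ENNReal.ofReal (V (x i, x k)) * ‖ψ x‖ₑ ^ 2 ∂(Measure.pi fun _ : Fin N => ν)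

/-- The form `⟨ψ, (H_N + m N) ψ⟩` of `H_N + m N = ∑ᵢ (h + m)ᵢ + ∑_{i<k} V(xᵢ, x_k) ≥ 0`. -/
noncomputable def nBodyForm (h : OneP ν →ₗ.[ℂ] OneP ν) (m : ℝ) (V : M × M → ℝ) (N : ℕ)
    (ψ : (Fin N → M) → ℂ) : ℝ≥0∞ :=
  kineticForm ν h m N ψ + pairForm ν V N ψ

/-- The form of the second quantization `ℍ + m ℕ` on Fock space. -/
noncomputable def fockForm (h : OneP ν →ₗ.[ℂ] OneP ν) (m : ℝ) (V : M × M → ℝ)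
    (Ψ : Fock ν) : ℝ≥0∞ :=
  ∑' N : ℕ, nBodyForm ν h m V N (comp ν Ψ N)

/-- The form of the particle number operator. -/
noncomputable def numberForm (Ψ : Fock ν) : ℝ≥0∞ := ∑' N : ℕ, (N : ℝ≥0∞) * ‖Ψ N‖ₑ ^ 2

/-- Density matrices: even nonnegative operators of unit trace. -/
structure IsDensityMatrix (ρ : Fock ν →L[ℂ] Fock ν) : Prop where
  nonneg : 0 ≤ ρ
  trace_one : posTrace ρ = 1
  even : ∀ (a b : ℕ) (φ : antisym ν a) (ψ : antisym ν b), Odd (a + b) →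
    ⟪(lp.single 2 a φ : Fock ν), ρ (lp.single 2 b ψ : Fock ν)⟫_ℂ = 0

/-- The pairings of `{0, …, 2k-1}`: permutations with `π(0) < π(2) < ⋯ < π(2k-2)` and
`π(2i) < π(2i+1)`. -/
def pairings (k : ℕ) : Finset (Equiv.Perm (Fin (2 * k))) :=
  Finset.univ.filter fun π =>
    (∀ i i' : Fin k, i < i' → π ⟨2 * i, by omega⟩ < π ⟨2 * i', by omega⟩) ∧
      ∀ i : Fin k, π ⟨2 * i, by omega⟩ < π ⟨2 * i + 1, by omega⟩

/-- Quasifree density matrices: density matrices of finite particle number expectation that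
satisfy Wick's formula
`⟨A₁ ⋯ A_{2k}⟩ = ∑_π (-1)^π ⟨A_{π(1)} A_{π(2)}⟩ ⋯ ⟨A_{π(2k-1)} A_{π(2k)}⟩`
for all field operators `Aᵢ = c*(fᵢ) + c(gᵢ)`. -/
structure IsQuasifree (ρ : Fock ν →L[ℂ] Fock ν) : Prop extends IsDensityMatrix ν ρ where
  finite_number : formTrace (numberForm ν) ρ ≠ ∞
  wick : ∀ (k : ℕ), 2 ≤ k → ∀ f g : Fin (2 * k) → OneP ν,
    trExp ρ (List.ofFn fun i => field ν (f i) (g i)).prod =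
      ∑ π ∈ pairings k, ((Equiv.Perm.sign π : ℤ) : ℂ) * ∏ i : Fin k,
        trExp ρ (field ν (f (π ⟨2 * i, by omega⟩)) (g (π ⟨2 * i, by omega⟩)) *
          field ν (f (π ⟨2 * i + 1, by omega⟩)) (g (π ⟨2 * i + 1, by omega⟩)))

/-- `Tr[ρ (ℍ - μ ℕ)]` for a density matrix `ρ` of finite particle number expectation. -/
noncomputable def fockEnergy (h : OneP ν →ₗ.[ℂ] OneP ν) (m μ : ℝ) (V : M × M → ℝ)
    (ρ : Fock ν →L[ℂ] Fock ν) : EReal :=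
  (formTrace (fockForm ν h m V) ρ : EReal) -
    (((m + μ) * (formTrace (numberForm ν) ρ).toReal : ℝ) : EReal)

/-- The Bogoliubov–Hartree–Fock energy: the infimum of `Tr[ρ (ℍ - μ ℕ)]` over the quasifree
density matrices of finite energy. -/
noncomputable def bhfEnergy (h : OneP ν →ₗ.[ℂ] OneP ν) (m μ : ℝ) (V : M × M → ℝ) : EReal :=
  ⨅ (ρ : Fock ν →L[ℂ] Fock ν) (_ : IsQuasifree ν ρ)
    (_ : formTrace (fockForm ν h m V) ρ ≠ ∞), fockEnergy ν h m μ V ρ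

/-- The `N`-particle Hartree–Fock energy: the infimum of `⟨Φ, H_N Φ⟩` over Slater determinants
`Φ = f₁ ∧ ⋯ ∧ f_N` of orthonormal orbitals. -/
noncomputable def hfEnergyN (h : OneP ν →ₗ.[ℂ] OneP ν) (m : ℝ) (V : M × M → ℝ) (N : ℕ) : EReal :=
  ⨅ (f : Fin N → OneP ν) (_ : Orthonormal ℂ f),
    (nBodyForm ν h m V N (slater ν f) : EReal) - ((m * N : ℝ) : EReal)

/-- The total Hartree–Fock energy at chemical potential `μ`, `inf_{N ≥ 0} (E_HF(N) - μ N)`. -/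
noncomputable def hfEnergy (h : OneP ν →ₗ.[ℂ] OneP ν) (m μ : ℝ) (V : M × M → ℝ) : EReal :=
  ⨅ N : ℕ, hfEnergyN ν h m V N - ((μ * N : ℝ) : EReal)

end Fock

end BHF

/-! The three infima are compared in a circle: the BHF energy is at most the HF energy, which is at
most the infimum of the HF functional over one-particle density matrices, which is at most the BHF
energy.

A Slater determinant is a pure quasifree state. Every field operator splits into a part that kills
the determinant and a part whose adjoint kills it, and moving the first part through a product
reproduces the sum over pairings (`wick_of_split`, `isQuasifree_wedge`). This gives the first
inequality (`bhfEnergy_le_hfEnergy`).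

The second inequality is Lieb's variational principle (`hfEnergy_le_hfFunctional`). For γ = ∑ x_l
|f_l⟩⟨f_l| of finite rank with orthonormal f_l and 0 < x_l ≤ 1, the energy is affine in each x_l
separately, because f ∧ f = 0 removes the diagonal terms. Rounding the x_l one at a time to 0 or 1
without raising the energy, chemical potential included, ends at a Slater determinant. A general γ
is replaced by the finite-rank operators γ^{1/2} P_F γ^{1/2}: all terms of the shifted energy are
nonnegative, so truncation only lowers it, and the particle number converges.

For the third inequality, Wick's formula with four operators (`IsQuasifree.four_point`) shows that
twice the two-particle density of a quasifree state is the density of (1 - Ex)(γ ⊗ γ) plus |α(x,y)|²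
(`IsQuasifree.pairDensity_le`). Since V ≥ 0, the pairing part can be dropped, and the energy of the
state is at least the HF functional of its γ.

Unbounded forms are kept harmless by writing all of them through annihilation operators. The closed
form of h + m is a sum of squares ∑ |⟨φ_k, f⟩|² (`exists_opForm_eq_tsum`), obtained from the bounded
resolvent T = (1 + h + m)^{-1} by the geometric series (1 - T)T^{-1} = ∑ (1 - T)^{n+1}; its second
quantization is then ∑ ‖c(φ_k)Ψ‖². The interaction is the integral of V against a measure on M × M
whose mass on rectangles is a sum of ‖c(b)c(a)Ψ‖², and finite measures on a product are determined
by rectangles. Lagrange's identity identifies γ(x,x)γ(y,y) - |γ(x,y)|² with half a sum of squares,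
and so gives the HF interaction the same shape.

On generalized density matrices, 0 ≤ Γ ≤ 1 gives Γ² ≤ Γ, so α is Hilbert–Schmidt. Conjugation by
diag(1,-1) reverses the sign of α, so averaging removes the nonnegative pairing term. -/

namespace BHF

set_option linter.unusedSectionVars false

/-! ### Square sums in Hilbert spaces -/

section HilbertSums

variable {E F : Type*} [NormedAddCommGroup E] [InnerProductSpace ℂ E] [CompleteSpace E]
  [NormedAddCommGroup F] [InnerProductSpace ℂ F] [CompleteSpace F]

theorem enorm_sq_eq_ofReal (z : F) : ‖z‖ₑ ^ 2 = ENNReal.ofReal (‖z‖ ^ 2) := by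
  rw [ENNReal.ofReal_pow (norm_nonneg _), ofReal_norm]

theorem enorm_inner_symm (x y : E) : ‖⟪x, y⟫_ℂ‖ₑ = ‖⟪y, x⟫_ℂ‖ₑ := by
  rw [← ofReal_norm, ← ofReal_norm, norm_inner_symm]

theorem hasSum_norm_inner_sq {ι : Type*} (b : HilbertBasis ι ℂ E) (x : E) :
    HasSum (fun i => ‖⟪b i, x⟫_ℂ‖ ^ 2) (‖x‖ ^ 2) := by
  have h := (b.hasSum_inner_mul_inner x x).mapL Complex.reCLM
  have h2 : Complex.reCLM ⟪x, x⟫_ℂ = ‖x‖ ^ 2 := by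
    simp [inner_self_eq_norm_sq_to_K, ← Complex.ofReal_pow]
  rw [h2] at h
  convert h using 1
  ext i
  rw [← inner_conj_symm x (b i), Complex.conj_mul']
  simp [← Complex.ofReal_pow]

theorem tsum_enorm_inner_sq {ι : Type*} (b : HilbertBasis ι ℂ E) (x : E) :
    ∑' i, ‖⟪b i, x⟫_ℂ‖ₑ ^ 2 = ‖x‖ₑ ^ 2 := by
  simp_rw [enorm_sq_eq_ofReal]
  rw [← ENNReal.ofReal_tsum_of_nonneg (fun _ => by positivity) (hasSum_norm_inner_sq b x).summable,
    (hasSum_norm_inner_sq b x).tsum_eq]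

/-- Parseval turns both sides into the double sum of |⟨c_k, T b_i⟩|². -/
theorem tsum_enorm_adjoint {ι κ : Type*} (b : HilbertBasis ι ℂ E) (c : HilbertBasis κ ℂ F)
    (T : E →L[ℂ] F) :
    ∑' i, ‖T (b i)‖ₑ ^ 2 = ∑' k, ‖ContinuousLinearMap.adjoint T (c k)‖ₑ ^ 2 := by
  simp_rw [← tsum_enorm_inner_sq c (T _), ← tsum_enorm_inner_sq b (ContinuousLinearMap.adjoint T _)]
  rw [ENNReal.tsum_comm]
  refine tsum_congr fun k => tsum_congr fun i => ?_
  rw [ContinuousLinearMap.adjoint_inner_right, enorm_inner_symm]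

theorem summable_norm_sq_of_tsum_ne_top {ι : Type*} {f : ι → E} (h : ∑' i, ‖f i‖ₑ ^ 2 ≠ ∞) :
    Summable fun i => ‖f i‖ ^ 2 := by
  simp_rw [enorm_sq_eq_ofReal] at h
  have := ENNReal.summable_toReal h
  simpa [ENNReal.toReal_ofReal] using this

theorem tsum_ne_top_of_summable_norm_sq {ι : Type*} {f : ι → E} (h : Summable fun i => ‖f i‖ ^ 2) :
    ∑' i, ‖f i‖ₑ ^ 2 ≠ ∞ := by
  simp_rw [enorm_sq_eq_ofReal]
  rw [← ENNReal.ofReal_tsum_of_nonneg (fun _ => by positivity) h]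
  exact ENNReal.ofReal_ne_top

theorem tsum_enorm_sq_eq_ofReal {ι : Type*} {f : ι → E} (h : Summable fun i => ‖f i‖ ^ 2) :
    ∑' i, ‖f i‖ₑ ^ 2 = ENNReal.ofReal (∑' i, ‖f i‖ ^ 2) := by
  simp_rw [enorm_sq_eq_ofReal]
  rw [← ENNReal.ofReal_tsum_of_nonneg (fun _ => by positivity) h]

theorem summable_mul_of_norm_sq {ι : Type*} {f g : ι → ℂ} (hf : Summable fun i => ‖f i‖ ^ 2)
    (hg : Summable fun i => ‖g i‖ ^ 2) : Summable fun i => f i * g i := by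
  refine Summable.of_norm_bounded (hf.add hg) fun i => ?_
  rw [norm_mul]
  nlinarith [sq_nonneg (‖f i‖ - ‖g i‖), sq_nonneg ‖f i‖, sq_nonneg ‖g i‖]

theorem summable_inner_of_norm_sq {ι : Type*} {f g : ι → E} (hf : Summable fun i => ‖f i‖ ^ 2)
    (hg : Summable fun i => ‖g i‖ ^ 2) : Summable fun i => ⟪f i, g i⟫_ℂ := by
  refine Summable.of_norm_bounded (hf.add hg) fun i => (norm_inner_le_norm _ _).trans ?_
  nlinarith [sq_nonneg (‖f i‖ - ‖g i‖), sq_nonneg ‖f i‖, sq_nonneg ‖g i‖]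

theorem summable_norm_sq_apply {ι : Type*} {f : ι → E} (hf : Summable fun i => ‖f i‖ ^ 2)
    (B : E →L[ℂ] F) : Summable fun i => ‖B (f i)‖ ^ 2 := by
  refine Summable.of_nonneg_of_le (fun _ => by positivity) (fun i => ?_) (hf.mul_left (‖B‖ ^ 2))
  rw [← mul_pow]
  exact pow_le_pow_left₀ (norm_nonneg _) (B.le_opNorm _) 2

/-- The Hilbert–Schmidt pairing computed with the adjoints. -/
theorem tsum_inner_adjoint {ι : Type*} (b : HilbertBasis ι ℂ E) (S T : E →L[ℂ] E)
    (hS : ∑' i, ‖S (b i)‖ₑ ^ 2 ≠ ∞) (hT : ∑' i, ‖T (b i)‖ₑ ^ 2 ≠ ∞) :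
    ∑' i, ⟪S (b i), T (b i)⟫_ℂ =
      ∑' i, ⟪ContinuousLinearMap.adjoint T (b i), ContinuousLinearMap.adjoint S (b i)⟫_ℂ := by
  have key : ∀ U : E →L[ℂ] E, ∑' i, ‖U (b i)‖ₑ ^ 2 ≠ ∞ →
      Summable fun p : ι × ι => ‖⟪b p.2, U (b p.1)⟫_ℂ‖ ^ 2 := by
    intro U hU
    refine summable_norm_sq_of_tsum_ne_top (E := ℂ) ?_
    rw [ENNReal.tsum_prod (f := fun i k => ‖⟪b k, U (b i)⟫_ℂ‖ₑ ^ 2)]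
    simpa only [tsum_enorm_inner_sq b] using hU
  -- Absolute summability over pairs, from the two Hilbert–Schmidt bounds, is what permits the
  -- exchange of the sums below.
  have hsum : Summable fun p : ι × ι => ⟪S (b p.1), b p.2⟫_ℂ * ⟪b p.2, T (b p.1)⟫_ℂ := by
    refine summable_mul_of_norm_sq ?_ (key T hT)
    simpa only [norm_inner_symm (S _)] using key S hS
  calc ∑' i, ⟪S (b i), T (b i)⟫_ℂ
      = ∑' i, ∑' k, ⟪S (b i), b k⟫_ℂ * ⟪b k, T (b i)⟫_ℂ :=
        tsum_congr fun i => (b.tsum_inner_mul_inner _ _).symm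
    _ = ∑' k, ∑' i, ⟪S (b i), b k⟫_ℂ * ⟪b k, T (b i)⟫_ℂ := (hsum.tsum_comm).symm
    _ = _ := by
        refine tsum_congr fun k => ?_
        rw [← b.tsum_inner_mul_inner]
        refine tsum_congr fun i => ?_
        rw [ContinuousLinearMap.adjoint_inner_left, ContinuousLinearMap.adjoint_inner_right, mul_comm]

end HilbertSums

/-! ### Traces -/

section Traces

variable {H : Type*} [NormedAddCommGroup H] [InnerProductSpace ℂ H] [CompleteSpace H]

theorem opSqrt_mul_self {T : H →L[ℂ] H} (hT : 0 ≤ T) : opSqrt T * opSqrt T = T :=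
  CFC.sqrt_mul_sqrt_self T hT

theorem adjoint_opSqrt (T : H →L[ℂ] H) : ContinuousLinearMap.adjoint (opSqrt T) = opSqrt T :=
  ((ContinuousLinearMap.nonneg_iff_isPositive _).1 (CFC.sqrt_nonneg T)).isSelfAdjoint.adjoint_eq

theorem inner_opSqrt (T : H →L[ℂ] H) (x y : H) : ⟪opSqrt T x, y⟫_ℂ = ⟪x, opSqrt T y⟫_ℂ := by
  conv_lhs => rw [← ContinuousLinearMap.adjoint_inner_right, adjoint_opSqrt]

theorem opSqrt_opSqrt {T : H →L[ℂ] H} (hT : 0 ≤ T) (x : H) : opSqrt T (opSqrt T x) = T x :=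
  congrArg (fun S : H →L[ℂ] H => S x) (opSqrt_mul_self hT)

theorem inner_opSqrt_opSqrt {T : H →L[ℂ] H} (hT : 0 ≤ T) (x y : H) :
    ⟪opSqrt T x, opSqrt T y⟫_ℂ = ⟪x, T y⟫_ℂ := by
  rw [inner_opSqrt, opSqrt_opSqrt hT]

theorem enorm_opSqrt_sq {T : H →L[ℂ] H} (hT : 0 ≤ T) (x : H) :
    ‖opSqrt T x‖ₑ ^ 2 = ENNReal.ofReal (⟪x, T x⟫_ℂ).re := by
  rw [enorm_sq_eq_ofReal, ← inner_opSqrt_opSqrt hT]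
  congr 1
  exact (inner_self_eq_norm_sq (𝕜 := ℂ) _).symm

theorem posTrace_eq {T : H →L[ℂ] H} (hT : 0 ≤ T) :
    posTrace T = ∑' i, ‖opSqrt T (stdBasis H i)‖ₑ ^ 2 := by
  simp_rw [enorm_opSqrt_sq hT, posTrace]

theorem summable_norm_opSqrt {T : H →L[ℂ] H} (hT : 0 ≤ T) (h : posTrace T ≠ ∞) :
    Summable fun i => ‖opSqrt T (stdBasis H i)‖ ^ 2 :=
  summable_norm_sq_of_tsum_ne_top (by rwa [← posTrace_eq hT])

/-- Cyclicity of the trace for ρ^{1/2} and ρ^{1/2}B. It presents the state as the mixture of the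
vectors ρ^{1/2}e_i, so that later facts about expectations become facts about vectors. -/
theorem trExp_eq {ρ : H →L[ℂ] H} (hρ : 0 ≤ ρ) (h : posTrace ρ ≠ ∞) (B : H →L[ℂ] H) :
    trExp ρ B = ∑' i, ⟪opSqrt ρ (stdBasis H i), B (opSqrt ρ (stdBasis H i))⟫_ℂ := by
  have h1 : ∑' i, ‖opSqrt ρ (stdBasis H i)‖ₑ ^ 2 ≠ ∞ := by rwa [← posTrace_eq hρ]
  have h2 : ∑' i, ‖(opSqrt ρ ∘L B) (stdBasis H i)‖ₑ ^ 2 ≠ ∞ := by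
    rw [tsum_enorm_adjoint _ (stdBasis H), ContinuousLinearMap.adjoint_comp, adjoint_opSqrt]
    exact tsum_ne_top_of_summable_norm_sq
      (summable_norm_sq_apply (summable_norm_opSqrt hρ h) (ContinuousLinearMap.adjoint B))
  have := tsum_inner_adjoint (stdBasis H) (opSqrt ρ) (opSqrt ρ ∘L B) h1 h2
  rw [trExp]
  calc _ = ∑' i, ⟪opSqrt ρ (stdBasis H i), (opSqrt ρ ∘L B) (stdBasis H i)⟫_ℂ :=
        tsum_congr fun i => (inner_opSqrt_opSqrt hρ _ _).symm
    _ = _ := this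
    _ = _ := by
      refine tsum_congr fun i => ?_
      rw [ContinuousLinearMap.adjoint_comp, adjoint_opSqrt, ContinuousLinearMap.comp_apply,
        ContinuousLinearMap.adjoint_inner_left]

end Traces

/-! ### Lagrange's identity -/

theorem hasSum_mul_prod {ι : Type*} {f g : ι → ℂ} {w z : ℂ} (hf : HasSum f w) (hg : HasSum g z) :
    HasSum (fun p : ι × ι => f p.1 * g p.2) (w * z) := by
  have h1 : Summable fun i => ‖f i‖ := summable_norm_iff.2 hf.summable
  have h2 : Summable fun i => ‖g i‖ := summable_norm_iff.2 hg.summable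
  have h3 := summable_mul_of_summable_norm h1 h2
  exact HasSum.mul hf hg h3

theorem hasSum_mul_conj {ι : Type*} {f : ι → ℂ} {w : ℂ} (hw : HasSum f w) :
    HasSum (fun p : ι × ι => f p.1 * (starRingEnd ℂ) (f p.2)) (w * (starRingEnd ℂ) w) :=
  hasSum_mul_prod (g := fun i => (starRingEnd ℂ) (f i)) hw (Complex.hasSum_conj'.2 hw)

theorem hasSum_re_mul_conj {ι : Type*} {f : ι → ℂ} {w : ℂ} (hw : HasSum f w) :
    HasSum (fun p : ι × ι => Complex.reCLM (f p.1 * (starRingEnd ℂ) (f p.2))) (‖w‖ ^ 2) := by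
  have h := (hasSum_mul_conj hw).mapL Complex.reCLM
  rwa [Complex.mul_conj, Complex.reCLM_apply, Complex.ofReal_re, Complex.normSq_eq_norm_sq] at h

theorem norm_sq_det_two (a b c d : ℂ) : ‖a * d - b * c‖ ^ 2 =
    ‖a‖ ^ 2 * ‖d‖ ^ 2 + ‖b‖ ^ 2 * ‖c‖ ^ 2 -
      2 * Complex.reCLM ((a * (starRingEnd ℂ) c) * (starRingEnd ℂ) (b * (starRingEnd ℂ) d)) := by
  simp only [← Complex.normSq_eq_norm_sq, Complex.normSq_apply, Complex.reCLM_apply,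
    Complex.mul_re, Complex.mul_im, Complex.sub_re, Complex.sub_im, Complex.conj_re,
    Complex.conj_im]
  ring

/-- Expanding |u_i v_k - u_k v_i|² and summing over (i,k), the two unmixed terms each give the
product of the square sums, and the mixed term gives twice the square of the pairing. The identity
serves pointwise for kernels, for matrix elements of (1 - Ex)(γ ⊗ γ), and as a source of
Cauchy–Schwarz. -/
theorem lagrange_tsum {ι : Type*} {u v : ι → ℂ} (hu : Summable fun i => ‖u i‖ ^ 2)
    (hv : Summable fun i => ‖v i‖ ^ 2) :
    Summable (fun p : ι × ι => ‖u p.1 * v p.2 - u p.2 * v p.1‖ ^ 2) ∧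
    (∑' i, ‖u i‖ ^ 2) * (∑' i, ‖v i‖ ^ 2) =
      ‖∑' i, u i * (starRingEnd ℂ) (v i)‖ ^ 2 +
        (1 / 2) * ∑' p : ι × ι, ‖u p.1 * v p.2 - u p.2 * v p.1‖ ^ 2 := by
  have huv : Summable fun i => u i * (starRingEnd ℂ) (v i) :=
    summable_mul_of_norm_sq hu (by simpa using hv)
  obtain ⟨a, ha⟩ := id hu
  obtain ⟨b, hb⟩ := id hv
  have hab : Summable fun p : ι × ι => ‖u p.1‖ ^ 2 * ‖v p.2‖ ^ 2 :=
    Summable.mul_of_nonneg (f := fun i => ‖u i‖ ^ 2) (g := fun i => ‖v i‖ ^ 2) hu hv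
      (fun _ => sq_nonneg _) (fun _ => sq_nonneg _)
  have h1 : HasSum (fun p : ι × ι => ‖u p.1‖ ^ 2 * ‖v p.2‖ ^ 2) (a * b) :=
    HasSum.mul (f := fun i => ‖u i‖ ^ 2) (g := fun i => ‖v i‖ ^ 2) ha hb hab
  have h1' : HasSum (fun p : ι × ι => ‖u p.2‖ ^ 2 * ‖v p.1‖ ^ 2) (a * b) :=
    (Equiv.prodComm ι ι).hasSum_iff (f := fun p : ι × ι => ‖u p.1‖ ^ 2 * ‖v p.2‖ ^ 2) |>.2 h1
  obtain ⟨w, hw⟩ : ∃ w, HasSum (fun i => u i * (starRingEnd ℂ) (v i)) w := huv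
  have h2 := hasSum_re_mul_conj hw
  have h3 := (h1.add h1').sub (h2.mul_left 2)
  have h4 := fun p : ι × ι => norm_sq_det_two (u p.1) (u p.2) (v p.1) (v p.2)
  simp only [← h4] at h3
  refine ⟨h3.summable, ?_⟩
  rw [ha.tsum_eq, hb.tsum_eq, h3.tsum_eq, hw.tsum_eq]
  ring

theorem lagrange_tsum_enorm {ι : Type*} {u v : ι → ℂ} (hu : Summable fun i => ‖u i‖ ^ 2)
    (hv : Summable fun i => ‖v i‖ ^ 2) :
    (∑' i, ‖u i‖ₑ ^ 2) * (∑' i, ‖v i‖ₑ ^ 2) =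
      ‖∑' i, u i * (starRingEnd ℂ) (v i)‖ₑ ^ 2 +
        2⁻¹ * ∑' p : ι × ι, ‖u p.1 * v p.2 - u p.2 * v p.1‖ₑ ^ 2 := by
  obtain ⟨h1, h2⟩ := lagrange_tsum hu hv
  rw [tsum_enorm_sq_eq_ofReal hu, tsum_enorm_sq_eq_ofReal hv, tsum_enorm_sq_eq_ofReal h1,
    enorm_sq_eq_ofReal, ← ENNReal.ofReal_mul (tsum_nonneg fun _ => by positivity), h2,
    ENNReal.ofReal_add (by positivity) (mul_nonneg (by norm_num) (tsum_nonneg fun _ => by positivity)),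
    ENNReal.ofReal_mul (by norm_num)]
  congr 2
  rw [one_div, ENNReal.ofReal_inv_of_pos (by norm_num)]
  simp

end BHF

namespace BHF

set_option linter.unusedSectionVars false

/-! ### The form of a semibounded essentially self-adjoint operator as a sum of squares -/

section Resolvent

variable {H : Type*} [NormedAddCommGroup H] [InnerProductSpace ℂ H] [CompleteSpace H]

theorem inner_pow_of_symm {C : H →L[ℂ] H} (hC : ∀ x y, ⟪C x, y⟫_ℂ = ⟪x, C y⟫_ℂ) (n : ℕ)
    (x y : H) : ⟪(C ^ n) x, y⟫_ℂ = ⟪x, (C ^ n) y⟫_ℂ := by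
  induction n generalizing x y with
  | zero => rfl
  | succ n ih =>
    rw [pow_succ, mul_apply_eq_comp, ih, hC, ← mul_apply_eq_comp, ← pow_succ',
      pow_succ]

/-- A pair `T`, `C` with `C` self-adjoint, `C² = 1 - T` and `0 ≤ T`. -/
structure IsComplPair (T C : H →L[ℂ] H) : Prop where
  symm : ∀ x y, ⟪C x, y⟫_ℂ = ⟪x, C y⟫_ℂ
  sq : ∀ x, C (C x) = x - T x
  nonneg : ∀ x, 0 ≤ (⟪x, T x⟫_ℂ).re
  norm_le : ∀ x, ‖T x‖ ^ 2 ≤ (⟪x, T x⟫_ℂ).re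

/-- The intended T is (1 + h + m)^{-1}; the form of h + m is then that of (1 - T)T^{-1} = ∑
C^{2(n+1)}. The field `norm_le` is T² ≤ T. -/
theorem isComplPair_opSqrt {T : H →L[ℂ] H} (h0 : 0 ≤ T) (h1 : T ≤ 1) :
    IsComplPair T (opSqrt (1 - T)) := by
  have h2 : 0 ≤ 1 - T := sub_nonneg.2 h1
  have hR : ∀ x : H, ‖opSqrt T x‖ ^ 2 = (⟪x, T x⟫_ℂ).re := fun x => by
    rw [← inner_opSqrt_opSqrt h0]
    exact (inner_self_eq_norm_sq (𝕜 := ℂ) _).symm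
  have hT1 : ∀ x : H, (⟪x, T x⟫_ℂ).re ≤ ‖x‖ ^ 2 := fun x => by
    have : 0 ≤ (⟪x, (1 - T) x⟫_ℂ).re := by
      rw [← inner_opSqrt_opSqrt h2]
      exact inner_self_nonneg (𝕜 := ℂ)
    change 0 ≤ (⟪x, x - T x⟫_ℂ).re at this
    rw [inner_sub_right, Complex.sub_re] at this
    have h3 : (⟪x, x⟫_ℂ).re = ‖x‖ ^ 2 := inner_self_eq_norm_sq (𝕜 := ℂ) _
    linarith
  refine ⟨inner_opSqrt _, fun x => ?_, fun x => ?_, fun x => ?_⟩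
  · rw [opSqrt_opSqrt h2]
    rfl
  · rw [← hR]; positivity
  · rw [← hR x, ← opSqrt_opSqrt h0 x, hR]
    exact hT1 _

namespace IsComplPair

variable {T C : H →L[ℂ] H} (hC : IsComplPair T C)
include hC

theorem apply_eq (x : H) : T x = x - C (C x) := by rw [hC.sq]; abel

theorem comm (x : H) : T (C x) = C (T x) := by
  rw [hC.apply_eq, hC.apply_eq, map_sub]

theorem comm_pow (n : ℕ) (x : H) : T ((C ^ n) x) = (C ^ n) (T x) := by
  induction n generalizing x with
  | zero => rfl
  | succ n ih =>
    rw [pow_succ, mul_apply_eq_comp, ih, hC.comm, mul_apply_eq_comp]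

theorem inner_T (x : H) : (⟪x, T x⟫_ℂ).re = ‖x‖ ^ 2 - ‖C x‖ ^ 2 := by
  rw [hC.apply_eq, inner_sub_right, ← hC.symm, Complex.sub_re]
  congr 1
  · exact inner_self_eq_norm_sq (𝕜 := ℂ) _
  · exact inner_self_eq_norm_sq (𝕜 := ℂ) _

theorem norm_C_le (x : H) : ‖C x‖ ≤ ‖x‖ := by
  have h1 := hC.nonneg x
  rw [hC.inner_T] at h1
  nlinarith [norm_nonneg x, norm_nonneg (C x)]

theorem norm_pow_le (n : ℕ) (x : H) : ‖(C ^ n) x‖ ≤ ‖x‖ := by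
  induction n generalizing x with
  | zero => rfl
  | succ n ih =>
    rw [pow_succ, mul_apply_eq_comp]
    exact (ih _).trans (hC.norm_C_le x)

/-- The sequence ‖Cⁿx‖² decreases, hence converges, and the expression in question is the difference
of two consecutive terms. -/
theorem tendsto_inner_T (x : H) :
    Filter.Tendsto (fun n => (⟪(C ^ n) x, T ((C ^ n) x)⟫_ℂ).re) Filter.atTop (nhds 0) := by
  have hs : ∀ n, (C ^ (n + 1)) x = C ((C ^ n) x) := fun n => by
    rw [pow_succ', mul_apply_eq_comp]
  have hanti : Antitone fun n => ‖(C ^ n) x‖ ^ 2 := by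
    refine antitone_nat_of_succ_le fun n => ?_
    rw [hs]
    exact pow_le_pow_left₀ (norm_nonneg _) (hC.norm_C_le _) 2
  have hl := tendsto_atTop_ciInf hanti ⟨0, by rintro _ ⟨n, rfl⟩; positivity⟩
  have hl' := (hl.comp (Filter.tendsto_add_atTop_nat 1))
  have := hl.sub hl'
  rw [sub_self] at this
  refine this.congr fun n => ?_
  rw [hC.inner_T, ← hs]
  rfl

/-- On the range of T, ‖CⁿTx‖² ≤ ⟨Cⁿx, TCⁿx⟩ tends to 0; since the powers of C are contractions,
density extends this to all vectors. -/
theorem tendsto_pow_zero (hd : DenseRange T) (f : H) :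
    Filter.Tendsto (fun n => (C ^ n) f) Filter.atTop (nhds 0) := by
  have h1 : ∀ x, Filter.Tendsto (fun n => (C ^ n) (T x)) Filter.atTop (nhds 0) := fun x => by
    rw [tendsto_zero_iff_norm_tendsto_zero]
    have h2 := (hC.tendsto_inner_T x).sqrt
    rw [Real.sqrt_zero] at h2
    refine squeeze_zero (fun _ => norm_nonneg _) (fun n => ?_) h2
    refine Real.le_sqrt_of_sq_le ?_
    rw [← hC.comm_pow]
    exact hC.norm_le _
  rw [Metric.tendsto_atTop]
  intro ε hε
  obtain ⟨x, hx⟩ := hd.exists_dist_lt f (half_pos hε)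
  obtain ⟨N, hN⟩ := Metric.tendsto_atTop.1 (h1 x) (ε / 2) (half_pos hε)
  refine ⟨N, fun n hn => ?_⟩
  have h3 := hN n hn
  rw [dist_zero_right] at h3 ⊢
  have h4 : ‖(C ^ n) (f - T x)‖ < ε / 2 :=
    (hC.norm_pow_le n _).trans_lt (by rwa [← dist_eq_norm])
  calc ‖(C ^ n) f‖ = ‖(C ^ n) (f - T x) + (C ^ n) (T x)‖ := by rw [map_sub, sub_add_cancel]
    _ ≤ _ := norm_add_le _ _
    _ < ε := by linarith

/-- The sum telescopes, since ‖CⁿTx‖² = a n - a (n+1). Starting at exponent 1 matters: for x = (1 +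
h + m)u the value a 1 is ⟨u, (h + m)u⟩, whereas a 0 would be the form of 1 + h + m. -/
theorem hasSum_apply_T (x : H) :
    HasSum (fun n => ‖(C ^ (n + 1)) (T x)‖ ^ 2) (⟪T x, x - T x⟫_ℂ).re := by
  have hs : ∀ n, (C ^ (n + 1)) x = C ((C ^ n) x) := fun n => by
    rw [pow_succ', mul_apply_eq_comp]
  set a : ℕ → ℝ := fun n => (⟪(C ^ n) x, T ((C ^ n) x)⟫_ℂ).re with ha
  have hTs : ∀ u v, ⟪T u, v⟫_ℂ = ⟪u, T v⟫_ℂ := fun u v => by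
    rw [hC.apply_eq, hC.apply_eq, inner_sub_left, inner_sub_right, hC.symm, hC.symm]
  have hstep : ∀ n, ‖(C ^ n) (T x)‖ ^ 2 = a n - a (n + 1) := by
    intro n
    rw [← hC.comm_pow]
    simp only [ha, hs]
    set y := (C ^ n) x
    have h1 : ⟪C y, T (C y)⟫_ℂ = ⟪y, T y⟫_ℂ - ⟪T y, T y⟫_ℂ := by
      rw [hC.comm, hC.symm, hC.sq, inner_sub_right, hTs]
    rw [h1, Complex.sub_re]
    have h2 : (⟪T y, T y⟫_ℂ).re = ‖T y‖ ^ 2 := inner_self_eq_norm_sq (𝕜 := ℂ) _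
    linarith
  have ha1 : a 1 = (⟪T x, x - T x⟫_ℂ).re := by
    simp only [ha, pow_one]
    rw [hC.comm, hC.symm, hC.sq, hTs, map_sub]
  rw [hasSum_iff_tendsto_nat_of_nonneg (fun n => by positivity)]
  have h3 : ∀ N, ∑ n ∈ Finset.range N, ‖(C ^ (n + 1)) (T x)‖ ^ 2 = a 1 - a (N + 1) := by
    intro N
    induction N with
    | zero => simp
    | succ N ih => rw [Finset.sum_range_succ, ih, hstep]; ring
  have h4 := ((hC.tendsto_inner_T x).comp (Filter.tendsto_add_atTop_nat 1)).const_sub (a 1)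
  rw [sub_zero, ha1] at h4
  refine h4.congr fun N => ?_
  rw [h3, ← ha1]
  rfl

theorem tsum_apply_T (x : H) :
    ∑' n, ‖(C ^ (n + 1)) (T x)‖ₑ ^ 2 = ENNReal.ofReal (⟪T x, x - T x⟫_ℂ).re := by
  simp_rw [enorm_sq_eq_ofReal]
  rw [← ENNReal.ofReal_tsum_of_nonneg (fun _ => by positivity) (hC.hasSum_apply_T x).summable,
    (hC.hasSum_apply_T x).tsum_eq]

/-- The polynomial 1 - (1 - T)^N is divisible by T. This supplies approximations of f inside the
range of T. -/
theorem exists_range_approx (N : ℕ) (f : H) : ∃ x, T x = f - (C ^ (N + N)) f := by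
  induction N with
  | zero => exact ⟨0, by simp⟩
  | succ N ih =>
    obtain ⟨x, hx⟩ := ih
    refine ⟨x + (C ^ (N + N)) f, ?_⟩
    rw [map_add, hx, hC.apply_eq ((C ^ (N + N)) f)]
    have : (C ^ (N + 1 + (N + 1))) f = C (C ((C ^ (N + N)) f)) := by
      rw [show N + 1 + (N + 1) = 1 + (1 + (N + N)) by ring, pow_add, pow_add C 1 (N + N), pow_one]
      rfl
    rw [this]
    abel

theorem norm_sub_pow_le (N : ℕ) (y : H) : ‖y - (C ^ (N + N)) y‖ ≤ ‖y‖ := by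
  have h0 : ‖(C ^ (N + N)) y‖ ≤ ‖(C ^ N) y‖ := by
    rw [pow_add]; exact hC.norm_pow_le N _
  have h1 : ‖y - (C ^ (N + N)) y‖ ^ 2 = ‖y‖ ^ 2 - 2 * ‖(C ^ N) y‖ ^ 2 + ‖(C ^ (N + N)) y‖ ^ 2 := by
    rw [@norm_sub_sq ℂ]
    congr 3
    rw [pow_add, mul_apply_eq_comp, ← inner_pow_of_symm hC.symm]
    exact inner_self_eq_norm_sq (𝕜 := ℂ) _
  have h2 : ‖(C ^ (N + N)) y‖ ^ 2 ≤ ‖(C ^ N) y‖ ^ 2 := pow_le_pow_left₀ (norm_nonneg _) h0 2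
  refine pow_le_pow_iff_left₀ (norm_nonneg _) (norm_nonneg _) two_ne_zero |>.1 ?_
  nlinarith [sq_nonneg ‖(C ^ N) y‖]

/-- The operator 1 - C^{2N} is a contraction commuting with C, so the approximations do not raise
the form. -/
theorem tsum_approx_le (N : ℕ) (f : H) :
    ∑' n, ‖(C ^ (n + 1)) (f - (C ^ (N + N)) f)‖ₑ ^ 2 ≤ ∑' n, ‖(C ^ (n + 1)) f‖ₑ ^ 2 := by
  refine ENNReal.tsum_le_tsum fun n => ?_
  have h1 : (C ^ (n + 1)) (f - (C ^ (N + N)) f) =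
      (C ^ (n + 1)) f - (C ^ (N + N)) ((C ^ (n + 1)) f) := by
    rw [map_sub, ← mul_apply_eq_comp, ← mul_apply_eq_comp, ← pow_add,
      ← pow_add, add_comm (N + N)]
  rw [h1, ← ofReal_norm, ← ofReal_norm]
  gcongr
  exact hC.norm_sub_pow_le N _

end IsComplPair

variable {h : H →ₗ.[ℂ] H} {m : ℝ}

/-- The series is lower semicontinuous and equals the form on the domain of h, which gives one
inequality for the lower semicontinuous hull. For the other, f - C^{2N}f = Tx tends to f without
increase of the series, and x can be moved slightly so that Tx falls in the domain. -/
theorem opForm_eq_tsum_pow {T C : H →L[ℂ] H} (hC : IsComplPair T C) (hd : DenseRange T)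
    (hL : DenseRange fun u : h.domain => (u : H) + (h u + (m : ℂ) • (u : H)))
    (hT : ∀ u : h.domain, T ((u : H) + (h u + (m : ℂ) • (u : H))) = u) (f : H) :
    opForm h m f = ∑' n, ‖(C ^ (n + 1)) f‖ₑ ^ 2 := by
  set Q : H → ℝ≥0∞ := fun f => ∑' n, ‖(C ^ (n + 1)) f‖ₑ ^ 2 with hQ
  have hq : ∀ x, ∀ u : h.domain, x = (u : H) + (h u + (m : ℂ) • (u : H)) →
      (⟪T x, x - T x⟫_ℂ).re = (⟪(u : H), h u⟫_ℂ).re + m * ‖(u : H)‖ ^ 2 := by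
    rintro x u rfl
    rw [hT, add_sub_cancel_left, inner_add_right, inner_smul_right, Complex.add_re,
      Complex.re_ofReal_mul]
    congr 2
    exact inner_self_eq_norm_sq (𝕜 := ℂ) _
  have hQD : ∀ u : h.domain,
      ENNReal.ofReal ((⟪(u : H), h u⟫_ℂ).re + m * ‖(u : H)‖ ^ 2) = Q u := by
    intro u
    rw [← hq _ u rfl, ← hC.tsum_apply_T, hT]
  have hlsc : LowerSemicontinuous Q := lowerSemicontinuous_tsum fun n =>
    Continuous.lowerSemicontinuous (by fun_prop)
  unfold opForm
  refine le_antisymm ?_ ?_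
  · refine ENNReal.le_of_forall_pos_le_add fun ε hε hfin => ?_
    refine Filter.liminf_le_of_frequently_le' ?_
    rw [Filter.frequently_iff]
    intro U hU
    obtain ⟨W, hW, hWU⟩ := Filter.mem_comap.1 hU
    obtain ⟨O, hOW, hO, hfO⟩ := mem_nhds_iff.1 hW
    have hlim : Filter.Tendsto (fun N => f - (C ^ (N + N)) f) Filter.atTop (nhds f) := by
      have h1 := hC.tendsto_pow_zero hd f
      have h2 : Filter.Tendsto (fun N : ℕ => N + N) Filter.atTop Filter.atTop :=
        Filter.tendsto_atTop_mono (fun N => Nat.le_add_left N N) Filter.tendsto_id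
      simpa using (h1.comp h2).const_sub f
    obtain ⟨N, hN⟩ := (hlim.eventually (hO.mem_nhds hfO)).exists
    obtain ⟨x, hx⟩ := hC.exists_range_approx N f
    have hle : ENNReal.ofReal (⟪T x, x - T x⟫_ℂ).re ≤ Q f := by
      rw [← hC.tsum_apply_T, hx]
      exact hC.tsum_approx_le N f
    -- The vector x need not be in the image of 1 + h + m. That image is dense and both conditions
    -- are open in y, so a nearby point of the image serves.
    have hopen : IsOpen {y : H | T y ∈ O ∧ ENNReal.ofReal (⟪T y, y - T y⟫_ℂ).re < Q f + ε} := by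
      refine IsOpen.and (hO.preimage T.continuous) (isOpen_lt ?_ continuous_const)
      refine ENNReal.continuous_ofReal.comp (Complex.continuous_re.comp ?_)
      exact T.continuous.inner (continuous_id.sub T.continuous)
    obtain ⟨u, hu1, hu2⟩ := hL.exists_mem_open hopen ⟨x, by rw [hx]; exact hN,
      hle.trans_lt (ENNReal.lt_add_right hfin.ne (by simpa using hε.ne'))⟩
    refine ⟨u, hWU (hOW ?_), ?_⟩
    · rwa [hT] at hu1
    · rw [← hq _ u rfl]
      exact hu2.le
  · simp_rw [hQD]
    have h1 : Q f ≤ Filter.liminf Q (nhds f) := LowerSemicontinuousAt.le_liminf (hlsc f)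
    refine h1.trans ?_
    calc Filter.liminf Q (nhds f)
        ≤ Filter.liminf Q (Filter.map (fun g : h.domain => (g : H))
            (Filter.comap (fun g : h.domain => (g : H)) (nhds f))) :=
          Filter.liminf_le_liminf_of_le Filter.map_comap_le
      _ = _ := by rw [Filter.liminf, Filter.liminf, Filter.map_map]; rfl

theorem symm_of_isSelfAdjoint_closure (hdense : Dense (h.domain : Set H))
    (hsa : IsSelfAdjoint h.closure) (u v : h.domain) : ⟪h u, (v : H)⟫_ℂ = ⟪(u : H), h v⟫_ℂ := by
  have hle := LinearPMap.le_closure h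
  have hd : Dense (h.closure.domain : Set H) := hdense.mono hle.1
  have hfa := LinearPMap.adjoint_isFormalAdjoint hd
  rw [LinearPMap.isSelfAdjoint_def.1 hsa] at hfa
  have := hfa ⟨u, hle.1 u.2⟩ ⟨v, hle.1 v.2⟩
  rw [hle.2 (x := u) (y := ⟨u, hle.1 u.2⟩) rfl, hle.2 (x := v) (y := ⟨v, hle.1 v.2⟩) rfl]
  exact this

theorem closure_form_nonneg (hcl : h.IsClosable)
    (hbdd : ∀ f : h.domain, 0 ≤ (⟪(f : H), h f⟫_ℂ).re + m * ‖(f : H)‖ ^ 2)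
    (u : h.closure.domain) : 0 ≤ (⟪(u : H), h.closure u⟫_ℂ).re + m * ‖(u : H)‖ ^ 2 := by
  have hmem : ((u : H), h.closure u) ∈ h.closure.graph := LinearPMap.mem_graph _ u
  rw [← hcl.graph_closure_eq_closure_graph] at hmem
  have hclosed : IsClosed {p : H × H | 0 ≤ (⟪p.1, p.2⟫_ℂ).re + m * ‖p.1‖ ^ 2} :=
    isClosed_le continuous_const (by fun_prop)
  have hsub : (h.graph : Set (H × H)) ⊆ {p : H × H | 0 ≤ (⟪p.1, p.2⟫_ℂ).re + m * ‖p.1‖ ^ 2} := by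
    rintro ⟨x, y⟩ hxy
    obtain ⟨w, hw1, hw2⟩ := (LinearPMap.mem_graph_iff h).1 hxy
    simp only at hw1 hw2
    subst hw1 hw2
    exact hbdd w
  exact closure_minimal hsub hclosed hmem

/-- A vector g orthogonal to the range lies in the domain of the adjoint of the closure, that is, of
the closure itself, and is an eigenvector with eigenvalue -(1 + m). The lower bound -m then forces g
= 0. Essential self-adjointness is used in full here; elsewhere only symmetry is drawn from it. -/
theorem denseRange_one_add (hdense : Dense (h.domain : Set H)) (hsa : IsSelfAdjoint h.closure)
    (hbdd : ∀ f : h.domain, 0 ≤ (⟪(f : H), h f⟫_ℂ).re + m * ‖(f : H)‖ ^ 2) :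
    DenseRange fun u : h.domain => (u : H) + (h u + (m : ℂ) • (u : H)) := by
  have hle := LinearPMap.le_closure h
  have hcl : h.IsClosable := hsa.isClosed.isClosable.leIsClosable hle
  let L : h.domain →ₗ[ℂ] H := h.domain.subtype + (h.toFun + (m : ℂ) • h.domain.subtype)
  change Dense (Set.range L)
  rw [← LinearMap.coe_range, Submodule.dense_iff_topologicalClosure_eq_top,
    Submodule.topologicalClosure_eq_top_iff,
    Submodule.eq_bot_iff]
  intro g hg
  have horth : ∀ u : h.domain, ⟪(u : H) + (h u + (m : ℂ) • (u : H)), g⟫_ℂ = 0 :=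
    fun u => hg _ ⟨u, rfl⟩
  have hd : Dense (h.closure.domain : Set H) := hdense.mono hle.1
  have horth' : ∀ u : h.closure.domain, ⟪-((1 + m : ℂ) • g), (u : H)⟫_ℂ = ⟪g, h.closure u⟫_ℂ := by
    intro u
    have hmem : ((u : H), h.closure u) ∈ h.closure.graph := LinearPMap.mem_graph _ u
    rw [← hcl.graph_closure_eq_closure_graph] at hmem
    have hclosed : IsClosed {p : H × H | ⟪-((1 + m : ℂ) • g), p.1⟫_ℂ = ⟪g, p.2⟫_ℂ} :=
      isClosed_eq (by fun_prop) (by fun_prop)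
    refine closure_minimal ?_ hclosed hmem
    rintro ⟨x, y⟩ hxy
    obtain ⟨w, hw1, hw2⟩ := (LinearPMap.mem_graph_iff h).1 hxy
    simp only at hw1 hw2
    subst hw1 hw2
    have h1 := congrArg (starRingEnd ℂ) (horth w)
    rw [inner_conj_symm, map_zero, inner_add_right, inner_add_right, inner_smul_right] at h1
    simp only [Set.mem_ofPred_eq]
    rw [inner_neg_left, inner_smul_left, map_add, map_one, Complex.conj_ofReal]
    linear_combination -h1
  have hgd : g ∈ h.closure.adjoint.domain :=
    LinearPMap.mem_adjoint_domain_of_exists _ ⟨_, horth'⟩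
  have hag : h.closure.adjoint ⟨g, hgd⟩ = -((1 + m : ℂ) • g) :=
    LinearPMap.adjoint_apply_eq hd ⟨g, hgd⟩ horth'
  have hsa' := LinearPMap.isSelfAdjoint_def.1 hsa
  have hgd' : g ∈ h.closure.domain := hsa' ▸ hgd
  have hag' : h.closure ⟨g, hgd'⟩ = -((1 + m : ℂ) • g) := by
    rw [← hag]
    exact (hsa'.le.2 (x := ⟨g, hgd⟩) (y := ⟨g, hgd'⟩) rfl).symm
  have hnn := closure_form_nonneg hcl hbdd ⟨g, hgd'⟩
  rw [hag', inner_neg_right, inner_smul_right] at hnn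
  simp only at hnn
  rw [inner_self_eq_norm_sq_to_K (𝕜 := ℂ)] at hnn
  have h5 : (-((1 + (m : ℂ)) * ((‖g‖ : ℂ)) ^ 2)).re = -((1 + m) * ‖g‖ ^ 2) := by
    rw [← Complex.ofReal_one, ← Complex.ofReal_add, ← Complex.ofReal_pow, ← Complex.ofReal_mul,
      ← Complex.ofReal_neg, Complex.ofReal_re]
  have h6 : 0 ≤ -((1 + m) * ‖g‖ ^ 2) + m * ‖g‖ ^ 2 := by rw [← h5]; exact hnn
  have : ‖g‖ = 0 := by nlinarith [norm_nonneg g]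
  exact norm_eq_zero.1 this

/-- Semiboundedness gives ‖u‖ ≤ ‖(1 + h + m)u‖, so u depends boundedly on (1 + h + m)u and the
dependence extends from the dense range to all of H. The order bounds pass to the limit. -/
theorem exists_resolvent (hdense : Dense (h.domain : Set H)) (hsa : IsSelfAdjoint h.closure)
    (hbdd : ∀ f : h.domain, 0 ≤ (⟪(f : H), h f⟫_ℂ).re + m * ‖(f : H)‖ ^ 2) :
    ∃ T : H →L[ℂ] H, 0 ≤ T ∧ T ≤ 1 ∧
      ∀ u : h.domain, T ((u : H) + (h u + (m : ℂ) • (u : H))) = u := by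
  have hL := denseRange_one_add hdense hsa hbdd
  let L : h.domain →ₗ[ℂ] H := h.domain.subtype + (h.toFun + (m : ℂ) • h.domain.subtype)
  have hLd : DenseRange L := hL
  have hLa : ∀ u : h.domain, L u = (u : H) + (h u + (m : ℂ) • (u : H)) := fun u => rfl
  have hin : ∀ u : h.domain, (⟪(u : H), L u⟫_ℂ).re =
      ‖(u : H)‖ ^ 2 + ((⟪(u : H), h u⟫_ℂ).re + m * ‖(u : H)‖ ^ 2) := by
    intro u
    have h2 : (⟪(u : H), (u : H)⟫_ℂ).re = ‖(u : H)‖ ^ 2 := inner_self_eq_norm_sq (𝕜 := ℂ) _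
    rw [hLa, inner_add_right, inner_add_right, inner_smul_right, Complex.add_re, Complex.add_re,
      Complex.re_ofReal_mul, h2]
  have hnorm : ∀ u : h.domain, ‖h.domain.subtype u‖ ≤ 1 * ‖L u‖ := by
    intro u
    have h1 : (⟪(u : H), L u⟫_ℂ).re ≤ ‖(u : H)‖ * ‖L u‖ :=
      (Complex.re_le_norm _).trans (norm_inner_le_norm _ _)
    rw [hin] at h1
    have h2 := hbdd u
    rw [one_mul, Submodule.subtype_apply]
    by_contra! hlt
    nlinarith [norm_nonneg (u : H), norm_nonneg (L u)]
  set T := h.domain.subtype.extendOfNorm L with hTdef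
  have hT : ∀ u : h.domain, T (L u) = u :=
    fun u => LinearMap.extendOfNorm_eq hLd ⟨1, hnorm⟩ u
  have hsymL : ∀ u v : h.domain, ⟪L u, (v : H)⟫_ℂ = ⟪(u : H), L v⟫_ℂ := by
    intro u v
    rw [hLa, hLa, inner_add_left, inner_add_right, inner_add_left, inner_add_right,
      inner_smul_left, inner_smul_right, Complex.conj_ofReal,
      symm_of_isSelfAdjoint_closure hdense hsa]
  have hsymm : ∀ x y, ⟪T x, y⟫_ℂ = ⟪x, T y⟫_ℂ := by
    intro x y
    refine hLd.induction_on₂ (p := fun x y => ⟪T x, y⟫_ℂ = ⟪x, T y⟫_ℂ) ?_ ?_ x y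
    · exact isClosed_eq (by fun_prop) (by fun_prop)
    · intro u v
      rw [hT, hT, hsymL]
  have hbounds : ∀ x, 0 ≤ (⟪x, T x⟫_ℂ).re ∧ (⟪x, T x⟫_ℂ).re ≤ (⟪x, x⟫_ℂ).re := by
    intro x
    refine hLd.induction_on
      (p := fun x => 0 ≤ (⟪x, T x⟫_ℂ).re ∧ (⟪x, T x⟫_ℂ).re ≤ (⟪x, x⟫_ℂ).re) x ?_ ?_
    · have h1 : Continuous fun x => (⟪x, T x⟫_ℂ).re :=
        Complex.continuous_re.comp (continuous_id.inner T.continuous)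
      have h2 : Continuous fun x : H => (⟪x, x⟫_ℂ).re :=
        Complex.continuous_re.comp (continuous_id.inner continuous_id)
      exact (isClosed_le continuous_const h1).and (isClosed_le h1 h2)
    · intro u
      rw [hT, hsymL, hin]
      have h0 := hbdd u
      refine ⟨by positivity, ?_⟩
      have h3 : (⟪L u, L u⟫_ℂ).re = ‖L u‖ ^ 2 := inner_self_eq_norm_sq (𝕜 := ℂ) _
      rw [← hin, h3]
      have h1 : (⟪(u : H), L u⟫_ℂ).re ≤ ‖(u : H)‖ * ‖L u‖ :=
        (Complex.re_le_norm _).trans (norm_inner_le_norm _ _)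
      have h4 := hnorm u
      rw [one_mul, Submodule.subtype_apply] at h4
      nlinarith [norm_nonneg (L u)]
  refine ⟨T, ?_, ?_, hT⟩
  · rw [ContinuousLinearMap.nonneg_iff_isPositive, ContinuousLinearMap.isPositive_def']
    refine ⟨ContinuousLinearMap.isSelfAdjoint_iff_isSymmetric.2 hsymm, fun x => ?_⟩
    rw [ContinuousLinearMap.reApplyInnerSelf_apply, hsymm]
    exact (hbounds x).1
  · rw [ContinuousLinearMap.le_def, ContinuousLinearMap.isPositive_def']
    refine ⟨ContinuousLinearMap.isSelfAdjoint_iff_isSymmetric.2 fun x y => ?_, fun x => ?_⟩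
    · change ⟪x - T x, y⟫_ℂ = ⟪x, y - T y⟫_ℂ
      rw [inner_sub_left, inner_sub_right, hsymm]
    · rw [ContinuousLinearMap.reApplyInnerSelf_apply]
      change 0 ≤ (⟪x - T x, x⟫_ℂ).re
      rw [inner_sub_left, hsymm, Complex.sub_re]
      linarith [(hbounds x).2]

/-- Parseval applied to each ‖C^{n+1}f‖² gives φ_(n,i) = C^{n+1}b_i. In this shape the form is
second-quantized term by term, |φ_k⟩⟨φ_k| becoming c*(φ_k)c(φ_k), and no domain questions remain. -/
theorem exists_opForm_eq_tsum (hdense : Dense (h.domain : Set H)) (hsa : IsSelfAdjoint h.closure)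
    (hbdd : ∀ f : h.domain, 0 ≤ (⟪(f : H), h f⟫_ℂ).re + m * ‖(f : H)‖ ^ 2)
    {ι : Type*} (b : HilbertBasis ι ℂ H) :
    ∃ φ : ℕ × ι → H, ∀ f, opForm h m f = ∑' k, ‖⟪φ k, f⟫_ℂ‖ₑ ^ 2 := by
  obtain ⟨T, h0, h1, hT⟩ := exists_resolvent hdense hsa hbdd
  have hC := isComplPair_opSqrt h0 h1
  have hd : DenseRange T := by
    refine hdense.mono ?_
    intro u hu
    exact ⟨_, hT ⟨u, hu⟩⟩
  refine ⟨fun k => (opSqrt (1 - T) ^ (k.1 + 1)) (b k.2), fun f => ?_⟩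
  rw [opForm_eq_tsum_pow hC hd (denseRange_one_add hdense hsa hbdd) hT, ENNReal.tsum_prod']
  refine tsum_congr fun n => ?_
  rw [← tsum_enorm_inner_sq b]
  refine tsum_congr fun i => ?_
  simp only [inner_pow_of_symm hC.symm]

end Resolvent

end BHF

namespace BHF

set_option linter.unusedSectionVars false

/-! ### Square-integrable functions on products -/

theorem eLpNorm_two_sq {X : Type*} [MeasurableSpace X] {μ : Measure X} (f : X → ℂ) :
    eLpNorm f 2 μ ^ 2 = ∫⁻ x, ‖f x‖ₑ ^ 2 ∂μ := by
  have := eLpNorm_nnreal_pow_eq_lintegral (μ := μ) (f := f) (p := 2) (by norm_num)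
  simpa using this

theorem memLp_two_iff {X : Type*} [MeasurableSpace X] {μ : Measure X} {f : X → ℂ}
    (hf : AEStronglyMeasurable f μ) : MemLp f 2 μ ↔ ∫⁻ x, ‖f x‖ₑ ^ 2 ∂μ ≠ ∞ := by
  rw [← eLpNorm_two_sq, ne_eq, ENNReal.pow_eq_top_iff, MemLp]
  simp [hf, lt_top_iff_ne_top]

theorem enorm_sq_eq_lintegral {X : Type*} [MeasurableSpace X] {μ : Measure X} (f : Lp ℂ 2 μ) :
    ‖f‖ₑ ^ 2 = ∫⁻ x, ‖f x‖ₑ ^ 2 ∂μ := by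
  rw [Lp.enorm_def, eLpNorm_two_sq]

section Tensor

variable {M X : Type*} [MeasurableSpace M] [MeasurableSpace X] {ν : Measure M} {μ : Measure X}
  [SigmaFinite ν] [SigmaFinite μ]

theorem aestronglyMeasurable_tens (f : Lp ℂ 2 ν) (g : Lp ℂ 2 μ) :
    AEStronglyMeasurable (fun p : M × X => f p.1 * g p.2) (ν.prod μ) :=
  ((Lp.stronglyMeasurable f).comp_measurable measurable_fst).aestronglyMeasurable.mul
    ((Lp.stronglyMeasurable g).comp_measurable measurable_snd).aestronglyMeasurable

theorem lintegral_tens (f : Lp ℂ 2 ν) (g : Lp ℂ 2 μ) :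
    ∫⁻ p : M × X, ‖f p.1 * g p.2‖ₑ ^ 2 ∂(ν.prod μ) = ‖f‖ₑ ^ 2 * ‖g‖ₑ ^ 2 := by
  simp_rw [enorm_mul, mul_pow]
  rw [lintegral_prod_mul (f := fun x => ‖f x‖ₑ ^ 2) (g := fun x => ‖g x‖ₑ ^ 2)
    ((Lp.stronglyMeasurable f).measurable.enorm.pow_const 2).aemeasurable
    ((Lp.stronglyMeasurable g).measurable.enorm.pow_const 2).aemeasurable,
    ← enorm_sq_eq_lintegral, ← enorm_sq_eq_lintegral]

theorem memLp_tens (f : Lp ℂ 2 ν) (g : Lp ℂ 2 μ) :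
    MemLp (fun p : M × X => f p.1 * g p.2) 2 (ν.prod μ) := by
  rw [memLp_two_iff (aestronglyMeasurable_tens f g), lintegral_tens]
  exact ENNReal.mul_ne_top (by simp) (by simp)

theorem enorm_toLp_tens (f : Lp ℂ 2 ν) (g : Lp ℂ 2 μ) :
    ‖(memLp_tens f g).toLp‖ₑ = ‖f‖ₑ * ‖g‖ₑ := by
  refine (ENNReal.pow_right_strictMono two_ne_zero).injective ?_
  rw [mul_pow, ← lintegral_tens, enorm_sq_eq_lintegral]
  refine lintegral_congr_ae ?_
  filter_upwards [(memLp_tens f g).coeFn_toLp] with p hp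
  rw [hp]

theorem norm_toLp_tens (f : Lp ℂ 2 ν) (g : Lp ℂ 2 μ) :
    ‖(memLp_tens f g).toLp‖ = ‖f‖ * ‖g‖ := by
  simpa using congrArg ENNReal.toReal (enorm_toLp_tens f g)

theorem ae_fst {p : M → Prop} (h : ∀ᵐ x ∂ν, p x) : ∀ᵐ z ∂(ν.prod μ), p z.1 :=
  Measure.quasiMeasurePreserving_fst.ae h

theorem ae_snd {p : X → Prop} (h : ∀ᵐ x ∂μ, p x) : ∀ᵐ z ∂(ν.prod μ), p z.2 :=
  Measure.quasiMeasurePreserving_snd.ae h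

/-- Tensoring with a fixed vector on the left. -/
noncomputable def tens (f : Lp ℂ 2 ν) : Lp ℂ 2 μ →L[ℂ] Lp ℂ 2 (ν.prod μ) :=
  LinearMap.mkContinuous
    { toFun := fun g => (memLp_tens f g).toLp
      map_add' := fun g g' => by
        rw [← MemLp.toLp_add]
        refine MemLp.toLp_congr _ _ ?_
        filter_upwards [ae_snd (ν := ν) (Lp.coeFn_add g g')] with p hp
        simp only [Pi.add_apply] at hp ⊢
        rw [hp, mul_add]
      map_smul' := fun c g => by
        rw [RingHom.id_apply, ← MemLp.toLp_const_smul]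
        refine MemLp.toLp_congr _ _ ?_
        filter_upwards [ae_snd (ν := ν) (Lp.coeFn_smul c g)] with p hp
        simp only [Pi.smul_apply, smul_eq_mul] at hp ⊢
        rw [hp]
        ring }
    ‖f‖ (fun g => (norm_toLp_tens f g).le)

theorem tens_ae (f : Lp ℂ 2 ν) (g : Lp ℂ 2 μ) :
    (tens f g : M × X → ℂ) =ᵐ[ν.prod μ] fun p => f p.1 * g p.2 :=
  (memLp_tens f g).coeFn_toLp

theorem norm_tens (f : Lp ℂ 2 ν) (g : Lp ℂ 2 μ) : ‖tens f g‖ = ‖f‖ * ‖g‖ :=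
  norm_toLp_tens f g

theorem inner_tens_tens (f f' : Lp ℂ 2 ν) (g g' : Lp ℂ 2 μ) :
    ⟪tens f g, tens f' g'⟫_ℂ = ⟪f, f'⟫_ℂ * ⟪g, g'⟫_ℂ := by
  simp only [L2.inner_def]
  rw [← integral_prod_mul]
  refine integral_congr_ae ?_
  filter_upwards [tens_ae f g, tens_ae f' g'] with p h1 h2
  simp only [h1, h2, RCLike.inner_apply, map_mul]
  ring

/-- Contraction of the first variable with a fixed vector, the adjoint of `tens`. -/
noncomputable def contr (f : Lp ℂ 2 ν) : Lp ℂ 2 (ν.prod μ) →L[ℂ] Lp ℂ 2 μ :=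
  ContinuousLinearMap.adjoint (tens f)

theorem contr_tens (f g : Lp ℂ 2 ν) (h : Lp ℂ 2 μ) : contr f (tens g h) = ⟪f, g⟫_ℂ • h := by
  refine ext_inner_left ℂ fun v => ?_
  rw [contr, ContinuousLinearMap.adjoint_inner_right, inner_tens_tens, inner_smul_right]

theorem memLp_slice (F : Lp ℂ 2 (ν.prod μ)) : ∀ᵐ y ∂μ, MemLp (fun x => F (x, y)) 2 ν := by
  have hm := Lp.stronglyMeasurable F
  have h : ∫⁻ y, ∫⁻ x, ‖F (x, y)‖ₑ ^ 2 ∂ν ∂μ ≠ ∞ := by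
    rw [← lintegral_prod_symm' (fun p => ‖F p‖ₑ ^ 2) (hm.measurable.enorm.pow_const 2),
      ← enorm_sq_eq_lintegral]
    simp
  have h2 := ae_lt_top (Measurable.lintegral_prod_left' (hm.measurable.enorm.pow_const 2)) h
  filter_upwards [h2] with y hy
  exact (memLp_two_iff (hm.comp_measurable measurable_prodMk_right).aestronglyMeasurable).2 hy.ne

theorem integral_inner_slice (f : Lp ℂ 2 ν) {u : M → ℂ} (hu : MemLp u 2 ν) :
    ∫ x, ⟪f x, u x⟫_ℂ ∂ν = ⟪f, hu.toLp⟫_ℂ := by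
  rw [L2.inner_def]
  refine integral_congr_ae ?_
  filter_upwards [hu.coeFn_toLp] with x hx
  rw [hx]

theorem stronglyMeasurable_contrFun (f : Lp ℂ 2 ν) (F : Lp ℂ 2 (ν.prod μ)) :
    StronglyMeasurable fun y => ∫ x, ⟪f x, F (x, y)⟫_ℂ ∂ν := by
  have : StronglyMeasurable fun p : M × X => ⟪f p.1, F p⟫_ℂ :=
    ((Lp.stronglyMeasurable f).comp_measurable measurable_fst).inner (Lp.stronglyMeasurable F)
  exact this.integral_prod_left'

theorem memLp_contrFun (f : Lp ℂ 2 ν) (F : Lp ℂ 2 (ν.prod μ)) :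
    MemLp (fun y => ∫ x, ⟪f x, F (x, y)⟫_ℂ ∂ν) 2 μ := by
  rw [memLp_two_iff (stronglyMeasurable_contrFun f F).aestronglyMeasurable]
  have h : ∫⁻ y, ‖∫ x, ⟪f x, F (x, y)⟫_ℂ ∂ν‖ₑ ^ 2 ∂μ ≤
      ∫⁻ y, ‖f‖ₑ ^ 2 * ∫⁻ x, ‖F (x, y)‖ₑ ^ 2 ∂ν ∂μ := by
    refine lintegral_mono_ae ?_
    filter_upwards [memLp_slice F] with y hy
    rw [integral_inner_slice f hy, ← eLpNorm_two_sq, ← Lp.enorm_toLp hy, ← mul_pow]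
    gcongr
    rw [← ofReal_norm, ← ofReal_norm, ← ofReal_norm, ← ENNReal.ofReal_mul (norm_nonneg _)]
    exact ENNReal.ofReal_le_ofReal (norm_inner_le_norm _ _)
  refine ne_top_of_le_ne_top ?_ h
  have hm : Measurable fun p => ‖F p‖ₑ ^ 2 :=
    (Lp.stronglyMeasurable F).measurable.enorm.pow_const 2
  rw [lintegral_const_mul _ hm.lintegral_prod_left', ← lintegral_prod_symm' _ hm,
    ← enorm_sq_eq_lintegral]
  exact ENNReal.mul_ne_top (by simp) (by simp)

/-- Testing the adjoint of `tens f` against g and using Fubini identifies it with the partial inner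
product of the slices. -/
theorem contr_ae (f : Lp ℂ 2 ν) (F : Lp ℂ 2 (ν.prod μ)) :
    (contr f F : X → ℂ) =ᵐ[μ] fun y => ∫ x, ⟪f x, F (x, y)⟫_ℂ ∂ν := by
  have : contr f F = (memLp_contrFun f F).toLp := by
    refine ext_inner_left ℂ fun g => ?_
    rw [contr, ContinuousLinearMap.adjoint_inner_right, ← integral_inner_slice]
    have h1 := L2.integrable_inner (𝕜 := ℂ) (tens f g) F
    rw [L2.inner_def]
    have h2 : (fun p => ⟪tens f g p, F p⟫_ℂ) =ᵐ[ν.prod μ]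
        fun p => ⟪g p.2, 1⟫_ℂ * ⟪f p.1, F p⟫_ℂ := by
      filter_upwards [tens_ae f g] with p hp
      simp only [hp, RCLike.inner_apply, map_mul]
      ring
    rw [integral_congr_ae h2, integral_prod_symm _ (h1.congr h2)]
    refine integral_congr_ae (Filter.Eventually.of_forall fun y => ?_)
    simp only [RCLike.inner_apply, one_mul]
    rw [integral_const_mul, mul_comm]
  rw [this]
  exact (memLp_contrFun f F).coeFn_toLp

/-- A quadratic functional `Q = ∑ₖ |⟨φₖ, ·⟩|²` applied to the slices of `F`. -/
theorem lintegral_slice_form {κ : Type*} [Countable κ] (φ : κ → Lp ℂ 2 ν) {g : X → ℝ≥0∞}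
    (hg : Measurable g) (F : Lp ℂ 2 (ν.prod μ)) {q : X → ℝ≥0∞}
    (hq : ∀ᵐ y ∂μ, ∀ hu : MemLp (fun x => F (x, y)) 2 ν,
      q y = ∑' k, ‖⟪φ k, hu.toLp⟫_ℂ‖ₑ ^ 2) :
    ∫⁻ y, g y * q y ∂μ = ∑' k, ∫⁻ y, g y * ‖contr (φ k) F y‖ₑ ^ 2 ∂μ := by
  have hm : ∀ k, AEMeasurable (fun y => g y * ‖contr (φ k) F y‖ₑ ^ 2) μ := fun k =>
    (hg.mul ((Lp.stronglyMeasurable (contr (φ k) F)).measurable.enorm.pow_const 2)).aemeasurable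
  rw [← lintegral_tsum hm]
  refine lintegral_congr_ae ?_
  filter_upwards [memLp_slice F, hq, ae_all_iff.2 fun k => contr_ae (φ k) F] with y hy h1 h2
  rw [h1 hy, ENNReal.tsum_mul_left]
  congr 1
  refine tsum_congr fun k => ?_
  rw [h2 k, integral_inner_slice _ hy]

end Tensor

/-! ### Cutting off by indicator functions -/

section Cut

variable {M : Type*} [MeasurableSpace M] {ν : Measure M}

/-- The product `1_A f`. -/
noncomputable def cut {A : Set M} (hA : MeasurableSet A) (f : Lp ℂ 2 ν) : Lp ℂ 2 ν :=
  ((Lp.memLp f).indicator hA).toLp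

theorem cut_ae {A : Set M} (hA : MeasurableSet A) (f : Lp ℂ 2 ν) :
    (cut hA f : M → ℂ) =ᵐ[ν] A.indicator f :=
  MemLp.coeFn_toLp _

theorem inner_cut {A : Set M} (hA : MeasurableSet A) (f g : Lp ℂ 2 ν) :
    ⟪cut hA f, g⟫_ℂ = ⟪f, cut hA g⟫_ℂ := by
  rw [L2.inner_def, L2.inner_def]
  refine integral_congr_ae ?_
  filter_upwards [cut_ae hA f, cut_ae hA g] with x h1 h2
  rw [h1, h2]
  by_cases hx : x ∈ A <;> simp [hx]

theorem enorm_cut_sq {A : Set M} (hA : MeasurableSet A) (f : Lp ℂ 2 ν) :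
    ‖cut hA f‖ₑ ^ 2 = ∫⁻ x in A, ‖f x‖ₑ ^ 2 ∂ν := by
  rw [enorm_sq_eq_lintegral, ← lintegral_indicator hA]
  refine lintegral_congr_ae ?_
  filter_upwards [cut_ae hA f] with x h1
  rw [h1]
  by_cases hx : x ∈ A <;> simp [hx]

/-- The cut-off moves to f, and Parseval applies to 1_A f. Families 1_A e_p thus convert indicator
weights into sums over one-particle vectors, which annihilation operators can absorb. -/
theorem tsum_inner_cut {κ : Type*} (e : HilbertBasis κ ℂ (Lp ℂ 2 ν)) {A : Set M}
    (hA : MeasurableSet A) (f : Lp ℂ 2 ν) :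
    ∑' p, ‖⟪cut hA (e p), f⟫_ℂ‖ₑ ^ 2 = ∫⁻ x in A, ‖f x‖ₑ ^ 2 ∂ν := by
  simp_rw [inner_cut, tsum_enorm_inner_sq, enorm_cut_sq]

variable {X : Type*} [MeasurableSpace X] {μ : Measure X} [SigmaFinite ν] [SigmaFinite μ]

theorem tsum_lintegral_contr_cut {κ : Type*} [Countable κ] (e : HilbertBasis κ ℂ (Lp ℂ 2 ν))
    {A : Set M} (hA : MeasurableSet A) {g : X → ℝ≥0∞} (hg : Measurable g)
    (F : Lp ℂ 2 (ν.prod μ)) :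
    ∑' p, ∫⁻ y, g y * ‖contr (cut hA (e p)) F y‖ₑ ^ 2 ∂μ =
      ∫⁻ z, A.indicator 1 z.1 * g z.2 * ‖F z‖ₑ ^ 2 ∂(ν.prod μ) := by
  have hm : Measurable fun z => ‖F z‖ₑ ^ 2 :=
    (Lp.stronglyMeasurable F).measurable.enorm.pow_const 2
  have hA1 : Measurable (A.indicator (1 : M → ℝ≥0∞)) := measurable_one.indicator hA
  rw [← lintegral_slice_form (fun p => cut hA (e p)) hg F
    (q := fun y => ∫⁻ x, A.indicator 1 x * ‖F (x, y)‖ₑ ^ 2 ∂ν),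
    lintegral_prod_symm' _ (by fun_prop)]
  · refine lintegral_congr fun y => ?_
    rw [← lintegral_const_mul _ (by fun_prop)]
    refine lintegral_congr fun x => ?_
    ring
  · refine Filter.Eventually.of_forall fun y hu => ?_
    rw [tsum_inner_cut, ← lintegral_indicator hA]
    refine lintegral_congr_ae ?_
    filter_upwards [hu.coeFn_toLp] with x hx
    by_cases hxA : x ∈ A <;> simp [hxA, hx]

theorem tsum_inner_tens_cut {κ : Type*} [Countable κ] (e : HilbertBasis κ ℂ (Lp ℂ 2 ν))
    {A B : Set M} (hA : MeasurableSet A) (hB : MeasurableSet B) (F : Lp ℂ 2 (ν.prod ν)) :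
    ∑' p, ∑' q, ‖⟪tens (cut hA (e p)) (cut hB (e q)), F⟫_ℂ‖ₑ ^ 2 =
      ∫⁻ z in A ×ˢ B, ‖F z‖ₑ ^ 2 ∂(ν.prod ν) := by
  have h1 : ∀ p, ∑' q, ‖⟪tens (cut hA (e p)) (cut hB (e q)), F⟫_ℂ‖ₑ ^ 2 =
      ∫⁻ y, B.indicator 1 y * ‖contr (cut hA (e p)) F y‖ₑ ^ 2 ∂ν := by
    intro p
    simp_rw [← ContinuousLinearMap.adjoint_inner_right]
    rw [tsum_inner_cut, ← lintegral_indicator hB]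
    refine lintegral_congr fun y => ?_
    by_cases hy : y ∈ B <;> simp [hy, contr]
  simp_rw [h1]
  rw [tsum_lintegral_contr_cut e hA (measurable_one.indicator hB),
    ← lintegral_indicator (hA.prod hB)]
  refine lintegral_congr fun z => ?_
  by_cases h1 : z.1 ∈ A <;> by_cases h2 : z.2 ∈ B <;> simp [h1, h2, Set.indicator]

end Cut

/-! ### Integral kernels of Hilbert–Schmidt operators -/

section Kernel

variable {M : Type*} [MeasurableSpace M] {ν : Measure M}

theorem inner_star_star (f g : Lp ℂ 2 ν) : ⟪star f, star g⟫_ℂ = ⟪g, f⟫_ℂ := by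
  rw [L2.inner_def, L2.inner_def]
  refine integral_congr_ae ?_
  filter_upwards [Lp.coeFn_star f, Lp.coeFn_star g] with x h1 h2
  rw [h1, h2]
  simp [RCLike.inner_apply, mul_comm]

theorem norm_star_Lp (f : Lp ℂ 2 ν) : ‖star f‖ = ‖f‖ := by
  rw [← sq_eq_sq₀ (norm_nonneg _) (norm_nonneg _), ← inner_self_eq_norm_sq (𝕜 := ℂ),
    ← inner_self_eq_norm_sq (𝕜 := ℂ), inner_star_star]

variable [SigmaFinite ν]

/-- The kernel is the orthogonal series ∑ conj(e_q) ⊗ T e_q, which converges because ∑ ‖T e_q‖²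
does; contracting it with conj(f) gives back ∑ ⟨e_q, f⟩ T e_q = T f. -/
theorem exists_integralKernel {κ : Type*} (e : HilbertBasis κ ℂ (OneP ν))
    (T : OneP ν →L[ℂ] OneP ν) (hT : ∑' q, ‖T (e q)‖ₑ ^ 2 ≠ ∞) :
    ∃ k, IsIntegralKernel ν k T := by
  have hs : ∀ q q', ⟪star (e q), star (e q')⟫_ℂ = ⟪e q', e q⟫_ℂ := fun q q' => inner_star_star _ _
  let V : ∀ q, OneP ν →ₗᵢ[ℂ] Lp ℂ 2 (ν.prod ν) := fun q =>
    { toLinearMap := (tens (star (e q)) : OneP ν →L[ℂ] Lp ℂ 2 (ν.prod ν)).toLinearMap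
      norm_map' := fun g => by
        have : ‖star (e q)‖ = 1 := by
          rw [norm_star_Lp, e.orthonormal.1 q]
        change ‖tens (star (e q)) g‖ = ‖g‖
        rw [norm_tens, this, one_mul] }
  have hV : OrthogonalFamily ℂ (fun _ : κ => OneP ν) V := by
    intro q q' hq g g'
    change ⟪tens (star (e q)) g, tens (star (e q')) g'⟫_ℂ = 0
    rw [inner_tens_tens, hs, e.orthonormal.2 hq.symm, zero_mul]
  have hsum : Summable fun q => V q (T (e q)) :=
    (hV.summable_iff_norm_sq_summable _).2 (summable_norm_sq_of_tsum_ne_top hT)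
  set K := ∑' q, V q (T (e q)) with hK
  have hc : ∀ f : OneP ν, contr (star f) K = T f := by
    intro f
    rw [hK, ContinuousLinearMap.map_tsum _ hsum]
    have h1 : ∀ q, contr (star f) (V q (T (e q))) = T (e.repr f q • e q) := by
      intro q
      change contr (star f) (tens (star (e q)) (T (e q))) = _
      rw [contr_tens, inner_star_star, map_smul, e.repr_apply_apply]
    simp_rw [h1]
    exact ((e.hasSum_repr f).mapL T).tsum_eq
  have hsw : Measure.map Prod.swap (ν.prod ν) = ν.prod ν := Measure.prod_swap
  refine ⟨fun x y => K (y, x), ?_, fun f => ?_⟩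
  · have : MemLp (K ∘ Prod.swap) 2 (ν.prod ν) :=
      (Lp.memLp K).comp_measurePreserving ⟨measurable_swap, hsw⟩
    exact this
  · rw [← hc f]
    filter_upwards [contr_ae (star f) K] with x hx
    rw [hx]
    refine integral_congr_ae ?_
    filter_upwards [Lp.coeFn_star f] with y hy
    rw [hy]
    simp [RCLike.inner_apply]

/-- The pairing of a Hilbert–Schmidt operator with product vectors, through its kernel. -/
theorem inner_kernel {k : M → M → ℂ} {T : OneP ν →L[ℂ] OneP ν} (hk : IsIntegralKernel ν k T)
    (a b : OneP ν) : ⟪a, T b⟫_ℂ = ⟪tens a (star b), hk.1.toLp⟫_ℂ := by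
  have h1 := L2.integrable_inner (𝕜 := ℂ) (tens a (star b)) (hk.1.toLp _)
  rw [L2.inner_def, L2.inner_def]
  have h2 : (fun p => ⟪tens a (star b) p, hk.1.toLp _ p⟫_ℂ) =ᵐ[ν.prod ν]
      fun p => ⟪a p.1, k p.1 p.2 * b p.2⟫_ℂ := by
    filter_upwards [tens_ae a (star b), hk.1.coeFn_toLp, ae_snd (ν := ν) (Lp.coeFn_star b)]
      with p h3 h4 h5
    rw [h3, h4, h5]
    simp only [RCLike.inner_apply, map_mul, Pi.star_apply, Function.uncurry, RCLike.star_def,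
      Complex.conj_conj]
    ring
  rw [integral_congr_ae h2, integral_prod _ (h1.congr h2)]
  refine integral_congr_ae ?_
  filter_upwards [hk.2 b] with x hx
  rw [hx]
  simp only [RCLike.inner_apply]
  rw [integral_mul_const]

end Kernel

end BHF

namespace BHF

set_option linter.unusedSectionVars false

theorem inner_self_ofReal {E : Type*} [NormedAddCommGroup E] [InnerProductSpace ℂ E] (u : E) :
    ⟪u, u⟫_ℂ = ((‖u‖ ^ 2 : ℝ) : ℂ) := by
  have := inner_self_eq_norm_sq_to_K (𝕜 := ℂ) u
  push_cast
  exact this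

/-! ### Slater determinants and annihilation operators on the `N`-particle spaces -/

section Sector

variable {M : Type*} [MeasurableSpace M] (ν : Measure M) [SigmaFinite ν]

theorem measurePreserving_slot (n : ℕ) (i : Fin (n + 1)) :
    MeasurePreserving (MeasurableEquiv.piFinSuccAbove (fun _ : Fin (n + 1) => M) i).symm
      (ν.prod (Measure.pi fun _ : Fin n => ν)) (Measure.pi fun _ : Fin (n + 1) => ν) :=
  (measurePreserving_piFinSuccAbove (fun _ => ν) i).symm

/-- An `(n+1)`-particle function as a function of its `i`-th variable and the other ones. -/
noncomputable def slot {n : ℕ} (i : Fin (n + 1)) :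
    L2N ν (n + 1) →ₗᵢ[ℂ] Lp ℂ 2 (ν.prod (Measure.pi fun _ : Fin n => ν)) :=
  Lp.compMeasurePreservingₗᵢ ℂ _ (measurePreserving_slot ν n i)

variable {ν}

theorem slot_ae {n : ℕ} (i : Fin (n + 1)) (ψ : L2N ν (n + 1)) :
    (slot ν i ψ : M × (Fin n → M) → ℂ) =ᵐ[ν.prod (Measure.pi fun _ : Fin n => ν)]
      fun p => ψ (i.insertNth (α := fun _ => M) p.1 p.2) :=
  Lp.coeFn_compMeasurePreserving ψ (measurePreserving_slot ν n i)

/-- Laplace expansion along the column of the i-th variable. The factor split off from the square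
root of (n+1)! is later cancelled by the normalization of `annN`. -/
theorem slater_insertNth {n : ℕ} (f : Fin (n + 1) → OneP ν) (i : Fin (n + 1)) (y : M)
    (x : Fin n → M) : slater ν f (i.insertNth (α := fun _ => M) y x) =
      ((Real.sqrt ((n : ℝ) + 1))⁻¹ : ℂ) *
        ∑ l : Fin (n + 1), (-1) ^ (l + i : ℕ) * (f l y * slater ν (f ∘ l.succAbove) x) := by
  rw [slater, Matrix.det_succ_column _ i, Finset.mul_sum, Finset.mul_sum]
  refine Finset.sum_congr rfl fun l _ => ?_
  have h1 : (Real.sqrt ((n + 1).factorial : ℝ) : ℂ) =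
      Real.sqrt ((n : ℝ) + 1) * Real.sqrt (n.factorial : ℝ) := by
    rw [← Complex.ofReal_mul, ← Real.sqrt_mul (by positivity), Nat.factorial_succ]
    push_cast
    rfl
  have h2 : ((Matrix.of fun a k => (f a : M → ℂ) (i.insertNth (α := fun _ => M) y x k)).submatrix
      l.succAbove i.succAbove) = Matrix.of fun a k => (f (l.succAbove a) : M → ℂ) (x k) := by
    ext a k
    simp
  rw [h1, h2, mul_inv, slater]
  simp only [Matrix.of_apply, Fin.insertNth_apply_same, Function.comp_apply]
  ring

theorem memLp_slater {N : ℕ} (f : Fin N → OneP ν) :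
    MemLp (slater ν f) 2 (Measure.pi fun _ : Fin N => ν) := by
  induction N with
  | zero =>
    have : slater ν f = fun _ => 1 := by
      ext x
      simp [slater]
    rw [this]
    have : IsFiniteMeasure (Measure.pi fun _ : Fin 0 => ν) := by
      rw [Measure.pi_of_empty]
      infer_instance
    exact memLp_const 1
  | succ n ih =>
    rw [← (measurePreserving_slot ν n 0).map_eq, (MeasurableEquiv.measurableEmbedding _).memLp_map_measure_iff]
    have : slater ν f ∘ (MeasurableEquiv.piFinSuccAbove (fun _ : Fin (n + 1) => M) 0).symm =
        fun p => ((Real.sqrt ((n : ℝ) + 1))⁻¹ : ℂ) *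
        ∑ l : Fin (n + 1), (-1) ^ (l + (0 : Fin (n + 1)) : ℕ) *
          (f l p.1 * slater ν (f ∘ l.succAbove) p.2) := by
      ext p
      rw [Function.comp_apply]
      refine Eq.trans ?_ (slater_insertNth f 0 p.1 p.2)
      rfl
    rw [this]
    have h1 : ∀ l : Fin (n + 1), MemLp (fun p : M × (Fin n → M) => (-1 : ℂ) ^ (l + (0 : Fin (n + 1)) : ℕ) *
        (f l p.1 * slater ν (f ∘ l.succAbove) p.2)) 2 (ν.prod (Measure.pi fun _ : Fin n => ν)) := by
      intro l
      have h2 : MemLp (fun p : M × (Fin n → M) => f l p.1 * slater ν (f ∘ l.succAbove) p.2) 2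
          (ν.prod (Measure.pi fun _ : Fin n => ν)) := by
        refine MemLp.ae_eq ?_ (memLp_tens (f l) (ih (f ∘ l.succAbove)).toLp)
        filter_upwards [ae_snd (ν := ν) (ih (f ∘ l.succAbove)).coeFn_toLp] with p hp
        rw [hp]
      exact h2.const_mul _
    have h3 := memLp_finsetSum Finset.univ fun l _ => h1 l
    exact h3.const_mul _

/-- The Slater determinant as an element of `L²(M^N)`. -/
noncomputable def slaterL {N : ℕ} (f : Fin N → OneP ν) : L2N ν N := (memLp_slater f).toLp

theorem slaterL_ae {N : ℕ} (f : Fin N → OneP ν) :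
    (slaterL f : (Fin N → M) → ℂ) =ᵐ[Measure.pi fun _ : Fin N => ν] slater ν f :=
  (memLp_slater f).coeFn_toLp

theorem slot_slaterL {n : ℕ} (i : Fin (n + 1)) (f : Fin (n + 1) → OneP ν) :
    slot ν i (slaterL f) = ((Real.sqrt ((n : ℝ) + 1))⁻¹ : ℂ) •
      ∑ l : Fin (n + 1), ((-1) ^ (l + i : ℕ) : ℂ) • tens (f l) (slaterL (f ∘ l.succAbove)) := by
  refine Lp.ext ?_
  have h1 : (fun p => slaterL f ((MeasurableEquiv.piFinSuccAbove
      (fun _ : Fin (n + 1) => M) i).symm p)) =ᵐ[ν.prod (Measure.pi fun _ : Fin n => ν)]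
      fun p => slater ν f ((MeasurableEquiv.piFinSuccAbove (fun _ : Fin (n + 1) => M) i).symm p) :=
    (measurePreserving_slot ν n i).quasiMeasurePreserving.ae_eq_comp (slaterL_ae f)
  have h2 : ∀ l : Fin (n + 1), ∀ᵐ p ∂(ν.prod (Measure.pi fun _ : Fin n => ν)),
      (((-1) ^ (l + i : ℕ) : ℂ) • tens (f l) (slaterL (f ∘ l.succAbove)) :
        Lp ℂ 2 (ν.prod (Measure.pi fun _ : Fin n => ν))) p =
      (-1) ^ (l + i : ℕ) * (f l p.1 * slater ν (f ∘ l.succAbove) p.2) := by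
    intro l
    filter_upwards [Lp.coeFn_smul ((-1) ^ (l + i : ℕ) : ℂ)
      (tens (f l) (slaterL (f ∘ l.succAbove)) : Lp ℂ 2 (ν.prod (Measure.pi fun _ : Fin n => ν))),
      tens_ae (f l) (slaterL (f ∘ l.succAbove)),
      ae_snd (ν := ν) (slaterL_ae (f ∘ l.succAbove))] with p h3 h4 h5
    rw [h3, Pi.smul_apply, h4, h5, smul_eq_mul]
  filter_upwards [slot_ae i (slaterL f), h1, ae_all_iff.2 h2,
    Lp.coeFn_smul ((Real.sqrt ((n : ℝ) + 1))⁻¹ : ℂ) (∑ l : Fin (n + 1),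
      ((-1) ^ (l + i : ℕ) : ℂ) • (tens (f l) (slaterL (f ∘ l.succAbove)) :
        Lp ℂ 2 (ν.prod (Measure.pi fun _ : Fin n => ν)))),
    Lp.coeFn_finsetSum Finset.univ (fun l : Fin (n + 1) =>
      ((-1) ^ (l + i : ℕ) : ℂ) • (tens (f l) (slaterL (f ∘ l.succAbove)) :
        Lp ℂ 2 (ν.prod (Measure.pi fun _ : Fin n => ν))))] with p h3 h4 h5 h6 h7
  rw [h3, h6, Pi.smul_apply, h7]
  refine h4.trans ((slater_insertNth f i p.1 p.2).trans ?_)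
  simp only [Finset.sum_apply, h5, smul_eq_mul]

/-- Contraction of the `i`-th variable with a fixed vector. -/
noncomputable def contrAt {n : ℕ} (i : Fin (n + 1)) (f : OneP ν) : L2N ν (n + 1) →L[ℂ] L2N ν n :=
  contr f ∘L (slot ν i).toContinuousLinearMap

theorem contrAt_apply {n : ℕ} (i : Fin (n + 1)) (f : OneP ν) (ψ : L2N ν (n + 1)) :
    contrAt i f ψ = contr f (slot ν i ψ) := rfl

theorem contrAt_slaterL {n : ℕ} (i : Fin (n + 1)) (f : OneP ν) (g : Fin (n + 1) → OneP ν) :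
    contrAt i f (slaterL g) = ((Real.sqrt ((n : ℝ) + 1))⁻¹ : ℂ) •
      ∑ l : Fin (n + 1), ((-1) ^ (l + i : ℕ) * ⟪f, g l⟫_ℂ) • slaterL (g ∘ l.succAbove) := by
  rw [contrAt_apply, slot_slaterL, map_smul, map_sum]
  simp_rw [map_smul, contr_tens, smul_smul]

theorem sqrt_succ_ne_zero (n : ℕ) : (Real.sqrt ((n : ℝ) + 1) : ℂ) ≠ 0 := by
  have : (0 : ℝ) < Real.sqrt ((n : ℝ) + 1) := Real.sqrt_pos.2 (by positivity)
  exact_mod_cast this.ne'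

/-- Induction on N by separating one variable. Each of the n + 1 terms in the expansion of the
second determinant yields the same Gram determinant, expanded along column l, and the n + 1 copies
cancel the two factors 1/√(n+1). -/
theorem inner_slaterL {N : ℕ} (k g : Fin N → OneP ν) :
    ⟪slaterL k, slaterL g⟫_ℂ = (Matrix.of fun i j => ⟪k i, g j⟫_ℂ).det := by
  induction N with
  | zero =>
    rw [L2.inner_def]
    have : (fun x => ⟪slaterL k x, slaterL g x⟫_ℂ) =ᵐ[Measure.pi fun _ : Fin 0 => ν]
        fun _ => (1 : ℂ) := by
      filter_upwards [slaterL_ae k, slaterL_ae g] with x h1 h2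
      rw [h1, h2]
      simp [slater]
    rw [integral_congr_ae this]
    simp [Measure.real]
  | succ n ih =>
    have hn : (0 : ℝ) < (n : ℝ) + 1 := by positivity
    rw [← (slot ν 0).inner_map_map, slot_slaterL 0 g, inner_smul_right, inner_sum]
    have h1 : ∀ l : Fin (n + 1), ⟪slot ν 0 (slaterL k),
        ((-1) ^ (l + (0 : Fin (n + 1)) : ℕ) : ℂ) • tens (g l) (slaterL (g ∘ l.succAbove))⟫_ℂ =
        ((Real.sqrt ((n : ℝ) + 1))⁻¹ : ℂ) * (Matrix.of fun i j => ⟪k i, g j⟫_ℂ).det := by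
      intro l
      rw [inner_smul_right, ← ContinuousLinearMap.adjoint_inner_left]
      change _ * ⟪contrAt 0 (g l) (slaterL k), _⟫_ℂ = _
      rw [contrAt_slaterL, inner_smul_left, sum_inner, Matrix.det_succ_column _ l,
        ← Complex.ofReal_inv, Complex.conj_ofReal, mul_left_comm, Finset.mul_sum]
      congr 1
      refine Finset.sum_congr rfl fun m _ => ?_
      rw [inner_smul_left, ih, map_mul, inner_conj_symm]
      simp only [Fin.val_zero, add_zero, map_pow, map_neg, map_one, Matrix.of_apply,
        Function.comp_apply]
      rw [pow_add, Matrix.submatrix]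
      simp only [Matrix.of_apply]
      ring
    simp_rw [h1]
    rw [Finset.sum_const, Finset.card_univ, Fintype.card_fin, nsmul_eq_mul]
    have h2 : ((Real.sqrt ((n : ℝ) + 1) : ℝ) : ℂ) * (Real.sqrt ((n : ℝ) + 1) : ℝ) =
        (n : ℂ) + 1 := by
      rw [← Complex.ofReal_mul, Real.mul_self_sqrt hn.le]
      push_cast
      rfl
    have h3 := sqrt_succ_ne_zero n
    rw [Nat.cast_add, Nat.cast_one, ← h2]
    field_simp

/-- The Slater determinant as an element of the `N`-particle space. -/
noncomputable def slat {N : ℕ} (f : Fin N → OneP ν) : antisym ν N :=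
  ⟨slaterL f, Submodule.le_topologicalClosure _ (Submodule.subset_span ⟨f, slaterL_ae f⟩)⟩

theorem antisym_inner_smul_left {N : ℕ} (c : ℂ) (u v : antisym ν N) :
    ⟪c • u, v⟫_ℂ = (starRingEnd ℂ) c * ⟪u, v⟫_ℂ := by
  change ⟪c • (u : L2N ν N), (v : L2N ν N)⟫_ℂ = _
  exact inner_smul_left _ _ _

theorem antisym_inner_smul_right {N : ℕ} (c : ℂ) (u v : antisym ν N) :
    ⟪u, c • v⟫_ℂ = c * ⟪u, v⟫_ℂ := by
  change ⟪(u : L2N ν N), c • (v : L2N ν N)⟫_ℂ = _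
  exact inner_smul_right _ _ _

theorem antisym_inner_self {N : ℕ} (u : antisym ν N) : ⟪u, u⟫_ℂ = ((‖u‖ ^ 2 : ℝ) : ℂ) :=
  inner_self_ofReal u

theorem inner_slat {N : ℕ} (k g : Fin N → OneP ν) :
    ⟪slat k, slat g⟫_ℂ = (Matrix.of fun i j => ⟪k i, g j⟫_ℂ).det := inner_slaterL k g

theorem eq_slaterL {N : ℕ} {f : Fin N → OneP ν} {Ψ : L2N ν N}
    (h : (Ψ : (Fin N → M) → ℂ) =ᵐ[Measure.pi fun _ : Fin N => ν] slater ν f) : Ψ = slaterL f :=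
  Lp.ext (h.trans (slaterL_ae f).symm)

theorem antisym_ext {N : ℕ} {F : Type*} [NormedAddCommGroup F] [NormedSpace ℂ F]
    {S T : antisym ν N →L[ℂ] F} (h : ∀ f, S (slat f) = T (slat f)) : S = T := by
  set s := Submodule.span ℂ {Ψ : L2N ν N | ∃ f : Fin N → OneP ν,
    (Ψ : (Fin N → M) → ℂ) =ᵐ[Measure.pi fun _ : Fin N => ν] slater ν f} with hs
  have hle : s ≤ antisym ν N := Submodule.le_topologicalClosure _
  have hd : DenseRange (Set.inclusion (hle : (s : Set (L2N ν N)) ⊆ antisym ν N)) :=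
    (denseRange_inclusion_iff _).2 (Submodule.topologicalClosure_coe s).le
  ext ψ
  refine congrFun (hd.equalizer S.continuous T.continuous ?_) ψ
  ext ⟨x, hx⟩
  change S ⟨x, hle hx⟩ = T ⟨x, hle hx⟩
  induction hx using Submodule.span_induction with
  | mem x hx =>
    obtain ⟨f, hf⟩ := hx
    obtain rfl := eq_slaterL hf
    exact h f
  | zero => rw [show (⟨0, hle s.zero_mem⟩ : antisym ν N) = 0 from rfl, map_zero, map_zero]
  | add x y hx hy h1 h2 =>
    rw [show (⟨x + y, hle (s.add_mem hx hy)⟩ : antisym ν N) = ⟨x, hle hx⟩ + ⟨y, hle hy⟩ from rfl,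
      map_add, map_add, h1, h2]
  | smul c x hx h1 =>
    rw [show (⟨c • x, hle (s.smul_mem c hx)⟩ : antisym ν N) = c • ⟨x, hle hx⟩ from rfl,
      map_smul, map_smul, h1]

theorem antisym_ext_inner {N : ℕ} {u v : antisym ν N}
    (h : ∀ k, ⟪slat k, u⟫_ℂ = ⟪slat k, v⟫_ℂ) : u = v := by
  have : innerSL ℂ u = innerSL ℂ v := antisym_ext fun k => by
    rw [innerSL_apply_apply, innerSL_apply_apply, ← inner_conj_symm u, ← inner_conj_symm v, h k]
  refine ext_inner_right ℂ fun w => ?_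
  simpa using congrArg (fun L : antisym ν N →L[ℂ] ℂ => L w) this

theorem contrAt_mem {n : ℕ} (i : Fin (n + 1)) (f : OneP ν) {ψ : L2N ν (n + 1)}
    (hψ : ψ ∈ antisym ν (n + 1)) : contrAt i f ψ ∈ antisym ν n := by
  have h : antisym ν (n + 1) ≤ (antisym ν n).comap (contrAt i f).toLinearMap := by
    refine Submodule.topologicalClosure_minimal _ (Submodule.span_le.2 ?_) ?_
    · rintro Ψ ⟨g, hg⟩
      obtain rfl := eq_slaterL hg
      change contrAt i f (slaterL g) ∈ antisym ν n
      rw [contrAt_slaterL]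
      exact Submodule.smul_mem _ _ (Submodule.sum_mem _ fun l _ =>
        Submodule.smul_mem _ _ (slat (g ∘ l.succAbove)).2)
    · exact (Submodule.isClosed_topologicalClosure _).preimage (contrAt i f).continuous
  exact h hψ

/-- The annihilation operator from the `(n+1)`-particle space to the `n`-particle space. -/
noncomputable def annN {n : ℕ} (f : OneP ν) : antisym ν (n + 1) →L[ℂ] antisym ν n :=
  (Real.sqrt ((n : ℝ) + 1) : ℂ) • ((contrAt 0 f ∘L (antisym ν (n + 1)).subtypeL).codRestrict
    (antisym ν n) fun ψ => contrAt_mem 0 f ψ.2)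

theorem coe_annN {n : ℕ} (f : OneP ν) (ψ : antisym ν (n + 1)) :
    (annN f ψ : L2N ν n) = (Real.sqrt ((n : ℝ) + 1) : ℂ) • contrAt 0 f (ψ : L2N ν (n + 1)) := rfl

theorem annN_slat {n : ℕ} (f : OneP ν) (g : Fin (n + 1) → OneP ν) :
    annN f (slat g) = ∑ l : Fin (n + 1), ((-1) ^ (l : ℕ) * ⟪f, g l⟫_ℂ) •
      slat (g ∘ l.succAbove) := by
  refine Subtype.ext ?_
  rw [coe_annN, AddSubmonoidClass.coe_finsetSum]
  change _ • contrAt 0 f (slaterL g) = _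
  rw [contrAt_slaterL, smul_smul, mul_inv_cancel₀ (sqrt_succ_ne_zero n), one_smul]
  rfl

/-- Antisymmetry: moving the i-th variable to the front costs (-1)^i. On Slater determinants this is
the sign in the Laplace expansion, and these determinants are total. -/
theorem contrAt_eq {n : ℕ} (i : Fin (n + 1)) (f : OneP ν) (ψ : antisym ν (n + 1)) :
    contrAt i f (ψ : L2N ν (n + 1)) =
      ((-1) ^ (i : ℕ) * (Real.sqrt ((n : ℝ) + 1) : ℂ)⁻¹) • (annN f ψ : L2N ν n) := by
  have : contrAt i f ∘L (antisym ν (n + 1)).subtypeL =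
      ((-1) ^ (i : ℕ) * (Real.sqrt ((n : ℝ) + 1) : ℂ)⁻¹) • ((antisym ν n).subtypeL ∘L annN f) := by
    refine antisym_ext fun g => ?_
    change contrAt i f (slaterL g) = ((-1) ^ (i : ℕ) * (Real.sqrt ((n : ℝ) + 1) : ℂ)⁻¹) •
      (annN f (slat g) : L2N ν n)
    rw [annN_slat, contrAt_slaterL, AddSubmonoidClass.coe_finsetSum, mul_comm, ← smul_smul,
      Finset.smul_sum (r := (-1 : ℂ) ^ (i : ℕ))]
    congr 1
    refine Finset.sum_congr rfl fun l _ => ?_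
    change ((-1 : ℂ) ^ (l + i : ℕ) * ⟪f, g l⟫_ℂ) • slaterL (g ∘ l.succAbove) =
      (-1 : ℂ) ^ (i : ℕ) • ((-1 : ℂ) ^ (l : ℕ) * ⟪f, g l⟫_ℂ) • slaterL (g ∘ l.succAbove)
    rw [smul_smul, pow_add]
    congr 1
    ring
  exact congrArg (fun L : antisym ν (n + 1) →L[ℂ] L2N ν n => L ψ) this

theorem enorm_contrAt_sq {n : ℕ} (i : Fin (n + 1)) (f : OneP ν) (ψ : antisym ν (n + 1)) :
    ((n : ℝ≥0∞) + 1) * ‖contrAt i f (ψ : L2N ν (n + 1))‖ₑ ^ 2 = ‖annN f ψ‖ₑ ^ 2 := by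
  have hn : (0 : ℝ) < (n : ℝ) + 1 := by positivity
  have h : ‖contrAt i f (ψ : L2N ν (n + 1))‖ ^ 2 = ((n : ℝ) + 1)⁻¹ * ‖annN f ψ‖ ^ 2 := by
    rw [contrAt_eq, norm_smul, mul_pow]
    congr 1
    rw [norm_mul, norm_pow, norm_neg, norm_one, one_pow, one_mul, norm_inv, Complex.norm_real,
      Real.norm_of_nonneg (Real.sqrt_nonneg _), inv_pow, Real.sq_sqrt hn.le]
  rw [enorm_sq_eq_ofReal, enorm_sq_eq_ofReal, h]
  have : ((n : ℝ≥0∞) + 1) = ENNReal.ofReal ((n : ℝ) + 1) := by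
    rw [ENNReal.ofReal_add (by positivity) (by positivity)]
    simp
  rw [this, ← ENNReal.ofReal_mul hn.le, mul_inv_cancel_left₀ hn.ne']

/-- The creation operator from the `n`-particle space to the `(n+1)`-particle space. -/
noncomputable def creN {n : ℕ} (f : OneP ν) : antisym ν n →L[ℂ] antisym ν (n + 1) :=
  ContinuousLinearMap.adjoint (annN f)

/-- Paired with another determinant, the claim is the Laplace expansion of the Gram determinant
along its column 0. -/
theorem creN_slat {n : ℕ} (f : OneP ν) (g : Fin n → OneP ν) :
    creN f (slat g) = slat (Fin.cons f g : Fin (n + 1) → OneP ν) := by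
  refine antisym_ext_inner fun k => ?_
  rw [creN, ContinuousLinearMap.adjoint_inner_right, annN_slat, sum_inner, inner_slat,
    Matrix.det_succ_column _ 0]
  refine Finset.sum_congr rfl fun l _ => ?_
  rw [antisym_inner_smul_left, inner_slat, map_mul, inner_conj_symm]
  simp only [Fin.val_zero, add_zero, map_pow, map_neg, map_one, Matrix.of_apply,
    Function.comp_apply, Fin.cons_zero, Matrix.submatrix, Fin.succAbove_zero, Fin.cons_succ]

theorem annN_creN_zero (f g : OneP ν) (ψ : antisym ν 0) : annN f (creN g ψ) = ⟪f, g⟫_ℂ • ψ := by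
  have : annN f ∘L creN g = ⟪f, g⟫_ℂ • ContinuousLinearMap.id ℂ (antisym ν 0) := by
    refine antisym_ext fun k => ?_
    simp only [ContinuousLinearMap.comp_apply, smul_apply,
      ContinuousLinearMap.id_apply]
    rw [creN_slat, annN_slat, Fin.sum_univ_succ]
    simp only [Finset.univ_eq_empty, Finset.sum_empty, add_zero, Fin.val_zero, pow_zero, one_mul,
      Fin.cons_zero]
    rw [Subsingleton.elim ((Fin.cons g k : Fin 1 → OneP ν) ∘ Fin.succAbove 0) k]
  exact congrArg (fun L : antisym ν 0 →L[ℂ] antisym ν 0 => L ψ) this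

/-- On a Slater determinant, removing the newly added g gives ⟨f, g⟩. The other terms cancel in
pairs, since putting g in front shifts the position of every k_l by one and reverses its sign. -/
theorem annN_creN {n : ℕ} (f g : OneP ν) (ψ : antisym ν (n + 1)) :
    annN f (creN g ψ) + creN g (annN f ψ) = ⟪f, g⟫_ℂ • ψ := by
  have : annN f ∘L creN g + creN g ∘L annN f =
      ⟪f, g⟫_ℂ • ContinuousLinearMap.id ℂ (antisym ν (n + 1)) := by
    refine antisym_ext fun k => ?_
    simp only [add_apply, ContinuousLinearMap.comp_apply,
      smul_apply, ContinuousLinearMap.id_apply]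
    rw [creN_slat, annN_slat, annN_slat, Fin.sum_univ_succ, map_sum, add_assoc,
      ← Finset.sum_add_distrib]
    have h0 : ((Fin.cons g k : Fin (n + 2) → OneP ν) ∘ (0 : Fin (n + 2)).succAbove) = k := by
      ext1 i
      simp
    rw [h0, Finset.sum_eq_zero]
    · simp
    · intro l _
      have hl : ((Fin.cons g k : Fin (n + 2) → OneP ν) ∘ l.succ.succAbove) =
          Fin.cons g (k ∘ l.succAbove) := by
        ext1 i
        refine Fin.cases ?_ (fun i => ?_) i <;> simp
      rw [hl, map_smul, creN_slat, ← add_smul]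
      simp only [Fin.val_succ, Fin.cons_succ, pow_succ]
      rw [show (-1 : ℂ) ^ (l : ℕ) * -1 * ⟪f, k l⟫_ℂ + (-1) ^ (l : ℕ) * ⟪f, k l⟫_ℂ = 0 by ring,
        zero_smul]
  exact congrArg (fun L : antisym ν (n + 1) →L[ℂ] antisym ν (n + 1) => L ψ) this

theorem slat_comp_perm {N : ℕ} (σ : Equiv.Perm (Fin N)) (f : Fin N → OneP ν) :
    slat (f ∘ σ) = ((Equiv.Perm.sign σ : ℤ) : ℂ) • slat f := by
  refine antisym_ext_inner fun k => ?_
  rw [antisym_inner_smul_right, inner_slat, inner_slat, ← Matrix.det_permute' σ]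
  rfl

theorem creN_creN {n : ℕ} (f g : OneP ν) (ψ : antisym ν n) :
    creN f (creN g ψ) = -creN g (creN f ψ) := by
  have : creN f ∘L creN g = -((creN g ∘L creN f : antisym ν n →L[ℂ] antisym ν (n + 2))) := by
    refine antisym_ext fun k => ?_
    simp only [neg_apply, ContinuousLinearMap.comp_apply, creN_slat]
    have h : (Fin.cons f (Fin.cons g k : Fin (n + 1) → OneP ν) : Fin (n + 2) → OneP ν) =
        (Fin.cons g (Fin.cons f k : Fin (n + 1) → OneP ν) : Fin (n + 2) → OneP ν) ∘
          Equiv.swap (0 : Fin (n + 2)) 1 := by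
      ext1 i
      refine Fin.cases ?_ (fun i => Fin.cases ?_ (fun i => ?_) i) i
      · rw [Function.comp_apply, Equiv.swap_apply_left]
        rfl
      · rw [Function.comp_apply, show (Fin.succ 0 : Fin (n + 2)) = 1 from rfl,
          Equiv.swap_apply_right]
        rfl
      · rw [Function.comp_apply, Equiv.swap_apply_of_ne_of_ne]
        · rfl
        · exact Fin.succ_ne_zero _
        · exact fun h => Fin.succ_ne_zero _ (Fin.succ_injective _ h)
    rw [h, slat_comp_perm, Equiv.Perm.sign_swap (by simp)]
    simp
  exact congrArg (fun L : antisym ν n →L[ℂ] antisym ν (n + 2) => L ψ) this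

theorem norm_annN_creN {n : ℕ} (f : OneP ν) (ψ : antisym ν (n + 1)) :
    ‖creN f ψ‖ ^ 2 + ‖annN f ψ‖ ^ 2 = ‖f‖ ^ 2 * ‖ψ‖ ^ 2 := by
  have h := congrArg (fun v => ⟪ψ, v⟫_ℂ) (annN_creN f f ψ)
  simp only [inner_add_right, antisym_inner_smul_right] at h
  have h1 : ⟪ψ, annN f (creN f ψ)⟫_ℂ = ⟪creN f ψ, creN f ψ⟫_ℂ :=
    (ContinuousLinearMap.adjoint_inner_left (annN f) _ _).symm
  have h2 : ⟪ψ, creN f (annN f ψ)⟫_ℂ = ⟪annN f ψ, annN f ψ⟫_ℂ :=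
    ContinuousLinearMap.adjoint_inner_right (annN f) _ _
  rw [h1, h2, antisym_inner_self, antisym_inner_self, antisym_inner_self,
    inner_self_ofReal] at h
  exact_mod_cast h

theorem norm_annN_le {n : ℕ} (f : OneP ν) (ψ : antisym ν (n + 1)) :
    ‖annN f ψ‖ ≤ ‖f‖ * ‖ψ‖ := by
  refine le_of_sq_le_sq ?_ (by positivity)
  rw [mul_pow, ← norm_annN_creN f ψ]
  exact le_add_of_nonneg_left (by positivity)

end Sector

end BHF

namespace BHF

set_option linter.unusedSectionVars false

/-! ### Creation and annihilation operators on Fock space -/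

section FockOperators

variable {M : Type*} [MeasurableSpace M] {ν : Measure M} [SigmaFinite ν]

theorem annN_add {n : ℕ} (f f' : OneP ν) :
    (annN (f + f') : antisym ν (n + 1) →L[ℂ] antisym ν n) = annN f + annN f' := by
  refine antisym_ext fun g => ?_
  rw [add_apply, annN_slat, annN_slat, annN_slat, ← Finset.sum_add_distrib]
  refine Finset.sum_congr rfl fun l _ => ?_
  rw [inner_add_left, mul_add, add_smul]

theorem annN_smul {n : ℕ} (c : ℂ) (f : OneP ν) :
    (annN (c • f) : antisym ν (n + 1) →L[ℂ] antisym ν n) =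
      (starRingEnd ℂ) c • (annN f : antisym ν (n + 1) →L[ℂ] antisym ν n) := by
  refine antisym_ext fun g => ?_
  rw [smul_apply, annN_slat, annN_slat]
  rw [Finset.smul_sum]
  refine Finset.sum_congr rfl fun l _ => ?_
  rw [inner_smul_left, mul_left_comm]
  exact mul_smul ((starRingEnd ℂ) c) _ (slat (g ∘ l.succAbove))

theorem Fock.hasSum_norm_sq (Ψ : Fock ν) : HasSum (fun N => ‖Ψ N‖ ^ 2) (‖Ψ‖ ^ 2) := by
  have h := lp.hasSum_norm (p := 2) (by norm_num) Ψ
  simpa using h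

theorem Fock.tsum_enorm_sq (Ψ : Fock ν) : ∑' N, ‖Ψ N‖ₑ ^ 2 = ‖Ψ‖ₑ ^ 2 := by
  simp_rw [enorm_sq_eq_ofReal]
  rw [← ENNReal.ofReal_tsum_of_nonneg (fun _ => by positivity) (Fock.hasSum_norm_sq Ψ).summable,
    (Fock.hasSum_norm_sq Ψ).tsum_eq]

theorem Fock.memℓp {Ψ : ∀ N, antisym ν N} (h : Summable fun N => ‖Ψ N‖ ^ 2) : Memℓp Ψ 2 :=
  memℓp_gen (by simpa using h)

theorem norm_annN_sq_le {n : ℕ} (f : OneP ν) (ψ : antisym ν (n + 1)) :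
    ‖annN f ψ‖ ^ 2 ≤ ‖f‖ ^ 2 * ‖ψ‖ ^ 2 := by
  rw [← mul_pow]
  exact pow_le_pow_left₀ (norm_nonneg _) (norm_annN_le f ψ) 2

theorem summable_annN (f : OneP ν) (Ψ : Fock ν) :
    Summable fun N => ‖annN f (Ψ (N + 1))‖ ^ 2 :=
  Summable.of_nonneg_of_le (fun _ => by positivity) (fun N => norm_annN_sq_le f (Ψ (N + 1)))
    (((summable_nat_add_iff 1).2 (Fock.hasSum_norm_sq Ψ).summable).mul_left _)

/-- The annihilation operator on Fock space, given sector by sector. -/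
noncomputable def annF (f : OneP ν) : Fock ν →L[ℂ] Fock ν :=
  LinearMap.mkContinuous
    { toFun := fun Ψ => ⟨fun N => annN f (Ψ (N + 1)), Fock.memℓp (summable_annN f Ψ)⟩
      map_add' := fun Ψ Φ => by
        ext1
        funext N
        exact map_add (annN f) _ _
      map_smul' := fun c Ψ => by
        ext1
        funext N
        exact map_smul (annN f) c _ }
    ‖f‖ (fun Ψ => by
      refine le_of_sq_le_sq ?_ (by positivity)
      rw [mul_pow, ← (Fock.hasSum_norm_sq _).tsum_eq, ← (Fock.hasSum_norm_sq Ψ).tsum_eq]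
      have h1 := (summable_nat_add_iff 1).2 (Fock.hasSum_norm_sq Ψ).summable
      calc ∑' N, ‖annN f (Ψ (N + 1))‖ ^ 2
          ≤ ∑' N, ‖f‖ ^ 2 * ‖Ψ (N + 1)‖ ^ 2 :=
            (summable_annN f Ψ).tsum_le_tsum (fun N => norm_annN_sq_le f _) (h1.mul_left _)
        _ = ‖f‖ ^ 2 * ∑' N, ‖Ψ (N + 1)‖ ^ 2 := tsum_mul_left
        _ ≤ ‖f‖ ^ 2 * ∑' N, ‖Ψ N‖ ^ 2 := by
            refine mul_le_mul_of_nonneg_left ?_ (by positivity)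
            rw [(Fock.hasSum_norm_sq Ψ).summable.tsum_eq_zero_add]
            exact le_add_of_nonneg_left (by positivity))

theorem annF_apply (f : OneP ν) (Ψ : Fock ν) (N : ℕ) : annF f Ψ N = annN f (Ψ (N + 1)) := rfl

/-- The creation operator on Fock space, the adjoint of the annihilation operator. -/
noncomputable def creF (f : OneP ν) : Fock ν →L[ℂ] Fock ν := ContinuousLinearMap.adjoint (annF f)

theorem Fock.ext_single {Ψ : Fock ν} {N : ℕ} {v : antisym ν N}
    (h : ∀ φ : antisym ν N, ⟪(lp.single 2 N φ : Fock ν), Ψ⟫_ℂ = ⟪φ, v⟫_ℂ) : Ψ N = v := by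
  refine ext_inner_left ℂ fun φ => ?_
  rw [← h φ, lp.inner_single_left]

theorem annF_single_zero (f : OneP ν) (φ : antisym ν 0) :
    annF f (lp.single 2 0 φ : Fock ν) = 0 := by
  ext1
  funext N
  rw [annF_apply, lp.single_apply_ne _ _ _ (Nat.succ_ne_zero N), map_zero]
  rfl

theorem annF_single_succ (f : OneP ν) (n : ℕ) (φ : antisym ν (n + 1)) :
    annF f (lp.single 2 (n + 1) φ : Fock ν) = (lp.single 2 n (annN f φ) : Fock ν) := by
  ext1
  funext N
  rw [annF_apply]
  by_cases h : N = n
  · subst h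
    rw [lp.single_apply_self, lp.single_apply_self]
  · rw [lp.single_apply_ne _ _ _ h, lp.single_apply_ne _ _ _ (by omega), map_zero]

theorem creF_apply_zero (f : OneP ν) (Ψ : Fock ν) : creF f Ψ 0 = 0 :=
  Fock.ext_single fun φ => by
    rw [creF, ContinuousLinearMap.adjoint_inner_right, annF_single_zero, inner_zero_left,
      inner_zero_right]

theorem creF_apply_succ (f : OneP ν) (Ψ : Fock ν) (n : ℕ) :
    creF f Ψ (n + 1) = creN f (Ψ n) :=
  Fock.ext_single fun φ => by
    rw [creF, ContinuousLinearMap.adjoint_inner_right, annF_single_succ, lp.inner_single_left,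
      creN, ContinuousLinearMap.adjoint_inner_right]

theorem creF_single (f : OneP ν) (n : ℕ) (φ : antisym ν n) :
    creF f (lp.single 2 n φ : Fock ν) = (lp.single 2 (n + 1) (creN f φ) : Fock ν) := by
  ext1
  funext N
  cases N with
  | zero => rw [creF_apply_zero, lp.single_apply_ne _ _ _ (Nat.succ_ne_zero n).symm]
  | succ N =>
    rw [creF_apply_succ]
    by_cases h : N = n
    · subst h
      rw [lp.single_apply_self, lp.single_apply_self]
    · rw [lp.single_apply_ne _ _ _ h, lp.single_apply_ne _ _ _ (by omega), map_zero]

/-- The Slater determinant as a Fock space vector. -/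
noncomputable def wedge {N : ℕ} (f : Fin N → OneP ν) : Fock ν := lp.single 2 N (slat f)

theorem isWedge_iff {N : ℕ} (f : Fin N → OneP ν) (Ψ : Fock ν) : IsWedge ν f Ψ ↔ Ψ = wedge f := by
  constructor
  · rintro ⟨h1, h2⟩
    ext1
    funext n
    by_cases hn : n = N
    · subst hn
      rw [wedge, lp.single_apply_self]
      exact Subtype.ext (eq_slaterL h2)
    · rw [h1 n hn, wedge, lp.single_apply_ne _ _ _ hn]
  · rintro rfl
    refine ⟨fun n hn => ?_, ?_⟩
    · rw [wedge, lp.single_apply_ne _ _ _ hn]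
    · rw [comp, wedge, lp.single_apply_self]
      exact slaterL_ae f

theorem creF_wedge {N : ℕ} (f : OneP ν) (g : Fin N → OneP ν) :
    creF f (wedge g) = wedge (Fin.cons f g : Fin (N + 1) → OneP ν) := by
  rw [wedge, creF_single, creN_slat, wedge]

theorem fock_ext {S T : Fock ν →L[ℂ] Fock ν}
    (h : ∀ (N : ℕ) (g : Fin N → OneP ν), S (wedge g) = T (wedge g)) : S = T := by
  have h1 : ∀ N, S ∘L lp.singleContinuousLinearMap ℂ (fun N : ℕ => antisym ν N) 2 N =
      T ∘L lp.singleContinuousLinearMap ℂ (fun N : ℕ => antisym ν N) 2 N :=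
    fun N => antisym_ext fun g => h N g
  ext1 Ψ
  have hΨ := lp.hasSum_single (p := 2) (by norm_num) Ψ
  refine (hΨ.mapL S).unique ?_
  convert hΨ.mapL T using 1
  funext N
  exact congrArg (fun L : antisym ν N →L[ℂ] Fock ν => L (Ψ N)) (h1 N)

-- `creation` is chosen from an existence statement. The explicit operator shows existence, and
-- `fock_ext` gives uniqueness because wedge vectors are total.
variable (ν) in
theorem creation_eq (f : OneP ν) : creation ν f = creF f := by
  have hex : ∃ T : Fock ν →L[ℂ] Fock ν, ∀ (N : ℕ) (g : Fin N → OneP ν) (Ψ : Fock ν),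
      IsWedge ν g Ψ → IsWedge ν (Fin.cons f g : Fin (N + 1) → OneP ν) (T Ψ) := by
    refine ⟨creF f, fun N g Ψ h => ?_⟩
    rw [isWedge_iff] at h ⊢
    rw [h, creF_wedge]
  rw [creation, dif_pos hex]
  refine fock_ext fun N g => ?_
  have h := hex.choose_spec N g (wedge g) ((isWedge_iff _ _).2 rfl)
  rw [isWedge_iff] at h
  rw [h, creF_wedge]

variable (ν) in
theorem annihilation_eq (f : OneP ν) : annihilation ν f = annF f := by
  rw [annihilation, creation_eq, creF, ContinuousLinearMap.adjoint_adjoint]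

theorem adjoint_creF (f : OneP ν) : ContinuousLinearMap.adjoint (creF f) = annF f := by
  rw [creF, ContinuousLinearMap.adjoint_adjoint]

theorem annF_add (f g : OneP ν) : annF (f + g) = annF f + annF g := by
  ext1 Ψ
  ext1
  funext N
  change annN (f + g) (Ψ (N + 1)) = annN f (Ψ (N + 1)) + annN g (Ψ (N + 1))
  rw [annN_add, add_apply]

theorem annF_smul (c : ℂ) (f : OneP ν) : annF (c • f) = (starRingEnd ℂ) c • annF f := by
  ext1 Ψ
  ext1
  funext N
  change annN (c • f) (Ψ (N + 1)) = (starRingEnd ℂ) c • annN f (Ψ (N + 1))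
  rw [annN_smul, smul_apply]

theorem creF_add (f g : OneP ν) : creF (f + g) = creF f + creF g := by
  rw [creF, annF_add, map_add, creF, creF]

theorem creF_smul (c : ℂ) (f : OneP ν) : creF (c • f) = c • creF f := by
  rw [creF, annF_smul, creF]
  exact (ContinuousLinearMap.adjoint.map_smulₛₗ _ _).trans (by rw [Complex.conj_conj])

theorem annF_creF (f g : OneP ν) :
    annF f * creF g + creF g * annF f = ⟪f, g⟫_ℂ • (1 : Fock ν →L[ℂ] Fock ν) := by
  ext1 Ψ
  ext1
  funext N
  change annN f (creF g Ψ (N + 1)) + creF g (annF f Ψ) N = ⟪f, g⟫_ℂ • Ψ N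
  rw [creF_apply_succ]
  cases N with
  | zero => rw [creF_apply_zero, add_zero, annN_creN_zero]
  | succ n => rw [creF_apply_succ, annF_apply, annN_creN]

theorem creF_creF (f g : OneP ν) : creF f * creF g + creF g * creF f = 0 := by
  ext1 Ψ
  ext1
  funext N
  change creF f (creF g Ψ) N + creF g (creF f Ψ) N = 0
  match N with
  | 0 => rw [creF_apply_zero, creF_apply_zero, add_zero]
  | 1 => rw [creF_apply_succ, creF_apply_succ, creF_apply_zero, creF_apply_zero, map_zero,
      map_zero, add_zero]
  | n + 2 => rw [creF_apply_succ, creF_apply_succ, creF_apply_succ, creF_apply_succ, creN_creN,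
      neg_add_cancel]

theorem annF_annF (f g : OneP ν) : annF f * annF g + annF g * annF f = 0 := by
  have h := congrArg ContinuousLinearMap.adjoint (creF_creF g f)
  rw [map_add, map_zero] at h
  have h2 : ∀ a b : OneP ν, ContinuousLinearMap.adjoint (creF a * creF b) = annF b * annF a :=
    fun a b => by
      rw [ContinuousLinearMap.mul_def, ContinuousLinearMap.adjoint_comp, adjoint_creF,
        adjoint_creF, ContinuousLinearMap.mul_def]
  rwa [h2, h2] at h

theorem norm_creF_annF (f : OneP ν) (Ψ : Fock ν) :
    ‖creF f Ψ‖ ^ 2 + ‖annF f Ψ‖ ^ 2 = ‖f‖ ^ 2 * ‖Ψ‖ ^ 2 := by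
  have h := congrArg (fun L : Fock ν →L[ℂ] Fock ν => ⟪Ψ, L Ψ⟫_ℂ) (annF_creF f f)
  have h' : ⟪Ψ, annF f (creF f Ψ)⟫_ℂ + ⟪Ψ, creF f (annF f Ψ)⟫_ℂ = ⟪f, f⟫_ℂ * ⟪Ψ, Ψ⟫_ℂ := by
    rw [← inner_add_right, ← inner_smul_right]
    exact h
  have h1 : ⟪Ψ, annF f (creF f Ψ)⟫_ℂ = ⟪creF f Ψ, creF f Ψ⟫_ℂ :=
    (ContinuousLinearMap.adjoint_inner_left (annF f) _ _).symm
  have h2 : ⟪Ψ, creF f (annF f Ψ)⟫_ℂ = ⟪annF f Ψ, annF f Ψ⟫_ℂ :=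
    ContinuousLinearMap.adjoint_inner_right (annF f) _ _
  rw [h1, h2, inner_self_ofReal, inner_self_ofReal, inner_self_ofReal, inner_self_ofReal] at h'
  exact_mod_cast h'

theorem annF_wedge_succ {n : ℕ} (f : OneP ν) (g : Fin (n + 1) → OneP ν) :
    annF f (wedge g) = ∑ l : Fin (n + 1), ((-1) ^ (l : ℕ) * ⟪f, g l⟫_ℂ) •
      wedge (g ∘ l.succAbove) := by
  rw [wedge, annF_single_succ, annN_slat]
  change lp.singleContinuousLinearMap ℂ (fun N : ℕ => antisym ν N) 2 n _ = _
  rw [map_sum]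
  refine Finset.sum_congr rfl fun l _ => ?_
  rw [map_smul]
  rfl

theorem annF_wedge_eq_zero {N : ℕ} (f : OneP ν) (g : Fin N → OneP ν) (h : ∀ i, ⟪f, g i⟫_ℂ = 0) :
    annF f (wedge g) = 0 := by
  cases N with
  | zero => exact annF_single_zero f _
  | succ n =>
    rw [annF_wedge_succ]
    refine Finset.sum_eq_zero fun l _ => ?_
    rw [h l, mul_zero, zero_smul]

theorem creF_wedge_self {N : ℕ} (g : Fin N → OneP ν) (i : Fin N) :
    creF (g i) (wedge g) = 0 := by
  have : slat (Fin.cons (g i) g : Fin (N + 1) → OneP ν) = 0 := by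
    refine antisym_ext_inner fun k => ?_
    rw [inner_slat, inner_zero_right]
    refine Matrix.det_zero_of_column_eq (i := 0) (j := i.succ) (Fin.succ_ne_zero i).symm fun a => ?_
    simp
  rw [creF_wedge, wedge, this, lp.single_zero]

theorem inner_wedge {N : ℕ} (k g : Fin N → OneP ν) :
    ⟪wedge k, wedge g⟫_ℂ = (Matrix.of fun i j => ⟪k i, g j⟫_ℂ).det := by
  rw [wedge, wedge, lp.inner_single_left, lp.single_apply_self, inner_slat]

theorem norm_wedge {N : ℕ} {f : Fin N → OneP ν} (hf : Orthonormal ℂ f) : ‖wedge f‖ = 1 := by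
  have h : ⟪wedge f, wedge f⟫_ℂ = 1 := by
    rw [inner_wedge]
    convert Matrix.det_one (R := ℂ) (n := Fin N) using 2
    ext i j
    rw [Matrix.of_apply, Matrix.one_apply]
    exact orthonormal_iff_ite.1 hf i j
  rw [inner_self_ofReal] at h
  have h' : ‖wedge f‖ ^ 2 = 1 := by exact_mod_cast h
  exact (pow_eq_one_iff_of_nonneg (norm_nonneg _) two_ne_zero).1 h'

theorem field_eq (f g : OneP ν) : field ν f g = creF f + annF g := by
  rw [field, creation_eq, annihilation_eq]

theorem field_anticomm (f g f' g' : OneP ν) :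
    (creF f + annF g) * (creF f' + annF g') + (creF f' + annF g') * (creF f + annF g) =
      (⟪g, f'⟫_ℂ + ⟪g', f⟫_ℂ) • (1 : Fock ν →L[ℂ] Fock ν) := by
  rw [add_smul, ← annF_creF, ← annF_creF]
  have h1 := creF_creF f f'
  have h2 := annF_annF g g'
  calc _ = (creF f * creF f' + creF f' * creF f) + (annF g * annF g' + annF g' * annF g) +
        (annF g * creF f' + creF f' * annF g + (annF g' * creF f + creF f * annF g')) := by
        noncomm_ring
    _ = _ := by rw [h1, h2, add_zero, zero_add]

end FockOperators

end BHF

namespace BHF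

set_option linter.unusedSectionVars false

/-! ### Wick's formula -/

section Pairings

/-- The pairing obtained by joining `0` to `j + 1` and pairing the other points by `π`. -/
def joinPairing {n : ℕ} (j : Fin (n + 1)) (π : Equiv.Perm (Fin n)) : Equiv.Perm (Fin (n + 2)) :=
  Equiv.Perm.decomposeFin.symm (0, j.cycleRange.symm * Equiv.Perm.decomposeFin.symm (0, π))

variable {n : ℕ} (j : Fin (n + 1)) (π : Equiv.Perm (Fin n))

theorem joinPairing_zero : joinPairing j π 0 = 0 :=
  Equiv.Perm.decomposeFin_symm_apply_zero _ _

theorem joinPairing_succ_zero : joinPairing j π (Fin.succ 0) = j.succ := by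
  rw [joinPairing, Equiv.Perm.decomposeFin_symm_apply_succ, Equiv.swap_self, Equiv.refl_apply,
    Equiv.Perm.mul_apply, Equiv.Perm.decomposeFin_symm_apply_zero, Fin.cycleRange_symm_zero]

theorem joinPairing_succ_succ (i : Fin n) :
    joinPairing j π i.succ.succ = (j.succAbove (π i)).succ := by
  rw [joinPairing, Equiv.Perm.decomposeFin_symm_apply_succ, Equiv.swap_self, Equiv.refl_apply,
    Equiv.Perm.mul_apply, Equiv.Perm.decomposeFin_symm_apply_succ, Equiv.swap_self,
    Equiv.refl_apply, Fin.cycleRange_symm_succ]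

theorem sign_joinPairing :
    Equiv.Perm.sign (joinPairing j π) = (-1) ^ (j : ℕ) * Equiv.Perm.sign π := by
  rw [joinPairing, Equiv.Perm.decomposeFin.symm_sign, if_pos rfl, one_mul, Equiv.Perm.sign_mul,
    Equiv.Perm.decomposeFin.symm_sign, if_pos rfl, one_mul, Equiv.Perm.sign_symm,
    Fin.sign_cycleRange]

theorem exists_decomposeFin_symm {n : ℕ} (σ : Equiv.Perm (Fin (n + 1))) (h : σ 0 = 0) :
    ∃ e, σ = Equiv.Perm.decomposeFin.symm (0, e) := by
  obtain ⟨⟨p, e⟩, rfl⟩ := Equiv.Perm.decomposeFin.symm.surjective σ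
  rw [Equiv.Perm.decomposeFin_symm_apply_zero] at h
  exact ⟨e, by rw [h]⟩

theorem exists_joinPairing {n : ℕ} (σ : Equiv.Perm (Fin (n + 2))) (h : σ 0 = 0) :
    ∃ j π, joinPairing j π = σ := by
  obtain ⟨e, rfl⟩ := exists_decomposeFin_symm σ h
  obtain ⟨π, hπ⟩ := exists_decomposeFin_symm ((e 0).cycleRange * e) (by
    rw [Equiv.Perm.mul_apply, Fin.cycleRange_self])
  refine ⟨e 0, π, ?_⟩
  rw [joinPairing, ← hπ]
  congr 2
  ext x
  simp

theorem joinPairing_injective {n : ℕ} {j j' : Fin (n + 1)} {π π' : Equiv.Perm (Fin n)}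
    (h : joinPairing j π = joinPairing j' π') : j = j' ∧ π = π' := by
  have hj : j = j' := by
    have := congrArg (fun σ : Equiv.Perm (Fin (n + 2)) => σ (Fin.succ 0)) h
    simp only [joinPairing_succ_zero] at this
    exact Fin.succ_injective _ this
  subst hj
  refine ⟨rfl, Equiv.ext fun i => ?_⟩
  have := congrArg (fun σ : Equiv.Perm (Fin (n + 2)) => σ i.succ.succ) h
  simp only [joinPairing_succ_succ] at this
  exact Fin.succAbove_right_injective (Fin.succ_injective _ this)

theorem mem_pairings {k : ℕ} (π : Equiv.Perm (Fin (2 * k))) : π ∈ pairings k ↔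
    (∀ i i' : Fin k, i < i' → π ⟨2 * i, by omega⟩ < π ⟨2 * i', by omega⟩) ∧
      ∀ i : Fin k, π ⟨2 * i, by omega⟩ < π ⟨2 * i + 1, by omega⟩ := by
  rw [pairings, Finset.mem_filter]
  simp

/-- The relabelling of the remaining points is strictly increasing, so the order conditions among
them are unchanged, while those involving the first pair (0, j+1) hold automatically. -/
theorem joinPairing_mem {k : ℕ} (j : Fin (2 * k + 1)) (π : Equiv.Perm (Fin (2 * k))) :
    (joinPairing j π : Equiv.Perm (Fin (2 * (k + 1)))) ∈ pairings (k + 1) ↔ π ∈ pairings k := by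
  rw [mem_pairings, mem_pairings]
  have h0 : ∀ h, joinPairing j π ⟨2 * ((0 : Fin (k + 1)) : ℕ), h⟩ = 0 := fun h =>
    joinPairing_zero j π
  have h1 : ∀ h, joinPairing j π ⟨2 * ((0 : Fin (k + 1)) : ℕ) + 1, h⟩ = j.succ := fun h =>
    joinPairing_succ_zero j π
  have h2 : ∀ (i : Fin k) (h), joinPairing j π ⟨2 * (i.succ : ℕ), h⟩ =
      (j.succAbove (π ⟨2 * i, by omega⟩)).succ := fun i h =>
    joinPairing_succ_succ j π ⟨2 * i, by omega⟩
  have h3 : ∀ (i : Fin k) (h), joinPairing j π ⟨2 * (i.succ : ℕ) + 1, h⟩ =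
      (j.succAbove (π ⟨2 * i + 1, by omega⟩)).succ := fun i h =>
    joinPairing_succ_succ j π ⟨2 * i + 1, by omega⟩
  have hmono : ∀ a b : Fin (2 * k), (j.succAbove a).succ < (j.succAbove b).succ ↔ a < b :=
    fun a b => by rw [Fin.succ_lt_succ_iff, Fin.succAbove_lt_succAbove_iff]
  constructor
  · rintro ⟨ha, hb⟩
    refine ⟨fun i i' hi => ?_, fun i => ?_⟩
    · have := ha i.succ i'.succ (Fin.succ_lt_succ_iff.2 hi)
      rw [h2, h2] at this
      exact (hmono _ _).1 this
    · have := hb i.succ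
      rw [h2, h3] at this
      exact (hmono _ _).1 this
  · rintro ⟨ha, hb⟩
    constructor
    · intro i i' hi
      induction i' using Fin.cases with
      | zero => exact absurd hi (Fin.not_lt_zero i)
      | succ i' =>
        induction i using Fin.cases with
        | zero =>
          rw [h0, h2]
          exact Fin.succ_pos _
        | succ i =>
          rw [h2, h2]
          exact (hmono _ _).2 (ha i i' (Fin.succ_lt_succ_iff.1 hi))
    · intro i
      induction i using Fin.cases with
      | zero =>
        rw [h0, h1]
        exact Fin.succ_pos _
      | succ i =>
        rw [h2, h3]
        exact (hmono _ _).2 (hb i)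

/-- The value at position 0 is the least among the even positions, and each odd position has a
larger value than the even one before it; hence it is the minimum. -/
theorem pairings_apply_zero {k : ℕ} {σ : Equiv.Perm (Fin (2 * (k + 1)))}
    (h : σ ∈ pairings (k + 1)) : σ (0 : Fin (2 * k + 2)) = (0 : Fin (2 * k + 2)) := by
  obtain ⟨ha, hb⟩ := (mem_pairings σ).1 h
  have heven : ∀ i : Fin (k + 1), σ ⟨2 * ((0 : Fin (k + 1)) : ℕ), by simp⟩ ≤
      σ ⟨2 * (i : ℕ), by omega⟩ := by
    intro i
    rcases (Fin.zero_le i).eq_or_lt with h | h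
    · subst h
      exact le_rfl
    · exact (ha 0 i h).le
  have hall : ∀ y : Fin (2 * (k + 1)), σ ⟨2 * ((0 : Fin (k + 1)) : ℕ), by simp⟩ ≤ σ y := by
    intro y
    rcases Nat.even_or_odd' (y : ℕ) with ⟨c, hc | hc⟩
    · have := heven ⟨c, by omega⟩
      convert this using 2
      exact Fin.ext hc
    · refine ((heven ⟨c, by omega⟩).trans (hb ⟨c, by omega⟩).le).trans_eq ?_
      congr 1
      exact Fin.ext hc.symm
  have := hall (σ.symm (0 : Fin (2 * k + 2)))
  rw [Equiv.apply_symm_apply] at this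
  exact Fin.le_zero_iff.1 this

/-- The sum over pairings on the right of Wick's formula, for a given two-point function. -/
def wickSum (k : ℕ) (b : Fin (2 * k) → Fin (2 * k) → ℂ) : ℂ :=
  ∑ π ∈ pairings k, ((Equiv.Perm.sign π : ℤ) : ℂ) * ∏ i : Fin k,
    b (π ⟨2 * i, by omega⟩) (π ⟨2 * i + 1, by omega⟩)

theorem wickSum_zero (b : Fin (2 * 0) → Fin (2 * 0) → ℂ) : wickSum 0 b = 1 := by
  have : pairings 0 = {1} := by
    ext π
    rw [mem_pairings]
    simp only [Finset.mem_singleton]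
    exact ⟨fun _ => Equiv.ext fun i => i.elim0, fun _ => ⟨fun i => i.elim0, fun i => i.elim0⟩⟩
  simp [wickSum, this]

/-- Expansion of a Pfaffian along its first row: a pairing is determined by the partner j + 1 of 0
and a pairing of the rest, and joining contributes the sign (-1)^j. -/
theorem wickSum_succ (k : ℕ) (b : Fin (2 * k + 2) → Fin (2 * k + 2) → ℂ) :
    wickSum (k + 1) b = ∑ j : Fin (2 * k + 1), (-1) ^ (j : ℕ) * b 0 j.succ *
      wickSum k (fun p q => b (j.succAbove p).succ (j.succAbove q).succ) := by
  simp_rw [wickSum, Finset.mul_sum]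
  rw [← Finset.sum_product']
  refine (Finset.sum_nbij (fun x : Fin (2 * k + 1) × Equiv.Perm (Fin (2 * k)) =>
    (joinPairing x.1 x.2 : Equiv.Perm (Fin (2 * (k + 1))))) ?_ ?_ ?_ ?_).symm
  · intro x hx
    exact (joinPairing_mem _ _).2 (Finset.mem_product.1 hx).2
  · intro x _ y _ h
    obtain ⟨h1, h2⟩ := joinPairing_injective h
    exact Prod.ext h1 h2
  · intro σ hσ
    obtain ⟨j, π, h⟩ := exists_joinPairing (n := 2 * k) σ (pairings_apply_zero hσ)
    refine ⟨(j, π), ?_, h⟩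
    simp only [Finset.coe_product, Set.mem_prod, Finset.coe_univ, Set.mem_univ, true_and]
    refine (joinPairing_mem j π).1 ?_
    rw [h]
    exact hσ
  · rintro ⟨j, π⟩ _
    rw [Fin.prod_univ_succ]
    have hs : Equiv.Perm.sign (joinPairing j π : Equiv.Perm (Fin (2 * (k + 1)))) =
        (-1) ^ (j : ℕ) * Equiv.Perm.sign π := sign_joinPairing j π
    have h0 : ∀ h, joinPairing j π ⟨2 * ((0 : Fin (k + 1)) : ℕ), h⟩ = 0 := fun h =>
      joinPairing_zero j π
    have h1 : ∀ h, joinPairing j π ⟨2 * ((0 : Fin (k + 1)) : ℕ) + 1, h⟩ = j.succ := fun h =>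
      joinPairing_succ_zero j π
    have h2 : ∀ (i : Fin k) (h), joinPairing j π ⟨2 * (i.succ : ℕ), h⟩ =
        (j.succAbove (π ⟨2 * i, by omega⟩)).succ := fun i h =>
      joinPairing_succ_succ j π ⟨2 * i, by omega⟩
    have h3 : ∀ (i : Fin k) (h), joinPairing j π ⟨2 * (i.succ : ℕ) + 1, h⟩ =
        (j.succAbove (π ⟨2 * i + 1, by omega⟩)).succ := fun i h =>
      joinPairing_succ_succ j π ⟨2 * i + 1, by omega⟩
    simp only [hs, h0, h1, h2, h3]
    push_cast
    ring

end Pairings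

/-! ### Wick's formula from anticommutation relations alone -/

section AbstractWick

variable {𝒜 : Type*} [Ring 𝒜] [Algebra ℂ 𝒜]

/-- X is moved to the right one factor at a time; each passage reverses the sign and leaves the
scalar anticommutator in place of the factor passed. -/
theorem mul_prod_ofFn_of_anticomm {m : ℕ} (X : 𝒜) (A : Fin (m + 1) → 𝒜) (c : Fin (m + 1) → ℂ)
    (h : ∀ j, X * A j + A j * X = c j • (1 : 𝒜)) :
    X * (List.ofFn A).prod = ∑ j : Fin (m + 1), ((-1) ^ (j : ℕ) * c j) •
      (List.ofFn (A ∘ j.succAbove)).prod + (-1 : ℂ) ^ (m + 1) • ((List.ofFn A).prod * X) := by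
  induction m with
  | zero =>
    simp only [List.ofFn_succ, List.ofFn_zero, List.prod_cons, List.prod_nil, mul_one,
      Fin.sum_univ_succ, Finset.univ_eq_empty, Finset.sum_empty, Fin.val_zero, pow_zero, one_mul]
    rw [← h 0]
    simp
  | succ m ih =>
    have ih' := ih (fun i => A i.succ) (fun i => c i.succ) (fun i => h i.succ)
    rw [List.ofFn_succ, List.prod_cons, ← mul_assoc, eq_sub_of_add_eq (h 0), sub_mul, mul_assoc,
      ih', mul_add, Finset.mul_sum, Fin.sum_univ_succ (n := m + 1)]
    have h1 : ∀ j : Fin (m + 1), A ∘ j.succ.succAbove =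
        Fin.cons (A 0) ((fun i => A i.succ) ∘ j.succAbove) := by
      intro j
      ext1 i
      refine Fin.cases ?_ (fun i => ?_) i <;> simp
    have h2 : A ∘ (0 : Fin (m + 2)).succAbove = fun i => A i.succ := by
      ext1 i
      simp
    simp only [h1, h2, List.ofFn_cons, List.prod_cons, Fin.val_zero, pow_zero, one_mul,
      Fin.val_succ, smul_mul_assoc, mul_smul_comm, mul_assoc]
    rw [sub_eq_add_neg, neg_add, ← Finset.sum_neg_distrib, ← add_assoc]
    congr 1
    · congr 1
      refine Finset.sum_congr rfl fun j _ => ?_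
      rw [← neg_smul]
      congr 1
      ring
    · rw [← neg_smul]
      congr 1
      ring

/-- Wick's formula for a functional `ω` such that every operator splits into a part annihilated by
`ω` from the left and one annihilated from the right, with scalar anticommutators. -/
theorem wick_of_split (ω : 𝒜 →ₗ[ℂ] ℂ) (h1 : ω 1 = 1) (k : ℕ) (A : Fin (2 * k) → 𝒜)
    (hA : ∀ i, ∃ P X, A i = P + X ∧ (∀ B, ω (P * B) = 0) ∧ (∀ B, ω (B * X) = 0) ∧
      ∀ j, ∃ c : ℂ, X * A j + A j * X = c • (1 : 𝒜)) :
    ω (List.ofFn A).prod = wickSum k fun p q => ω (A p * A q) := by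
  induction k with
  | zero =>
    rw [wickSum_zero]
    simpa using h1
  | succ k ih =>
    change ω (List.ofFn (n := 2 * k + 2) A).prod = _
    refine Eq.trans ?_ (wickSum_succ k (fun p q => ω (A p * A q))).symm
    obtain ⟨P, X, hPX, hP, hX, hc⟩ := hA (0 : Fin (2 * k + 2))
    choose c hc using hc
    -- The scalar left when X passes A_j is the two-point function, because P vanishes on the left
    -- of ω and X on the right.
    have hc2 : ∀ j, ω (A (0 : Fin (2 * k + 2)) * A j) = c j := by
      intro j
      rw [hPX, add_mul, map_add, hP, zero_add, eq_sub_of_add_eq (hc j), map_sub, hX, sub_zero,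
        map_smul, h1, smul_eq_mul, mul_one]
    rw [List.ofFn_succ, List.prod_cons, hPX, add_mul, map_add, hP, zero_add]
    refine (congrArg ω (mul_prod_ofFn_of_anticomm (m := 2 * k) X
      (fun i => A (Fin.succ i : Fin (2 * k + 2))) (fun i => c (Fin.succ i : Fin (2 * k + 2)))
      (fun i => hc _))).trans ?_
    rw [map_add, map_smul, hX, smul_zero, add_zero, map_sum]
    refine Finset.sum_congr rfl fun j _ => ?_
    rw [map_smul, smul_eq_mul, ← hPX, hc2]
    congr 1
    exact ih (fun i => A (Fin.succ (j.succAbove i) : Fin (2 * k + 2))) fun i => by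
      obtain ⟨P, X, h1, h2, h3, h4⟩ := hA (Fin.succ (j.succAbove i) : Fin (2 * k + 2))
      exact ⟨P, X, h1, h2, h3, fun j' => h4 _⟩

end AbstractWick

end BHF

namespace BHF

set_option linter.unusedSectionVars false

/-! ### Quadratic forms on Fock space in terms of annihilation operators -/

/-- Distinct orthonormal vectors are at distance √2, so balls of radius 1/2 around them are disjoint
open sets. -/
theorem Orthonormal.countable {E : Type*} [NormedAddCommGroup E] [InnerProductSpace ℂ E]
    [TopologicalSpace.SeparableSpace E] {ι : Type*} {v : ι → E} (hv : Orthonormal ℂ v) :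
    Countable ι := by
  have hd : ∀ i j, i ≠ j → ‖v i - v j‖ ^ 2 = 2 := by
    intro i j hij
    rw [@norm_sub_sq ℂ, hv.1 i, hv.1 j, hv.2 hij]
    norm_num
  have h : (Set.univ : Set ι).PairwiseDisjoint fun i => Metric.ball (v i) (1 / 2) := by
    intro i _ j _ hij
    refine Metric.ball_disjoint_ball ?_
    rw [dist_eq_norm]
    nlinarith [hd i j hij, norm_nonneg (v i - v j)]
  have := h.countable_of_isOpen (fun i _ => Metric.isOpen_ball)
    (fun i _ => Metric.nonempty_ball.2 (by norm_num))
  exact Set.countable_univ_iff.1 this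

instance instCountableBasisIndex {E : Type*} [NormedAddCommGroup E] [InnerProductSpace ℂ E]
    [CompleteSpace E] [TopologicalSpace.SeparableSpace E] : Countable (BasisIndex E) :=
  Orthonormal.countable (stdBasis E).orthonormal

section SectorForms

variable {M : Type*} [MeasurableSpace M] {ν : Measure M} [SigmaFinite ν]

theorem enorm_contrAt {n : ℕ} (i : Fin (n + 1)) (f : OneP ν) (ψ : antisym ν (n + 1)) :
    ‖contrAt i f (ψ : L2N ν (n + 1))‖ₑ ^ 2 = ((n : ℝ≥0∞) + 1)⁻¹ * ‖annN f ψ‖ₑ ^ 2 := by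
  rw [← enorm_contrAt_sq i, ← mul_assoc, ENNReal.inv_mul_cancel (by simp) (by simp), one_mul]

theorem opFormFn_of_memLp {h : OneP ν →ₗ.[ℂ] OneP ν} {m : ℝ} {u : M → ℂ} (hu : MemLp u 2 ν) :
    opFormFn ν h m u = opForm h m hu.toLp := by
  rw [opFormFn, dif_pos hu]

theorem ae_slot {n : ℕ} (i : Fin (n + 1)) (ψ : L2N ν (n + 1)) :
    ∀ᵐ x ∂(Measure.pi fun _ : Fin n => ν),
      (fun y => slot ν i ψ (y, x)) =ᵐ[ν] fun y => ψ (i.insertNth (α := fun _ => M) y x) := by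
  have h := Measure.measurePreserving_swap (μ := Measure.pi fun _ : Fin n => ν) (ν := ν)
    |>.quasiMeasurePreserving.ae (slot_ae i ψ)
  exact Measure.ae_ae_of_ae_prod h

theorem lintegral_opFormFn {h : OneP ν →ₗ.[ℂ] OneP ν} {m : ℝ} {κ : Type*} [Countable κ]
    {φ : κ → OneP ν} (hφ : ∀ f, opForm h m f = ∑' k, ‖⟪φ k, f⟫_ℂ‖ₑ ^ 2) {n : ℕ}
    (i : Fin (n + 1)) (ψ : L2N ν (n + 1)) :
    ∫⁻ x : Fin n → M, opFormFn ν h m (fun y => ψ (i.insertNth (α := fun _ => M) y x))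
        ∂(Measure.pi fun _ : Fin n => ν) = ∑' k, ‖contrAt i (φ k) ψ‖ₑ ^ 2 := by
  have h1 := lintegral_slice_form φ (g := fun _ : Fin n → M => 1) measurable_const (slot ν i ψ)
    (q := fun x => opFormFn ν h m (fun y => ψ (i.insertNth (α := fun _ => M) y x))) (by
      filter_upwards [ae_slot i ψ] with x hx hu
      have hu' : MemLp (fun y => ψ (i.insertNth (α := fun _ => M) y x)) 2 ν := hu.ae_eq hx
      rw [opFormFn_of_memLp hu', hφ]
      have : hu'.toLp = hu.toLp := MemLp.toLp_congr _ _ hx.symm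
      rw [this])
  simp only [one_mul] at h1
  rw [h1]
  refine tsum_congr fun k => ?_
  rw [enorm_sq_eq_lintegral]
  rfl

/-- By antisymmetry every variable contributes the share 1/(n+1) of the right-hand side. -/
theorem sum_contrAt {κ : Type*} (φ : κ → OneP ν) {n : ℕ} (ψ : antisym ν (n + 1)) :
    ∑ i : Fin (n + 1), ∑' k, ‖contrAt i (φ k) (ψ : L2N ν (n + 1))‖ₑ ^ 2 =
      ∑' k, ‖annN (φ k) ψ‖ₑ ^ 2 := by
  simp_rw [enorm_contrAt, ENNReal.tsum_mul_left]
  rw [Finset.sum_const, Finset.card_univ, Fintype.card_fin, nsmul_eq_mul, ← mul_assoc]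
  push_cast
  rw [ENNReal.mul_inv_cancel (by simp) (by simp), one_mul]

theorem kineticForm_succ {h : OneP ν →ₗ.[ℂ] OneP ν} {m : ℝ} {κ : Type*} [Countable κ]
    {φ : κ → OneP ν} (hφ : ∀ f, opForm h m f = ∑' k, ‖⟪φ k, f⟫_ℂ‖ₑ ^ 2) {n : ℕ}
    (ψ : antisym ν (n + 1)) :
    kineticForm ν h m (n + 1) (ψ : L2N ν (n + 1)) = ∑' k, ‖annN (φ k) ψ‖ₑ ^ 2 := by
  rw [kineticForm, ← sum_contrAt]
  exact Finset.sum_congr rfl fun i _ => lintegral_opFormFn hφ i _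

theorem tsum_contrAt_basis {κ : Type*} [Countable κ] (e : HilbertBasis κ ℂ (OneP ν)) {n : ℕ}
    (i : Fin (n + 1)) (ψ : L2N ν (n + 1)) : ∑' p, ‖contrAt i (e p) ψ‖ₑ ^ 2 = ‖ψ‖ₑ ^ 2 := by
  have hm : Measurable fun p => ‖slot ν i ψ p‖ₑ ^ 2 :=
    (Lp.stronglyMeasurable (slot ν i ψ)).measurable.enorm.pow_const 2
  have h1 := lintegral_slice_form (fun p => e p) (g := fun _ : Fin n → M => 1) measurable_const
    (slot ν i ψ) (q := fun x => ∫⁻ y, ‖slot ν i ψ (y, x)‖ₑ ^ 2 ∂ν) (by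
      refine Filter.Eventually.of_forall fun x hu => ?_
      rw [tsum_enorm_inner_sq e, ← eLpNorm_two_sq, Lp.enorm_toLp])
  simp only [one_mul] at h1
  rw [← lintegral_prod_symm' _ hm, ← enorm_sq_eq_lintegral] at h1
  have h2 : ‖slot ν i ψ‖ₑ = ‖ψ‖ₑ := by
    rw [← ofReal_norm, LinearIsometry.norm_map, ofReal_norm]
  rw [← h2, h1]
  refine tsum_congr fun k => ?_
  rw [enorm_sq_eq_lintegral]
  rfl

theorem tsum_annN_basis {κ : Type*} [Countable κ] (e : HilbertBasis κ ℂ (OneP ν)) {n : ℕ}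
    (ψ : antisym ν (n + 1)) :
    ∑' p, ‖annN (e p) ψ‖ₑ ^ 2 = ((n + 1 : ℕ) : ℝ≥0∞) * ‖ψ‖ₑ ^ 2 := by
  rw [← sum_contrAt]
  simp_rw [tsum_contrAt_basis e]
  rw [Finset.sum_const, Finset.card_univ, Fintype.card_fin, nsmul_eq_mul]
  rfl

theorem lintegral_insertNth {n : ℕ} (i : Fin (n + 1)) (ψ : L2N ν (n + 1)) {w : M → ℝ≥0∞}
    {g : (Fin n → M) → ℝ≥0∞} (hw : Measurable w) (hg : Measurable g) :
    ∫⁻ z, w (z i) * g (fun a => z (i.succAbove a)) * ‖ψ z‖ₑ ^ 2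
        ∂(Measure.pi fun _ : Fin (n + 1) => ν) =
      ∫⁻ p, w p.1 * g p.2 * ‖slot ν i ψ p‖ₑ ^ 2 ∂(ν.prod (Measure.pi fun _ : Fin n => ν)) := by
  have hm : Measurable fun z => ‖ψ z‖ₑ ^ 2 := (Lp.stronglyMeasurable ψ).measurable.enorm.pow_const 2
  have hg' : Measurable fun z : Fin (n + 1) → M => g fun a => z (i.succAbove a) :=
    hg.comp (measurable_pi_lambda _ fun a => measurable_pi_apply _)
  rw [← (measurePreserving_slot ν n i).lintegral_comp (by fun_prop)]
  refine lintegral_congr_ae ?_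
  filter_upwards [slot_ae i ψ] with p hp
  rw [hp]
  simp [MeasurableEquiv.piFinSuccAbove_symm_apply, Fin.insertNthEquiv]

theorem lintegral_one_slot {κ : Type*} [Countable κ] (e : HilbertBasis κ ℂ (OneP ν)) {A : Set M}
    (hA : MeasurableSet A) {n : ℕ} (i : Fin (n + 1)) (ψ : L2N ν (n + 1))
    {g : (Fin n → M) → ℝ≥0∞} (hg : Measurable g) :
    ∫⁻ z, A.indicator 1 (z i) * g (fun a => z (i.succAbove a)) * ‖ψ z‖ₑ ^ 2
        ∂(Measure.pi fun _ : Fin (n + 1) => ν) =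
      ∑' p, ∫⁻ x, g x * ‖contrAt i (cut hA (e p)) ψ x‖ₑ ^ 2 ∂(Measure.pi fun _ : Fin n => ν) := by
  rw [lintegral_insertNth i ψ (measurable_one.indicator hA) hg, ← tsum_lintegral_contr_cut e hA hg]
  rfl

theorem lintegral_indicator_slot {κ : Type*} [Countable κ] (e : HilbertBasis κ ℂ (OneP ν))
    {B : Set M} (hB : MeasurableSet B) {n : ℕ} (i : Fin (n + 1)) (ψ : antisym ν (n + 1)) :
    ∫⁻ z, B.indicator 1 (z i) * ‖(ψ : L2N ν (n + 1)) z‖ₑ ^ 2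
        ∂(Measure.pi fun _ : Fin (n + 1) => ν) =
      ((n : ℝ≥0∞) + 1)⁻¹ * ∑' q, ‖annN (cut hB (e q)) ψ‖ₑ ^ 2 := by
  have := lintegral_one_slot e hB i (ψ : L2N ν (n + 1)) (g := fun _ => 1) measurable_const
  simp only [mul_one, one_mul] at this
  rw [this, ← ENNReal.tsum_mul_left]
  refine tsum_congr fun q => ?_
  rw [← enorm_sq_eq_lintegral, enorm_contrAt]

/-- The variable i is contracted against 1_A e_p, which leaves an antisymmetric vector with one
particle fewer, and then the other variable against 1_B e_q. Each contraction costs the reciprocal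
of the current particle number. -/
theorem lintegral_two_slots {κ : Type*} [Countable κ] (e : HilbertBasis κ ℂ (OneP ν))
    {A B : Set M} (hA : MeasurableSet A) (hB : MeasurableSet B) {n : ℕ} {i k : Fin (n + 2)}
    (hik : i ≠ k) (ψ : antisym ν (n + 2)) :
    ∫⁻ z, A.indicator 1 (z i) * B.indicator 1 (z k) * ‖(ψ : L2N ν (n + 2)) z‖ₑ ^ 2
        ∂(Measure.pi fun _ : Fin (n + 2) => ν) =
      (((n + 2 : ℕ) : ℝ≥0∞) * ((n + 1 : ℕ) : ℝ≥0∞))⁻¹ *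
        ∑' p, ∑' q, ‖annN (cut hB (e q)) (annN (cut hA (e p)) ψ)‖ₑ ^ 2 := by
  -- Here k' is the position of the second variable once the i-th has been removed.
  obtain ⟨k', rfl⟩ := Fin.exists_succAbove_eq hik.symm
  have hB1 : Measurable fun x : Fin (n + 1) → M => B.indicator (1 : M → ℝ≥0∞) (x k') :=
    (measurable_one.indicator hB).comp (measurable_pi_apply k')
  have h1 := lintegral_one_slot e hA i (ψ : L2N ν (n + 2)) hB1
  rw [h1, ← ENNReal.tsum_mul_left]
  refine tsum_congr fun p => ?_
  have h2 := lintegral_indicator_slot e hB k'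
    ⟨contrAt i (cut hA (e p)) (ψ : L2N ν (n + 2)), contrAt_mem i _ ψ.2⟩
  refine h2.trans ?_
  have h3 : (⟨contrAt i (cut hA (e p)) (ψ : L2N ν (n + 2)), contrAt_mem i _ ψ.2⟩ :
      antisym ν (n + 1)) = ((-1) ^ (i : ℕ) * (Real.sqrt (((n + 1 : ℕ) : ℝ) + 1) : ℂ)⁻¹) •
        annN (cut hA (e p)) ψ := Subtype.ext (contrAt_eq i _ ψ)
  have h4 : ‖((-1) ^ (i : ℕ) * (Real.sqrt (((n + 1 : ℕ) : ℝ) + 1) : ℂ)⁻¹ : ℂ)‖ₑ ^ 2 =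
      (((n + 2 : ℕ) : ℝ≥0∞))⁻¹ := by
    rw [enorm_sq_eq_ofReal, norm_mul, norm_pow, norm_neg, norm_one, one_pow, one_mul, norm_inv,
      Complex.norm_real, Real.norm_of_nonneg (Real.sqrt_nonneg _), inv_pow,
      Real.sq_sqrt (by positivity), ENNReal.ofReal_inv_of_pos (by positivity)]
    congr 1
    rw [← ENNReal.ofReal_natCast]
    congr 1
    push_cast
    ring
  have h6 : ∀ q, ‖annN (cut hB (e q)) (((-1) ^ (i : ℕ) *
      (Real.sqrt (((n + 1 : ℕ) : ℝ) + 1) : ℂ)⁻¹) • annN (cut hA (e p)) ψ)‖ₑ ^ 2 =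
      ((n + 2 : ℕ) : ℝ≥0∞)⁻¹ * ‖annN (cut hB (e q)) (annN (cut hA (e p)) ψ)‖ₑ ^ 2 := by
    intro q
    have h5 := map_smul (annN (cut hB (e q)) : antisym ν (n + 1) →L[ℂ] antisym ν n)
      ((-1) ^ (i : ℕ) * (Real.sqrt (((n + 1 : ℕ) : ℝ) + 1) : ℂ)⁻¹) (annN (cut hA (e p)) ψ)
    rw [h5, enorm_smul, mul_pow, h4]
  rw [h3]
  simp_rw [h6]
  rw [ENNReal.tsum_mul_left, ENNReal.mul_inv (by simp) (by simp), Nat.cast_succ n]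
  ring

/-- The two-particle density of an `N`-particle vector, as a measure on `M × M`. -/
noncomputable def pairMeasure {N : ℕ} (ψ : antisym ν N) : Measure (M × M) :=
  ∑ i : Fin N, ∑ k ∈ Finset.Ioi i, ((Measure.pi fun _ : Fin N => ν).withDensity
    fun z => ‖(ψ : L2N ν N) z‖ₑ ^ 2).map fun z => (z i, z k)

theorem measurable_enorm_sq {N : ℕ} (ψ : antisym ν N) :
    Measurable fun z => ‖(ψ : L2N ν N) z‖ₑ ^ 2 :=
  (Lp.stronglyMeasurable (ψ : L2N ν N)).measurable.enorm.pow_const 2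

theorem lintegral_pairMeasure {N : ℕ} (ψ : antisym ν N) {v : M × M → ℝ≥0∞} (hv : Measurable v) :
    ∫⁻ p, v p ∂(pairMeasure ψ) = ∑ i : Fin N, ∑ k ∈ Finset.Ioi i,
      ∫⁻ z, v (z i, z k) * ‖(ψ : L2N ν N) z‖ₑ ^ 2 ∂(Measure.pi fun _ : Fin N => ν) := by
  rw [pairMeasure, lintegral_finsetSum_measure]
  refine Finset.sum_congr rfl fun i _ => ?_
  rw [lintegral_finsetSum_measure]
  refine Finset.sum_congr rfl fun k _ => ?_
  have hz : Measurable fun z : Fin N → M => (z i, z k) :=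
    (measurable_pi_apply i).prodMk (measurable_pi_apply k)
  have hvz : Measurable fun z : Fin N → M => v (z i, z k) := hv.comp hz
  rw [lintegral_map hv hz, lintegral_withDensity_eq_lintegral_mul _ (measurable_enorm_sq ψ)
    hvz]
  refine lintegral_congr fun z => ?_
  rw [Pi.mul_apply, mul_comm]

theorem pairForm_eq {V : M × M → ℝ} (hV : Measurable V) {N : ℕ} (ψ : antisym ν N) :
    pairForm ν V N (ψ : L2N ν N) = ∫⁻ p, ENNReal.ofReal (V p) ∂(pairMeasure ψ) := by
  rw [lintegral_pairMeasure ψ hV.ennreal_ofReal, pairForm]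

theorem sum_card_Ioi (n : ℕ) : (∑ i : Fin n, (Finset.Ioi i).card) * 2 = n * (n - 1) := by
  rw [← Finset.sum_range_id_mul_two n, ← Finset.sum_range_reflect, Finset.sum_range]
  congr 1
  refine Finset.sum_congr rfl fun i _ => ?_
  rw [Fin.card_Ioi]

/-- There are (n+2)(n+1)/2 pairs i < k, all giving the same mass, and the factor 2 makes the count
cancel the normalization. Working with a measure lets V be integrated only after rectangles have
been compared. -/
theorem pairMeasure_prod {κ : Type*} [Countable κ] (e : HilbertBasis κ ℂ (OneP ν))
    {A B : Set M} (hA : MeasurableSet A) (hB : MeasurableSet B) {n : ℕ} (ψ : antisym ν (n + 2)) :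
    2 * pairMeasure ψ (A ×ˢ B) =
      ∑' p, ∑' q, ‖annN (cut hB (e q)) (annN (cut hA (e p)) ψ)‖ₑ ^ 2 := by
  set S := ∑' p, ∑' q, ‖annN (cut hB (e q)) (annN (cut hA (e p)) ψ)‖ₑ ^ 2 with hS
  have h1 : pairMeasure ψ (A ×ˢ B) = ∑ i : Fin (n + 2), ∑ k ∈ Finset.Ioi i,
      (((n + 2 : ℕ) : ℝ≥0∞) * ((n + 1 : ℕ) : ℝ≥0∞))⁻¹ * S := by
    rw [← lintegral_indicator_one (hA.prod hB),
      lintegral_pairMeasure ψ (measurable_one.indicator (hA.prod hB))]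
    refine Finset.sum_congr rfl fun i _ => Finset.sum_congr rfl fun k hk => ?_
    rw [hS, ← lintegral_two_slots e hA hB (Finset.mem_Ioi.1 hk).ne ψ]
    refine lintegral_congr fun z => ?_
    by_cases h1 : z i ∈ A <;> by_cases h2 : z k ∈ B <;> simp [h1, h2, Set.indicator]
  have h2 := congrArg (fun j : ℕ => (j : ℝ≥0∞)) (sum_card_Ioi (n + 2))
  simp only [Nat.cast_mul, Nat.add_succ_sub_one] at h2
  rw [h1]
  simp_rw [Finset.sum_const, ← Finset.sum_smul]
  rw [nsmul_eq_mul, ← mul_assoc, ← mul_assoc, mul_comm 2]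
  have h3 : ((2 : ℕ) : ℝ≥0∞) = 2 := by norm_num
  rw [← h3, h2, ENNReal.mul_inv_cancel (by simp) (ENNReal.mul_ne_top (by simp) (by simp)), one_mul]

end SectorForms

/-! ### Kinetic energy, particle number and pair density of a Fock vector -/

section FockForms

variable {M : Type*} [MeasurableSpace M] {ν : Measure M} [SigmaFinite ν]

theorem tsum_enorm_annF (f : OneP ν) (Ψ : Fock ν) :
    ‖annF f Ψ‖ₑ ^ 2 = ∑' n, ‖annN f (Ψ (n + 1))‖ₑ ^ 2 := by
  rw [← Fock.tsum_enorm_sq]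
  rfl

theorem tsum_kineticForm {h : OneP ν →ₗ.[ℂ] OneP ν} {m : ℝ} {κ : Type*} [Countable κ]
    {φ : κ → OneP ν} (hφ : ∀ f, opForm h m f = ∑' k, ‖⟪φ k, f⟫_ℂ‖ₑ ^ 2) (Ψ : Fock ν) :
    ∑' N, kineticForm ν h m N (comp ν Ψ N) = ∑' k, ‖annF (φ k) Ψ‖ₑ ^ 2 := by
  rw [tsum_eq_zero_add' ENNReal.summable]
  simp_rw [tsum_enorm_annF]
  rw [ENNReal.tsum_comm, kineticForm, zero_add]
  exact tsum_congr fun n => kineticForm_succ hφ (Ψ (n + 1))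

theorem numberForm_eq {κ : Type*} [Countable κ] (e : HilbertBasis κ ℂ (OneP ν)) (Ψ : Fock ν) :
    numberForm ν Ψ = ∑' p, ‖annF (e p) Ψ‖ₑ ^ 2 := by
  rw [numberForm, tsum_eq_zero_add' ENNReal.summable]
  simp_rw [tsum_enorm_annF]
  rw [ENNReal.tsum_comm, Nat.cast_zero, zero_mul, zero_add]
  exact tsum_congr fun n => (tsum_annN_basis e (Ψ (n + 1))).symm

/-- The two-particle density of a Fock space vector. -/
noncomputable def fockPairMeasure (Ψ : Fock ν) : Measure (M × M) :=
  Measure.sum fun N => pairMeasure (Ψ N)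

theorem fockForm_eq {h : OneP ν →ₗ.[ℂ] OneP ν} {m : ℝ} {κ : Type*} [Countable κ]
    {φ : κ → OneP ν} (hφ : ∀ f, opForm h m f = ∑' k, ‖⟪φ k, f⟫_ℂ‖ₑ ^ 2) {V : M × M → ℝ}
    (hV : Measurable V) (Ψ : Fock ν) :
    fockForm ν h m V Ψ = ∑' k, ‖annF (φ k) Ψ‖ₑ ^ 2 +
      ∫⁻ p, ENNReal.ofReal (V p) ∂(fockPairMeasure Ψ) := by
  rw [fockForm, ← tsum_kineticForm hφ, fockPairMeasure, lintegral_sum_measure, ← ENNReal.tsum_add]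
  refine tsum_congr fun N => ?_
  rw [nBodyForm, ← pairForm_eq hV]
  rfl

theorem fockPairMeasure_prod {κ : Type*} [Countable κ] (e : HilbertBasis κ ℂ (OneP ν))
    {A B : Set M} (hA : MeasurableSet A) (hB : MeasurableSet B) (Ψ : Fock ν) :
    2 * fockPairMeasure Ψ (A ×ˢ B) =
      ∑' p, ∑' q, ‖annF (cut hB (e q)) (annF (cut hA (e p)) Ψ)‖ₑ ^ 2 := by
  -- The sectors with at most one particle contain no pairs, so the sum starts at N = 2, matching
  -- the two annihilations.
  have h0 : pairMeasure (Ψ 0) = 0 := by simp [pairMeasure]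
  have h1 : pairMeasure (Ψ 1) = 0 := by
    rw [pairMeasure]
    refine Finset.sum_eq_zero fun i _ => ?_
    have : Finset.Ioi i = ∅ := by
      ext k
      simp [Subsingleton.elim k i]
    rw [this, Finset.sum_empty]
  rw [fockPairMeasure, Measure.sum_apply _ (hA.prod hB), tsum_eq_zero_add' ENNReal.summable,
    tsum_eq_zero_add' ENNReal.summable, h0, h1]
  simp only [zero_add, Measure.coe_zero, Pi.zero_apply]
  rw [← ENNReal.tsum_mul_left]
  have h2 : ∀ n, 2 * pairMeasure (Ψ (n + 1 + 1)) (A ×ˢ B) = ∑' p, ∑' q,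
      ‖annN (cut hB (e q)) (annN (cut hA (e p)) (Ψ (n + 2)))‖ₑ ^ 2 :=
    fun n => pairMeasure_prod e hA hB (Ψ (n + 2))
  simp_rw [h2, tsum_enorm_annF]
  rw [ENNReal.tsum_comm]
  refine tsum_congr fun p => ?_
  rw [ENNReal.tsum_comm]
  rfl

end FockForms

end BHF

namespace BHF

set_option linter.unusedSectionVars false

/-! ### The pair density of a one-particle density matrix -/

section PairDensity

variable {M : Type*} [MeasurableSpace M] {ν : Measure M} [SigmaFinite ν]

/-- The matrix element of `(1 - Ex)(γ ⊗ γ)` at `a ⊗ b`, where `γ = ∑ᵢ |gᵢ⟩⟨gᵢ|`. -/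
noncomputable def pairGram {ι : Type*} (g : ι → OneP ν) (a b : OneP ν) : ℝ≥0∞ :=
  2⁻¹ * ∑' r : ι × ι, ‖⟪a, g r.1⟫_ℂ * ⟪b, g r.2⟫_ℂ - ⟪a, g r.2⟫_ℂ * ⟪b, g r.1⟫_ℂ‖ₑ ^ 2

/-- The function `|f(x)g(y) - g(x)f(y)|²`. -/
noncomputable def wedgeSq (f g : OneP ν) (z : M × M) : ℝ≥0∞ :=
  ‖f z.1 * g z.2 - g z.1 * f z.2‖ₑ ^ 2

/-- The measure with density the diagonal of `(1 - Ex)(γ ⊗ γ)`, where `γ = ∑ᵢ |gᵢ⟩⟨gᵢ|`. -/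
noncomputable def pairDensity {ι : Type*} (g : ι → OneP ν) : Measure (M × M) :=
  (ν.prod ν).withDensity fun z =>
    2⁻¹ * ∑' r : ι × ι, wedgeSq (g r.1) (g r.2) z

theorem measurable_wedgeSq (f g : OneP ν) : Measurable (wedgeSq f g) := by
  have hf := (Lp.stronglyMeasurable f).measurable
  have hg := (Lp.stronglyMeasurable g).measurable
  exact (((hf.comp measurable_fst).mul (hg.comp measurable_snd)).sub
    ((hg.comp measurable_fst).mul (hf.comp measurable_snd))).enorm.pow_const 2

theorem measurable_tsum_wedgeSq {ι : Type*} [Countable ι] (g : ι → OneP ν) :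
    Measurable fun z : M × M => ∑' r : ι × ι, wedgeSq (g r.1) (g r.2) z :=
  Measurable.tsum (f := fun (r : ι × ι) z => wedgeSq (g r.1) (g r.2) z)
    fun r => measurable_wedgeSq (g r.1) (g r.2)

theorem measurable_pairDensity {ι : Type*} [Countable ι] (g : ι → OneP ν) :
    Measurable fun z : M × M => (2⁻¹ : ℝ≥0∞) * ∑' r : ι × ι, wedgeSq (g r.1) (g r.2) z :=
  (measurable_tsum_wedgeSq g).const_mul _

theorem setLIntegral_wedgeSq {κ : Type*} [Countable κ] (e : HilbertBasis κ ℂ (OneP ν))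
    {A B : Set M} (hA : MeasurableSet A) (hB : MeasurableSet B) (f g : OneP ν) :
    ∫⁻ z in A ×ˢ B, wedgeSq f g z ∂(ν.prod ν) =
      ∑' p, ∑' q, ‖⟪cut hA (e p), f⟫_ℂ * ⟪cut hB (e q), g⟫_ℂ -
        ⟪cut hA (e p), g⟫_ℂ * ⟪cut hB (e q), f⟫_ℂ‖ₑ ^ 2 := by
  have h := tsum_inner_tens_cut e hA hB (tens f g - tens g f)
  simp_rw [inner_sub_right, inner_tens_tens] at h
  rw [h]
  refine lintegral_congr_ae (ae_restrict_of_ae ?_)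
  filter_upwards [tens_ae f g, tens_ae g f, Lp.coeFn_sub (tens f g) (tens g f)] with z h1 h2 h3
  rw [h3, Pi.sub_apply, h1, h2, wedgeSq]

theorem pairDensity_prod {ι κ : Type*} [Countable ι] [Countable κ]
    (e : HilbertBasis κ ℂ (OneP ν)) {A B : Set M} (hA : MeasurableSet A) (hB : MeasurableSet B)
    (g : ι → OneP ν) :
    pairDensity g (A ×ˢ B) = ∑' p, ∑' q, pairGram g (cut hA (e p)) (cut hB (e q)) := by
  rw [pairDensity, withDensity_apply _ (hA.prod hB), lintegral_const_mul _ (measurable_tsum_wedgeSq g),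
    lintegral_tsum (f := fun (r : ι × ι) z => wedgeSq (g r.1) (g r.2) z)
      fun r => (measurable_wedgeSq (g r.1) (g r.2)).aemeasurable]
  simp_rw [setLIntegral_wedgeSq e hA hB, pairGram, ENNReal.tsum_mul_left]
  congr 1
  rw [ENNReal.tsum_comm]
  exact tsum_congr fun p => ENNReal.tsum_comm

theorem summable_inner_sq {ι : Type*} {g : ι → OneP ν} (hg : ∑' i, ‖g i‖ₑ ^ 2 ≠ ∞)
    (a : OneP ν) : Summable fun i => ‖⟪a, g i⟫_ℂ‖ ^ 2 := by
  refine Summable.of_nonneg_of_le (fun _ => by positivity) (fun i => ?_)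
    ((summable_norm_sq_of_tsum_ne_top hg).mul_left (‖a‖ ^ 2))
  rw [← mul_pow]
  exact pow_le_pow_left₀ (norm_nonneg _) (norm_inner_le_norm a (g i)) 2

/-- Lagrange's identity for the coefficients ⟨a, g_i⟩ and ⟨b, g_i⟩. It reads ⟨a,γa⟩⟨b,γb⟩ -
|⟨a,γb⟩|², so `pairGram` depends only on γ = ∑ |g_i⟩⟨g_i|; the additive form avoids truncated
subtraction. -/
theorem pairGram_add {ι : Type*} {g : ι → OneP ν} (hg : ∑' i, ‖g i‖ₑ ^ 2 ≠ ∞) (a b : OneP ν) :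
    pairGram g a b + ‖∑' i, ⟪a, g i⟫_ℂ * ⟪g i, b⟫_ℂ‖ₑ ^ 2 =
      (∑' i, ‖⟪a, g i⟫_ℂ‖ₑ ^ 2) * ∑' i, ‖⟪b, g i⟫_ℂ‖ₑ ^ 2 := by
  rw [lagrange_tsum_enorm (summable_inner_sq hg a) (summable_inner_sq hg b), add_comm, pairGram]
  simp_rw [inner_conj_symm]

theorem pairGram_le {ι : Type*} {g : ι → OneP ν} (hg : ∑' i, ‖g i‖ₑ ^ 2 ≠ ∞) (a b : OneP ν) :
    pairGram g a b ≤ (∑' i, ‖⟪a, g i⟫_ℂ‖ₑ ^ 2) * ∑' i, ‖⟪b, g i⟫_ℂ‖ₑ ^ 2 := by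
  rw [← pairGram_add hg]
  exact le_self_add

/-- The total mass is at most (Tr γ)². Finiteness is what allows comparison on rectangles to
suffice. -/
theorem pairDensity_univ_ne_top [TopologicalSpace.SeparableSpace (OneP ν)] {ι : Type*}
    [Countable ι] {g : ι → OneP ν} (hg : ∑' i, ‖g i‖ₑ ^ 2 ≠ ∞) :
    pairDensity g Set.univ ≠ ∞ := by
  set e := stdBasis (OneP ν)
  have hc : ∀ p, cut MeasurableSet.univ (e p) = e p := fun p => by
    refine Lp.ext ?_
    filter_upwards [cut_ae MeasurableSet.univ (e p)] with x hx
    rw [hx, Set.indicator_univ]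
  have h1 : ∑' p, ∑' i, ‖⟪e p, g i⟫_ℂ‖ₑ ^ 2 = ∑' i, ‖g i‖ₑ ^ 2 := by
    rw [ENNReal.tsum_comm]
    exact tsum_congr fun i => tsum_enorm_inner_sq e (g i)
  rw [← Set.univ_prod_univ, pairDensity_prod e MeasurableSet.univ MeasurableSet.univ]
  simp_rw [hc]
  have h2 : ∑' p, ∑' q, pairGram g (e p) (e q) ≤ (∑' i, ‖g i‖ₑ ^ 2) * ∑' i, ‖g i‖ₑ ^ 2 :=
    calc _ ≤ ∑' p, ∑' q, (∑' i, ‖⟪e p, g i⟫_ℂ‖ₑ ^ 2) * ∑' i, ‖⟪e q, g i⟫_ℂ‖ₑ ^ 2 :=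
          ENNReal.tsum_le_tsum fun p => ENNReal.tsum_le_tsum fun q => pairGram_le hg _ _
      _ = _ := by simp_rw [ENNReal.tsum_mul_left, ENNReal.tsum_mul_right, h1]
  exact ne_top_of_le_ne_top (ENNReal.mul_ne_top hg hg) h2

/-- A finite measure on a product is determined by its values on rectangles. -/
theorem ext_prod_of_finite {P Q : Measure (M × M)} (hP : P Set.univ ≠ ∞)
    (h : ∀ A B : Set M, MeasurableSet A → MeasurableSet B → P (A ×ˢ B) = Q (A ×ˢ B)) : P = Q := by
  have : IsFiniteMeasure P := ⟨lt_top_iff_ne_top.2 hP⟩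
  refine ext_of_generate_finite _ generateFrom_prod.symm isPiSystem_prod ?_ ?_
  · rintro _ ⟨A, hA, B, hB, rfl⟩
    exact h A B hA hB
  · rw [← Set.univ_prod_univ]
    exact h _ _ MeasurableSet.univ MeasurableSet.univ

theorem pairDensity_congr [TopologicalSpace.SeparableSpace (OneP ν)] {ι ι' : Type*} [Countable ι]
    [Countable ι'] {g : ι → OneP ν} {g' : ι' → OneP ν} (hg : ∑' i, ‖g i‖ₑ ^ 2 ≠ ∞)
    (h : ∀ a b, pairGram g a b = pairGram g' a b) : pairDensity g = pairDensity g' := by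
  refine ext_prod_of_finite (pairDensity_univ_ne_top hg) fun A B hA hB => ?_
  rw [pairDensity_prod (stdBasis _) hA hB, pairDensity_prod (stdBasis _) hA hB]
  simp_rw [h]

theorem pairGram_congr {ι ι' : Type*} {g : ι → OneP ν} {g' : ι' → OneP ν}
    (hg : ∑' i, ‖g i‖ₑ ^ 2 ≠ ∞) (hg' : ∑' i, ‖g' i‖ₑ ^ 2 ≠ ∞)
    (h1 : ∀ a, ∑' i, ‖⟪a, g i⟫_ℂ‖ₑ ^ 2 = ∑' i, ‖⟪a, g' i⟫_ℂ‖ₑ ^ 2)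
    (h2 : ∀ a b, ∑' i, ⟪a, g i⟫_ℂ * ⟪g i, b⟫_ℂ = ∑' i, ⟪a, g' i⟫_ℂ * ⟪g' i, b⟫_ℂ)
    (a b : OneP ν) : pairGram g a b = pairGram g' a b := by
  have h3 := pairGram_add hg a b
  rw [h1, h1, h2, ← pairGram_add hg' a b] at h3
  exact (ENNReal.add_left_inj (by finiteness)).1 h3

theorem lintegral_pairDensity {ι : Type*} [Countable ι] (g : ι → OneP ν) {v : M × M → ℝ≥0∞}
    (hv : Measurable v) : ∫⁻ z, v z ∂(pairDensity g) = 2⁻¹ * ∑' r : ι × ι,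
      ∫⁻ z, v z * wedgeSq (g r.1) (g r.2) z ∂(ν.prod ν) := by
  have hm : ∀ r : ι × ι, Measurable fun z => v z * wedgeSq (g r.1) (g r.2) z :=
    fun r => hv.mul (measurable_wedgeSq (g r.1) (g r.2))
  rw [pairDensity, lintegral_withDensity_eq_lintegral_mul _ (measurable_pairDensity g) hv,
    ← lintegral_tsum (f := fun (r : ι × ι) z => v z * wedgeSq (g r.1) (g r.2) z)
      fun r => (hm r).aemeasurable, ← lintegral_const_mul _
      (Measurable.tsum (f := fun (r : ι × ι) z => v z * wedgeSq (g r.1) (g r.2) z) hm)]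
  refine lintegral_congr fun z => ?_
  rw [Pi.mul_apply, ENNReal.tsum_mul_left]
  ring

theorem ae_summable_sq {ι : Type*} [Countable ι] {g : ι → OneP ν} (hg : ∑' i, ‖g i‖ₑ ^ 2 ≠ ∞) :
    ∀ᵐ x ∂ν, Summable fun i => ‖g i x‖ ^ 2 := by
  have hm : ∀ i, Measurable fun x => ‖g i x‖ₑ ^ 2 :=
    fun i => (Lp.stronglyMeasurable (g i)).measurable.enorm.pow_const 2
  have h1 : ∫⁻ x, ∑' i, ‖g i x‖ₑ ^ 2 ∂ν ≠ ∞ := by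
    rw [lintegral_tsum fun i => (hm i).aemeasurable]
    simpa only [← enorm_sq_eq_lintegral] using hg
  filter_upwards [ae_lt_top (Measurable.tsum hm) h1] with x hx
  exact summable_norm_sq_of_tsum_ne_top hx.ne

/-- Lagrange's identity with u_i = g_i(x) and v_i = g_i(y): γ(x,x)γ(y,y) - |γ(x,y)|² is half a sum
of squares. In particular the negative part in `mulTrace` vanishes when V ≥ 0. -/
theorem ofReal_posKernel_diag {ι : Type*} {u v : ι → ℂ} (hu : Summable fun i => ‖u i‖ ^ 2)
    (hv : Summable fun i => ‖v i‖ ^ 2) :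
    0 ≤ ((∑' i, u i * (starRingEnd ℂ) (u i)) * (∑' i, v i * (starRingEnd ℂ) (v i)) -
      (∑' i, v i * (starRingEnd ℂ) (u i)) * ∑' i, u i * (starRingEnd ℂ) (v i)).re ∧
    ENNReal.ofReal ((∑' i, u i * (starRingEnd ℂ) (u i)) * (∑' i, v i * (starRingEnd ℂ) (v i)) -
      (∑' i, v i * (starRingEnd ℂ) (u i)) * ∑' i, u i * (starRingEnd ℂ) (v i)).re =
      2⁻¹ * ∑' r : ι × ι, ‖u r.1 * v r.2 - u r.2 * v r.1‖ₑ ^ 2 := by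
  obtain ⟨h1, h2⟩ := lagrange_tsum hu hv
  have hd : ∀ w : ι → ℂ, ∑' i, w i * (starRingEnd ℂ) (w i) = ((∑' i, ‖w i‖ ^ 2 : ℝ) : ℂ) := by
    intro w
    rw [Complex.ofReal_tsum]
    refine tsum_congr fun i => ?_
    rw [Complex.mul_conj, Complex.normSq_eq_norm_sq]
  have hc : ∑' i, v i * (starRingEnd ℂ) (u i) =
      (starRingEnd ℂ) (∑' i, u i * (starRingEnd ℂ) (v i)) := by
    rw [Complex.conj_tsum]
    refine tsum_congr fun i => ?_
    rw [map_mul, Complex.conj_conj, mul_comm]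
  have h3 : ((∑' i, u i * (starRingEnd ℂ) (u i)) * (∑' i, v i * (starRingEnd ℂ) (v i)) -
      (∑' i, v i * (starRingEnd ℂ) (u i)) * ∑' i, u i * (starRingEnd ℂ) (v i)).re =
      (1 / 2) * ∑' r : ι × ι, ‖u r.1 * v r.2 - u r.2 * v r.1‖ ^ 2 := by
    rw [hd, hd, hc, mul_comm ((starRingEnd ℂ) _), Complex.mul_conj, ← Complex.ofReal_mul,
      ← Complex.ofReal_sub, Complex.ofReal_re, Complex.normSq_eq_norm_sq, h2]
    ring
  rw [h3]
  refine ⟨mul_nonneg (by norm_num) (tsum_nonneg fun _ => by positivity), ?_⟩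
  rw [tsum_enorm_sq_eq_ofReal h1, ENNReal.ofReal_mul (by norm_num), one_div,
    ENNReal.ofReal_inv_of_pos (by norm_num)]
  simp

/-- The vectors `γ^{1/2} eᵢ`. -/
noncomputable def sqrtVec (γ : OneP ν →L[ℂ] OneP ν) (i : BasisIndex (OneP ν)) : OneP ν :=
  opSqrt γ (stdBasis (OneP ν) i)

theorem tsum_sqrtVec {γ : OneP ν →L[ℂ] OneP ν} (hγ : 0 ≤ γ) :
    ∑' i, ‖sqrtVec γ i‖ₑ ^ 2 = posTrace γ :=
  (posTrace_eq hγ).symm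

variable [TopologicalSpace.SeparableSpace (OneP ν)]

theorem mulTrace_eq {V : M × M → ℝ} (hVm : Measurable V) (hV : ∀ᵐ p ∂(ν.prod ν), 0 ≤ V p)
    {γ : OneP ν →L[ℂ] OneP ν} (hγ : 0 ≤ γ) (ht : posTrace γ ≠ ∞) :
    mulTrace ν V (fun p q =>
      tensorKernel (posKernel ν γ) (posKernel ν γ) p q -
        exKernel (tensorKernel (posKernel ν γ) (posKernel ν γ)) p q) =
      ((∫⁻ p, ENNReal.ofReal (V p) ∂(pairDensity (sqrtVec γ)) : ℝ≥0∞) : EReal) := by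
  have hg : ∑' i, ‖sqrtVec γ i‖ₑ ^ 2 ≠ ∞ := by rwa [tsum_sqrtVec hγ]
  have hs := ae_summable_sq hg
  have hkey : ∀ᵐ p ∂(ν.prod ν),
      0 ≤ (tensorKernel (posKernel ν γ) (posKernel ν γ) p p -
        exKernel (tensorKernel (posKernel ν γ) (posKernel ν γ)) p p).re ∧
      ENNReal.ofReal (tensorKernel (posKernel ν γ) (posKernel ν γ) p p -
        exKernel (tensorKernel (posKernel ν γ) (posKernel ν γ)) p p).re =
      2⁻¹ * ∑' r : BasisIndex (OneP ν) × BasisIndex (OneP ν), 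
        wedgeSq (sqrtVec γ r.1) (sqrtVec γ r.2) p := by
    filter_upwards [ae_fst (μ := ν) hs, ae_snd (ν := ν) hs] with p h1 h2
    exact ofReal_posKernel_diag h1 h2
  have h1 : ∫⁻ p, ENNReal.ofReal (-(V p * (tensorKernel (posKernel ν γ) (posKernel ν γ) p p -
        exKernel (tensorKernel (posKernel ν γ) (posKernel ν γ)) p p).re)) ∂(ν.prod ν) = 0 := by
    refine (lintegral_congr_ae ?_).trans lintegral_zero
    filter_upwards [hkey, hV] with p hp hv
    exact ENNReal.ofReal_of_nonpos (neg_nonpos.2 (mul_nonneg hv hp.1))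
  rw [mulTrace, h1, EReal.coe_ennreal_zero, sub_zero, pairDensity,
    lintegral_withDensity_eq_lintegral_mul _ (measurable_pairDensity _) hVm.ennreal_ofReal]
  congr 1
  refine lintegral_congr_ae ?_
  filter_upwards [hkey, hV] with p hp hv
  rw [ENNReal.ofReal_mul hv, hp.2, Pi.mul_apply, mul_comm]

/-- The energy `∑ᵢ ⟨gᵢ, (h + m) gᵢ⟩ + ½ ∫ V dD` of `γ = ∑ᵢ |gᵢ⟩⟨gᵢ|`. -/
noncomputable def familyForm (h : OneP ν →ₗ.[ℂ] OneP ν) (m : ℝ) (V : M × M → ℝ) {ι : Type*}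
    (g : ι → OneP ν) : ℝ≥0∞ :=
  ∑' i, opForm h m (g i) + 2⁻¹ * ∫⁻ p, ENNReal.ofReal (V p) ∂(pairDensity g)

theorem ereal_half_mul (x : ℝ≥0∞) :
    ((1 / 2 : ℝ) : EReal) * (x : EReal) = ((2⁻¹ * x : ℝ≥0∞) : EReal) := by
  rw [EReal.coe_ennreal_mul]
  congr 1
  rw [show (2⁻¹ : ℝ≥0∞) = ENNReal.ofReal (1 / 2) by
    rw [one_div, ENNReal.ofReal_inv_of_pos (by norm_num)]; simp]
  rw [EReal.coe_ennreal_ofReal, max_eq_left (by norm_num)]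

theorem hfFunctional_eq {V : M × M → ℝ} (hVm : Measurable V) (hV : ∀ᵐ p ∂(ν.prod ν), 0 ≤ V p)
    {γ : OneP ν →L[ℂ] OneP ν} (hγ : 0 ≤ γ) (ht : posTrace γ ≠ ∞) (h : OneP ν →ₗ.[ℂ] OneP ν)
    (m μ : ℝ) : hfFunctional ν h m μ V γ =
      (familyForm h m V (sqrtVec γ) : EReal) - (((m + μ) * (posTrace γ).toReal : ℝ) : EReal) := by
  rw [hfFunctional, mulTrace_eq hVm hV hγ ht, ereal_half_mul, familyForm, oneBodyEnergy, formTrace,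
    EReal.coe_ennreal_add, sub_eq_add_neg, sub_eq_add_neg, add_assoc, add_assoc]
  congr 1
  rw [add_comm]

end PairDensity

end BHF

namespace BHF

set_option linter.unusedSectionVars false

/-! ### Pure states -/

section PureState

variable {H : Type*} [NormedAddCommGroup H] [InnerProductSpace ℂ H] [CompleteSpace H] {Φ : H}

theorem pureState_nonneg (Φ : H) : 0 ≤ InnerProductSpace.rankOne ℂ Φ Φ :=
  (ContinuousLinearMap.nonneg_iff_isPositive _).2 (InnerProductSpace.isPositive_rankOne_self Φ)

theorem opSqrt_pureState (hΦ : ‖Φ‖ = 1) :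
    opSqrt (InnerProductSpace.rankOne ℂ Φ Φ) = InnerProductSpace.rankOne ℂ Φ Φ := by
  refine CFC.sqrt_unique ?_ (pureState_nonneg Φ)
  ext x
  have h : ⟪Φ, Φ⟫_ℂ = 1 := by rw [inner_self_eq_norm_sq_to_K, hΦ]; norm_num
  rw [mul_apply_eq_comp, InnerProductSpace.rankOne_apply, InnerProductSpace.rankOne_apply,
    inner_smul_right, h, mul_one]

/-- The projection is its own square root and sends e_i to ⟨Φ, e_i⟩Φ; homogeneity takes the scalars
out, and Parseval sums their squares to 1. -/
theorem formTrace_pureState (hΦ : ‖Φ‖ = 1) {Q : H → ℝ≥0∞}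
    (hQ : ∀ c : ℂ, Q (c • Φ) = ‖c‖ₑ ^ 2 * Q Φ) :
    formTrace Q (InnerProductSpace.rankOne ℂ Φ Φ) = Q Φ := by
  simp_rw [formTrace, opSqrt_pureState hΦ, InnerProductSpace.rankOne_apply, hQ,
    ENNReal.tsum_mul_right, enorm_inner_symm Φ, tsum_enorm_inner_sq]
  rw [← ofReal_norm, hΦ]
  simp

theorem posTrace_pureState (hΦ : ‖Φ‖ = 1) : posTrace (InnerProductSpace.rankOne ℂ Φ Φ) = 1 := by
  rw [posTrace_eq (pureState_nonneg Φ)]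
  have := formTrace_pureState hΦ (Q := fun x => ‖x‖ₑ ^ 2)
    (fun c => by rw [enorm_smul, mul_pow])
  rw [formTrace] at this
  rw [this, ← ofReal_norm, hΦ]
  simp

theorem trExp_pureState (Φ : H) (B : H →L[ℂ] H) :
    trExp (InnerProductSpace.rankOne ℂ Φ Φ) B = ⟪Φ, B Φ⟫_ℂ := by
  simp_rw [trExp, InnerProductSpace.rankOne_apply, inner_smul_right,
    ← ContinuousLinearMap.adjoint_inner_left B]
  exact (stdBasis H).tsum_inner_mul_inner _ _

end PureState

/-! ### Expectations in a density matrix -/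

section Expectation

variable {H : Type*} [NormedAddCommGroup H] [InnerProductSpace ℂ H] [CompleteSpace H]
  {ρ : H →L[ℂ] H}

theorem trExp_adjoint_mul (hρ : 0 ≤ ρ) (ht : posTrace ρ ≠ ∞) (B C : H →L[ℂ] H) :
    trExp ρ (ContinuousLinearMap.adjoint B * C) =
      ∑' i, ⟪B (opSqrt ρ (stdBasis H i)), C (opSqrt ρ (stdBasis H i))⟫_ℂ := by
  rw [trExp_eq hρ ht]
  refine tsum_congr fun i => ?_
  rw [mul_apply_eq_comp, ContinuousLinearMap.adjoint_inner_right]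

theorem trExp_adjoint_mul_self (hρ : 0 ≤ ρ) (ht : posTrace ρ ≠ ∞) (B : H →L[ℂ] H) :
    trExp ρ (ContinuousLinearMap.adjoint B * B) =
      ((∑' i, ‖B (opSqrt ρ (stdBasis H i))‖ ^ 2 : ℝ) : ℂ) := by
  rw [trExp_adjoint_mul hρ ht, Complex.ofReal_tsum]
  exact tsum_congr fun i => inner_self_ofReal _

theorem trExp_adjoint (hρ : 0 ≤ ρ) (ht : posTrace ρ ≠ ∞) (B : H →L[ℂ] H) :
    trExp ρ (ContinuousLinearMap.adjoint B) = (starRingEnd ℂ) (trExp ρ B) := by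
  rw [trExp_eq hρ ht, trExp_eq hρ ht, Complex.conj_tsum]
  refine tsum_congr fun i => ?_
  rw [ContinuousLinearMap.adjoint_inner_right, inner_conj_symm]

end Expectation

theorem wickSum_two (b : Fin (2 * 2) → Fin (2 * 2) → ℂ) :
    wickSum 2 b = b 0 1 * b 2 3 - b 0 2 * b 1 3 + b 0 3 * b 1 2 := by
  have h1 : ∀ b : Fin (2 * 1) → Fin (2 * 1) → ℂ, wickSum 1 b = b 0 1 := by
    intro b
    refine (wickSum_succ 0 b).trans ?_
    rw [Fin.sum_univ_one, wickSum_zero]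
    simp
  refine (wickSum_succ 1 b).trans ?_
  rw [Fin.sum_univ_three, h1, h1, h1]
  have e1 : ∀ p q p' q' : Fin (2 * 2), p = p' → q = q' → b p q = b p' q' := by
    rintro p q _ _ rfl rfl; rfl
  rw [e1 (Fin.succAbove (0 : Fin (2 * 1 + 1)) 0).succ
      (Fin.succAbove (0 : Fin (2 * 1 + 1)) 1).succ 2 3 rfl rfl,
    e1 (Fin.succAbove (1 : Fin (2 * 1 + 1)) 0).succ
      (Fin.succAbove (1 : Fin (2 * 1 + 1)) 1).succ 1 3 rfl rfl,
    e1 (Fin.succAbove (2 : Fin (2 * 1 + 1)) 0).succ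
      (Fin.succAbove (2 : Fin (2 * 1 + 1)) 1).succ 1 2 rfl rfl,
    e1 0 (Fin.succ 0) 0 1 rfl rfl, e1 0 (Fin.succ 1) 0 2 rfl rfl, e1 0 (Fin.succ 2) 0 3 rfl rfl]
  norm_num
  ring

/-! ### Four-point functions, and the quasifreeness of Slater determinants -/

section Quasifree

variable {M : Type*} [MeasurableSpace M] {ν : Measure M} [SigmaFinite ν]

theorem creF_zero : creF (0 : OneP ν) = 0 := by
  have := creF_smul (0 : ℂ) (0 : OneP ν)
  rwa [zero_smul, zero_smul] at this

theorem annF_zero : annF (0 : OneP ν) = 0 := by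
  have := annF_smul (0 : ℂ) (0 : OneP ν)
  rwa [zero_smul, map_zero, zero_smul] at this

theorem adjoint_annF (f : OneP ν) : ContinuousLinearMap.adjoint (annF f) = creF f := rfl

theorem adjoint_annF_mul (a b : OneP ν) :
    ContinuousLinearMap.adjoint (annF b * annF a) = creF a * creF b := by
  change ContinuousLinearMap.adjoint (annF b ∘L annF a) = _
  rw [ContinuousLinearMap.adjoint_comp]
  rfl

theorem tsum_annF_ne_top {ρ : Fock ν →L[ℂ] Fock ν} (hρ : 0 ≤ ρ) (ht : posTrace ρ ≠ ∞)
    (B : Fock ν →L[ℂ] Fock ν) :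
    Summable fun i => ‖B (opSqrt ρ (stdBasis (Fock ν) i))‖ ^ 2 :=
  summable_norm_sq_apply (summable_norm_opSqrt hρ ht) B

/-- Wick's formula for c*(a)c*(b)c(b)c(a) has three pairings: the direct term, the exchange term
with a minus sign, and the pairing term. The exchange term is moved to the left to stay within
nonnegative quantities. -/
theorem IsQuasifree.four_point {ρ : Fock ν →L[ℂ] Fock ν} (h : IsQuasifree ν ρ) (a b : OneP ν) :
    ∑' i, ‖annF b (annF a (opSqrt ρ (stdBasis (Fock ν) i)))‖ₑ ^ 2 +
        ‖trExp ρ (creF a * annF b)‖ₑ ^ 2 =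
      (∑' i, ‖annF a (opSqrt ρ (stdBasis (Fock ν) i))‖ₑ ^ 2) *
        (∑' i, ‖annF b (opSqrt ρ (stdBasis (Fock ν) i))‖ₑ ^ 2) +
        ‖trExp ρ (annF b * annF a)‖ₑ ^ 2 := by
  have ht : posTrace ρ ≠ ∞ := by rw [h.trace_one]; simp
  -- The zero entries switch off the creation or the annihilation half of each field operator.
  have hw := h.wick 2 le_rfl ![a, b, 0, 0] ![0, 0, b, a]
  have hA : ∀ i, field ν ((![a, b, 0, 0] : Fin 4 → OneP ν) i) ((![0, 0, b, a] : Fin 4 → OneP ν) i) =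
      (![creF a, creF b, annF b, annF a] : Fin 4 → Fock ν →L[ℂ] Fock ν) i := by
    intro i
    rw [field_eq]
    fin_cases i <;> simp [creF_zero, annF_zero]
  have hw' : trExp ρ (creF a * (creF b * (annF b * annF a))) =
      trExp ρ (creF a * creF b) * trExp ρ (annF b * annF a) -
        trExp ρ (creF a * annF b) * trExp ρ (creF b * annF a) +
        trExp ρ (creF a * annF a) * trExp ρ (creF b * annF b) := by
    have h1 := hw.trans (wickSum_two fun p q => trExp ρ
      (field ν ((![a, b, 0, 0] : Fin 4 → OneP ν) p) ((![0, 0, b, a] : Fin 4 → OneP ν) p) *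
        field ν ((![a, b, 0, 0] : Fin 4 → OneP ν) q) ((![0, 0, b, a] : Fin 4 → OneP ν) q)))
    simp only [hA] at h1
    have h2 : (List.ofFn fun i : Fin 4 =>
        field ν ((![a, b, 0, 0] : Fin 4 → OneP ν) i) ((![0, 0, b, a] : Fin 4 → OneP ν) i)).prod =
        creF a * (creF b * (annF b * annF a)) := by
      simp only [hA]
      simp [List.ofFn_succ]
    rw [← h2]
    refine Eq.trans ?_ h1
    simp only [hA]
  have e1 : trExp ρ (creF a * (creF b * (annF b * annF a))) =
      ((∑' i, ‖annF b (annF a (opSqrt ρ (stdBasis (Fock ν) i)))‖ ^ 2 : ℝ) : ℂ) := by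
    rw [← mul_assoc, ← adjoint_annF_mul, trExp_adjoint_mul_self h.nonneg ht]
    rfl
  have e2 : trExp ρ (creF a * creF b) * trExp ρ (annF b * annF a) =
      ((‖trExp ρ (annF b * annF a)‖ ^ 2 : ℝ) : ℂ) := by
    rw [← adjoint_annF_mul, trExp_adjoint h.nonneg ht, Complex.conj_mul', Complex.ofReal_pow]
  have e3 : trExp ρ (creF a * annF b) * trExp ρ (creF b * annF a) =
      ((‖trExp ρ (creF a * annF b)‖ ^ 2 : ℝ) : ℂ) := by
    have : creF b * annF a = ContinuousLinearMap.adjoint (creF a * annF b) := by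
      change _ = ContinuousLinearMap.adjoint (creF a ∘L annF b)
      rw [ContinuousLinearMap.adjoint_comp, adjoint_creF]
      rfl
    rw [this, trExp_adjoint h.nonneg ht, Complex.mul_conj', Complex.ofReal_pow]
  have e4 : ∀ c : OneP ν, trExp ρ (creF c * annF c) =
      ((∑' i, ‖annF c (opSqrt ρ (stdBasis (Fock ν) i))‖ ^ 2 : ℝ) : ℂ) := fun c => by
    rw [← adjoint_annF, trExp_adjoint_mul_self h.nonneg ht]
  rw [e1, e2, e3, e4, e4, ← Complex.ofReal_mul, ← Complex.ofReal_sub, ← Complex.ofReal_add,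
    Complex.ofReal_inj] at hw'
  have s1 := tsum_annF_ne_top h.nonneg ht (annF b * annF a)
  have hs1 : ∑' i, ‖annF b (annF a (opSqrt ρ (stdBasis (Fock ν) i)))‖ₑ ^ 2 =
      ENNReal.ofReal (∑' i, ‖annF b (annF a (opSqrt ρ (stdBasis (Fock ν) i)))‖ ^ 2) :=
    tsum_enorm_sq_eq_ofReal s1
  rw [hs1, tsum_enorm_sq_eq_ofReal (tsum_annF_ne_top h.nonneg ht (annF a)),
    tsum_enorm_sq_eq_ofReal (tsum_annF_ne_top h.nonneg ht (annF b)), enorm_sq_eq_ofReal,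
    enorm_sq_eq_ofReal, hw', ← ENNReal.ofReal_mul (tsum_nonneg fun _ => by positivity),
    ← ENNReal.ofReal_add ?_ (by positivity), ← ENNReal.ofReal_add ?_ (by positivity)]
  · congr 1
    ring
  · exact mul_nonneg (tsum_nonneg fun _ => by positivity) (tsum_nonneg fun _ => by positivity)
  · rw [← hw']
    exact tsum_nonneg fun _ => by positivity

/-! ### Slater determinants as quasifree states -/

theorem creF_wedge_of_mem_span {N : ℕ} {f : Fin N → OneP ν} {y : OneP ν}
    (hy : y ∈ Submodule.span ℂ (Set.range f)) : creF y (wedge f) = 0 := by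
  induction hy using Submodule.span_induction with
  | mem x hx =>
    obtain ⟨i, rfl⟩ := hx
    exact creF_wedge_self f i
  | zero => rw [creF_zero, zero_apply]
  | add x y _ _ hx hy => rw [creF_add, add_apply, hx, hy, add_zero]
  | smul c x _ hx => rw [creF_smul, smul_apply, hx, smul_zero]

/-- Splitting into occupied and empty orbitals: by the Pauli principle c*(y) kills the determinant,
and c(z) kills it because z is orthogonal to every occupied orbital. -/
theorem exists_split_span {N : ℕ} (f : Fin N → OneP ν) (x : OneP ν) :
    ∃ y z, x = y + z ∧ y ∈ Submodule.span ℂ (Set.range f) ∧ ∀ i, ⟪z, f i⟫_ℂ = 0 := by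
  have : FiniteDimensional ℂ (Submodule.span ℂ (Set.range f)) :=
    FiniteDimensional.span_of_finite ℂ (Set.finite_range f)
  obtain ⟨y, hy, z, hz, rfl⟩ :=
    (Submodule.span ℂ (Set.range f)).exists_add_mem_mem_orthogonal x
  exact ⟨y, z, rfl, hy, fun i => Submodule.inner_left_of_mem_orthogonal
    (Submodule.subset_span (Set.mem_range_self i)) hz⟩

theorem inner_of_mem_span {N : ℕ} {f : Fin N → OneP ν} (hf : Orthonormal ℂ f) {y : OneP ν}
    (hy : y ∈ Submodule.span ℂ (Set.range f)) (x : OneP ν) :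
    ⟪x, y⟫_ℂ = ∑ l, ⟪x, f l⟫_ℂ * ⟪f l, y⟫_ℂ := by
  induction hy using Submodule.span_induction with
  | mem y hy =>
    obtain ⟨i, rfl⟩ := hy
    simp [orthonormal_iff_ite.1 hf]
  | zero => simp
  | add u v _ _ hu hv => simp_rw [inner_add_right, mul_add, Finset.sum_add_distrib, ← hu, ← hv]
  | smul c u _ hu =>
    rw [inner_smul_right, hu, Finset.mul_sum]
    refine Finset.sum_congr rfl fun l _ => ?_
    rw [inner_smul_right, mul_left_comm]

/-- Only the occupied components y, y' of a, b matter, and since c*(y) kills the determinant the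
anticommutator alone gives ⟨y', y⟩. -/
theorem inner_annF_wedge {N : ℕ} {f : Fin N → OneP ν} (hf : Orthonormal ℂ f) (a b : OneP ν) :
    ⟪annF a (wedge f), annF b (wedge f)⟫_ℂ = ∑ l, ⟪b, f l⟫_ℂ * ⟪f l, a⟫_ℂ := by
  obtain ⟨y, z, rfl, hy, hz⟩ := exists_split_span f a
  obtain ⟨y', z', rfl, hy', hz'⟩ := exists_split_span f b
  have h1 : ⟪annF y (wedge f), annF y' (wedge f)⟫_ℂ = ⟪y', y⟫_ℂ := by
    have h2 := congrArg (fun L : Fock ν →L[ℂ] Fock ν => ⟪wedge f, L (wedge f)⟫_ℂ) (annF_creF y' y)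
    have h3 : ⟪wedge f, annF y' (creF y (wedge f)) + creF y (annF y' (wedge f))⟫_ℂ =
        ⟪wedge f, ⟪y', y⟫_ℂ • wedge f⟫_ℂ := h2
    rw [creF_wedge_of_mem_span hy, map_zero, zero_add, ← adjoint_annF,
      ContinuousLinearMap.adjoint_inner_right, inner_smul_right, inner_self_ofReal,
      norm_wedge hf] at h3
    rw [h3]
    norm_num
  rw [annF_add, annF_add, add_apply, add_apply, annF_wedge_eq_zero z f hz,
    annF_wedge_eq_zero z' f hz', add_zero, add_zero, h1, inner_of_mem_span hf hy]
  refine Finset.sum_congr rfl fun l _ => ?_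
  rw [inner_add_left, hz', add_zero, inner_add_right, ← inner_conj_symm (f l) z, hz, map_zero,
    add_zero]

theorem enorm_annF_wedge {N : ℕ} {f : Fin N → OneP ν} (hf : Orthonormal ℂ f) (a : OneP ν) :
    ‖annF a (wedge f)‖ₑ ^ 2 = ∑ l, ‖⟪a, f l⟫_ℂ‖ₑ ^ 2 := by
  have h := inner_annF_wedge hf a a
  have h2 : ∑ l, ⟪a, f l⟫_ℂ * ⟪f l, a⟫_ℂ = ((∑ l, ‖⟪a, f l⟫_ℂ‖ ^ 2 : ℝ) : ℂ) := by
    rw [Complex.ofReal_sum]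
    refine Finset.sum_congr rfl fun l _ => ?_
    rw [← inner_conj_symm (f l) a, Complex.mul_conj', Complex.ofReal_pow]
  rw [inner_self_ofReal, h2, Complex.ofReal_inj] at h
  simp_rw [enorm_sq_eq_ofReal]
  rw [h, ENNReal.ofReal_sum_of_nonneg fun _ _ => by positivity]

theorem inner_annF_annF_wedge {N : ℕ} (f : Fin N → OneP ν) (a b : OneP ν) :
    ⟪wedge f, annF b (annF a (wedge f))⟫_ℂ = 0 := by
  obtain ⟨y, z, rfl, hy, hz⟩ := exists_split_span f a
  rw [annF_add, add_apply, annF_wedge_eq_zero z f hz, add_zero]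
  have h := congrArg (fun L : Fock ν →L[ℂ] Fock ν => ⟪wedge f, L (wedge f)⟫_ℂ) (annF_annF b y)
  have h' : ⟪wedge f, annF b (annF y (wedge f)) + annF y (annF b (wedge f))⟫_ℂ = ⟪wedge f, 0⟫_ℂ := h
  rw [inner_add_right, ← ContinuousLinearMap.adjoint_inner_left (annF y), adjoint_annF,
    creF_wedge_of_mem_span hy, inner_zero_left, inner_zero_right, add_zero] at h'
  exact h'

theorem numberForm_smul (c : ℂ) (Ψ : Fock ν) :
    numberForm ν (c • Ψ) = ‖c‖ₑ ^ 2 * numberForm ν Ψ := by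
  rw [numberForm, numberForm, ← ENNReal.tsum_mul_left]
  refine tsum_congr fun N => ?_
  have : (c • Ψ) N = c • Ψ N := rfl
  rw [this, enorm_smul]
  ring

theorem numberForm_wedge {N : ℕ} {f : Fin N → OneP ν} (hf : Orthonormal ℂ f) :
    numberForm ν (wedge f) = N := by
  have h1 : ‖(slat f : antisym ν N)‖ₑ = 1 := by
    have h2 : ‖wedge f‖ = ‖(slat f : antisym ν N)‖ := lp.norm_single (by norm_num) _ _
    rw [← ofReal_norm, ← h2, norm_wedge hf]
    simp
  rw [numberForm, tsum_eq_single N]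
  · rw [wedge, lp.single_apply_self, h1]
    simp
  · intro n hn
    rw [wedge, lp.single_apply_ne _ _ _ hn]
    simp only [mul_eq_zero, pow_eq_zero_iff two_ne_zero]
    exact Or.inr enorm_zero

theorem isQuasifree_wedge {N : ℕ} {f : Fin N → OneP ν} (hf : Orthonormal ℂ f) :
    IsQuasifree ν (InnerProductSpace.rankOne ℂ (wedge f) (wedge f)) where
  nonneg := pureState_nonneg _
  trace_one := posTrace_pureState (norm_wedge hf)
  even := by
    intro a b φ ψ hab
    rw [InnerProductSpace.rankOne_apply, inner_smul_right, wedge]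
    by_cases ha : a = N
    · have hb : b ≠ N := by
        rintro rfl
        subst ha
        exact (Nat.not_odd_iff_even.2 (Even.add_self a)) hab
      rw [lp.inner_single_right, lp.single_apply_ne _ _ _ hb, inner_zero_left, zero_mul]
    · have h0 : ⟪(lp.single 2 a φ : Fock ν), (lp.single 2 N (slat f) : Fock ν)⟫_ℂ = 0 := by
        rw [lp.inner_single_left, lp.single_apply_ne _ _ _ ha, inner_zero_right]
      rw [h0, mul_zero]
  finite_number := by
    rw [formTrace_pureState (norm_wedge hf) fun c => numberForm_smul c _, numberForm_wedge hf]
    simp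
  wick := by
    intro k _ u v
    set Φ : Fock ν := wedge f with hΦ
    let ω : (Fock ν →L[ℂ] Fock ν) →ₗ[ℂ] ℂ :=
      { toFun := fun B => ⟪Φ, B Φ⟫_ℂ
        map_add' := fun B C => by rw [add_apply, inner_add_right]
        map_smul' := fun c B => by rw [smul_apply, inner_smul_right]; rfl }
    have h1 : ω 1 = 1 := by
      change ⟪Φ, Φ⟫_ℂ = 1
      rw [inner_self_ofReal, hΦ, norm_wedge hf]
      norm_num
    simp_rw [trExp_pureState, field_eq]
    refine wick_of_split ω h1 k (fun i => creF (u i) + annF (v i)) fun i => ?_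
    obtain ⟨y, z, hyz, hy, hz⟩ := exists_split_span f (u i)
    obtain ⟨y', z', hyz', hy', hz'⟩ := exists_split_span f (v i)
    -- The second operator, which creates occupied orbitals and annihilates empty ones, kills the
    -- determinant. The first does the opposite, so its adjoint kills the determinant and its range
    -- is orthogonal to it.
    refine ⟨creF z + annF y', creF y + annF z', ?_, fun B => ?_, fun B => ?_, fun j => ?_⟩
    · simp only [hyz, hyz', creF_add, annF_add]
      abel
    · change ⟪Φ, (creF z + annF y') (B Φ)⟫_ℂ = 0
      rw [add_apply, inner_add_right, ← adjoint_annF, ContinuousLinearMap.adjoint_inner_right,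
        ← ContinuousLinearMap.adjoint_inner_left (annF y'), adjoint_annF,
        creF_wedge_of_mem_span hy', hΦ, annF_wedge_eq_zero z f hz, inner_zero_left,
        add_zero]
    · change ⟪Φ, B ((creF y + annF z') Φ)⟫_ℂ = 0
      rw [add_apply, creF_wedge_of_mem_span hy, hΦ, annF_wedge_eq_zero z' f hz', add_zero,
        map_zero, inner_zero_right]
    · exact ⟨_, field_anticomm y z' (u j) (v j)⟩

/-- The four-point identity for this pure state has no pairing term, since a determinant has a fixed
particle number; what remains is the identity `pairGram_add`. -/
theorem enorm_annF_annF_wedge {N : ℕ} {f : Fin N → OneP ν} (hf : Orthonormal ℂ f)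
    (a b : OneP ν) : ‖annF b (annF a (wedge f))‖ₑ ^ 2 = pairGram f a b := by
  have hn := norm_wedge hf
  have h := (isQuasifree_wedge hf).four_point a b
  have hB : ∀ B : Fock ν →L[ℂ] Fock ν, ∑' i, ‖B (opSqrt (InnerProductSpace.rankOne ℂ (wedge f)
      (wedge f)) (stdBasis (Fock ν) i))‖ₑ ^ 2 = ‖B (wedge f)‖ₑ ^ 2 := fun B =>
    formTrace_pureState hn (Q := fun x => ‖B x‖ₑ ^ 2)
      fun c => by rw [map_smul, enorm_smul, mul_pow]
  have h2 := hB (annF b * annF a)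
  simp only [mul_apply_eq_comp] at h2
  rw [h2, hB, hB, trExp_pureState, trExp_pureState, mul_apply_eq_comp, mul_apply_eq_comp,
    inner_annF_annF_wedge, enorm_zero, zero_pow two_ne_zero, add_zero, ← adjoint_annF,
    ContinuousLinearMap.adjoint_inner_right, enorm_annF_wedge hf, enorm_annF_wedge hf,
    enorm_inner_symm, inner_annF_wedge hf] at h
  have hg : ∑' i, ‖f i‖ₑ ^ 2 ≠ ∞ := by
    rw [tsum_fintype]
    exact ENNReal.sum_ne_top.2 fun i _ => by simp
  have h3 := pairGram_add hg a b
  simp only [tsum_fintype] at h3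
  rw [← h3] at h
  exact (ENNReal.add_left_inj (by finiteness)).1 h

theorem tsum_enorm_ne_top_of_fintype {ι : Type*} [Fintype ι] (f : ι → OneP ν) :
    ∑' i, ‖f i‖ₑ ^ 2 ≠ ∞ := by
  rw [tsum_fintype]
  exact ENNReal.sum_ne_top.2 fun i _ => by simp

end Quasifree

/-! ### The energy of a Slater determinant -/

section SlaterEnergy

variable {M : Type*} [MeasurableSpace M] {ν : Measure M} [SigmaFinite ν]
  {h : OneP ν →ₗ.[ℂ] OneP ν} {m : ℝ}

theorem opFormFn_congr {u v : M → ℂ} (huv : u =ᵐ[ν] v) : opFormFn ν h m u = opFormFn ν h m v := by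
  by_cases hu : MemLp u 2 ν
  · have hv : MemLp v 2 ν := hu.ae_eq huv
    rw [opFormFn_of_memLp hu, opFormFn_of_memLp hv, MemLp.toLp_congr hu hv huv]
  · have hv : ¬ MemLp v 2 ν := fun hv => hu (hv.ae_eq huv.symm)
    rw [opFormFn, opFormFn, dif_neg hu, dif_neg hv]

theorem kineticForm_congr {N : ℕ} {u v : (Fin N → M) → ℂ}
    (huv : u =ᵐ[Measure.pi fun _ : Fin N => ν] v) :
    kineticForm ν h m N u = kineticForm ν h m N v := by
  cases N with
  | zero => rfl
  | succ n =>
    rw [kineticForm, kineticForm]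
    refine Finset.sum_congr rfl fun i _ => lintegral_congr_ae ?_
    have h1 := (measurePreserving_slot ν n i).quasiMeasurePreserving.ae huv
    have h2 := Measure.measurePreserving_swap (μ := Measure.pi fun _ : Fin n => ν) (ν := ν)
      |>.quasiMeasurePreserving.ae h1
    filter_upwards [Measure.ae_ae_of_ae_prod h2] with x hx
    exact opFormFn_congr hx

theorem nBodyForm_congr {V : M × M → ℝ} {N : ℕ} {u v : (Fin N → M) → ℂ}
    (huv : u =ᵐ[Measure.pi fun _ : Fin N => ν] v) :
    nBodyForm ν h m V N u = nBodyForm ν h m V N v := by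
  rw [nBodyForm, nBodyForm, kineticForm_congr huv, pairForm, pairForm]
  congr 1
  refine Finset.sum_congr rfl fun i _ => Finset.sum_congr rfl fun k _ => lintegral_congr_ae ?_
  filter_upwards [huv] with x hx
  rw [hx]

variable {κ : Type*} [Countable κ] {φ : κ → OneP ν}
  (hφ : ∀ f, opForm h m f = ∑' k, ‖⟪φ k, f⟫_ℂ‖ₑ ^ 2) {V : M × M → ℝ} (hV : Measurable V)
include hφ hV

theorem nBodyForm_zero (N : ℕ) :
    nBodyForm ν h m V N (((0 : antisym ν N) : L2N ν N) : (Fin N → M) → ℂ) = 0 := by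
  have h1 : kineticForm ν h m N (((0 : antisym ν N) : L2N ν N) : (Fin N → M) → ℂ) = 0 := by
    cases N with
    | zero => rfl
    | succ n =>
      rw [kineticForm_succ hφ]
      refine ENNReal.tsum_eq_zero.2 fun k => ?_
      have h0 : (annN (φ k) : antisym ν (n + 1) →L[ℂ] antisym ν n) 0 = 0 := map_zero _
      rw [h0]
      exact (pow_eq_zero_iff two_ne_zero).2 enorm_zero
  rw [nBodyForm, h1, zero_add, pairForm]
  refine Finset.sum_eq_zero fun i _ => Finset.sum_eq_zero fun k _ => ?_
  refine (lintegral_congr_ae ?_).trans lintegral_zero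
  filter_upwards [Lp.coeFn_zero ℂ 2 (Measure.pi fun _ : Fin N => ν)] with x hx
  change _ * ‖(0 : L2N ν N) x‖ₑ ^ 2 = 0
  rw [hx]
  simp

theorem nBodyForm_slater {N : ℕ} (f : Fin N → OneP ν) :
    nBodyForm ν h m V N (slater ν f) = fockForm ν h m V (wedge f) := by
  rw [fockForm, tsum_eq_single N, comp, wedge, lp.single_apply_self]
  · exact nBodyForm_congr (slaterL_ae f).symm
  · intro n hn
    rw [comp, wedge, lp.single_apply_ne _ _ _ hn]
    exact nBodyForm_zero hφ hV n

theorem fockForm_smul (c : ℂ) (Ψ : Fock ν) :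
    fockForm ν h m V (c • Ψ) = ‖c‖ₑ ^ 2 * fockForm ν h m V Ψ := by
  have h1 : ∀ N, ∫⁻ p, ENNReal.ofReal (V p) ∂(pairMeasure ((c • Ψ) N)) =
      ‖c‖ₑ ^ 2 * ∫⁻ p, ENNReal.ofReal (V p) ∂(pairMeasure (Ψ N)) := by
    intro N
    rw [lintegral_pairMeasure _ hV.ennreal_ofReal, lintegral_pairMeasure _ hV.ennreal_ofReal,
      Finset.mul_sum]
    refine Finset.sum_congr rfl fun i _ => ?_
    rw [Finset.mul_sum]
    refine Finset.sum_congr rfl fun k _ => ?_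
    rw [← lintegral_const_mul' _ _ (by simp)]
    refine lintegral_congr_ae ?_
    filter_upwards [Lp.coeFn_smul c ((Ψ N : antisym ν N) : L2N ν N)] with z hz
    change _ * ‖(c • ((Ψ N : antisym ν N) : L2N ν N)) z‖ₑ ^ 2 = _
    rw [hz, Pi.smul_apply, enorm_smul]
    ring
  rw [fockForm_eq hφ hV, fockForm_eq hφ hV, mul_add, fockPairMeasure, fockPairMeasure,
    lintegral_sum_measure, lintegral_sum_measure, ← ENNReal.tsum_mul_left,
    ← ENNReal.tsum_mul_left]
  simp_rw [h1, map_smul, enorm_smul, mul_pow]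

/-- Twice the pair density of the determinant and the density of (1 - Ex)(γ ⊗ γ) agree on
rectangles, hence as measures. The kinetic parts agree after exchanging two sums. -/
theorem fockForm_wedge [TopologicalSpace.SeparableSpace (OneP ν)] {N : ℕ} {f : Fin N → OneP ν}
    (hf : Orthonormal ℂ f) : fockForm ν h m V (wedge f) = familyForm h m V f := by
  have h1 : (2 : ℝ≥0∞) • fockPairMeasure (wedge f) = pairDensity f := by
    refine (ext_prod_of_finite
      (pairDensity_univ_ne_top (tsum_enorm_ne_top_of_fintype f)) fun A B hA hB => ?_).symm
    rw [Measure.smul_apply, smul_eq_mul, fockPairMeasure_prod (stdBasis _) hA hB,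
      pairDensity_prod (stdBasis _) hA hB]
    simp_rw [enorm_annF_annF_wedge hf]
  rw [fockForm_eq hφ hV, familyForm, ← h1, lintegral_smul_measure, smul_eq_mul, ← mul_assoc,
    ENNReal.inv_mul_cancel (by simp) (by simp), one_mul]
  congr 1
  simp_rw [enorm_annF_wedge hf, hφ, tsum_fintype]
  exact Summable.tsum_finsetSum fun _ _ => ENNReal.summable

end SlaterEnergy

end BHF

namespace BHF

set_option linter.unusedSectionVars false

/-! ### Sesquilinear expectations -/

section Sesquilinear

variable {H : Type*} [NormedAddCommGroup H] [InnerProductSpace ℂ H] [CompleteSpace H]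
  {ρ : H →L[ℂ] H}

/-- Cauchy–Schwarz, read off from Lagrange's identity for the sequences of norms. -/
theorem norm_tsum_inner_sq_le {ι : Type*} {x y : ι → H} (hx : Summable fun i => ‖x i‖ ^ 2)
    (hy : Summable fun i => ‖y i‖ ^ 2) :
    ‖∑' i, ⟪x i, y i⟫_ℂ‖ ^ 2 ≤ (∑' i, ‖x i‖ ^ 2) * ∑' i, ‖y i‖ ^ 2 := by
  have hx' : Summable fun i => ‖((‖x i‖ : ℝ) : ℂ)‖ ^ 2 := by simpa using hx
  have hy' : Summable fun i => ‖((‖y i‖ : ℝ) : ℂ)‖ ^ 2 := by simpa using hy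
  have hsum : Summable fun i => ‖x i‖ * ‖y i‖ := by
    refine Summable.of_nonneg_of_le (fun _ => by positivity) (fun i => ?_) (hx.add hy)
    nlinarith [sq_nonneg (‖x i‖ - ‖y i‖), sq_nonneg ‖x i‖, sq_nonneg ‖y i‖]
  obtain ⟨-, h2⟩ := lagrange_tsum hx' hy'
  have h3 : ∑' i, ((‖x i‖ : ℝ) : ℂ) * (starRingEnd ℂ) ((‖y i‖ : ℝ) : ℂ) =
      ((∑' i, ‖x i‖ * ‖y i‖ : ℝ) : ℂ) := by
    rw [Complex.ofReal_tsum]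
    refine tsum_congr fun i => ?_
    rw [Complex.conj_ofReal, Complex.ofReal_mul]
  simp only [Complex.norm_real, norm_norm] at h2
  rw [h2, h3, Complex.norm_real,
    Real.norm_of_nonneg (tsum_nonneg fun i => mul_nonneg (norm_nonneg _) (norm_nonneg _))]
  have h4 : ‖∑' i, ⟪x i, y i⟫_ℂ‖ ≤ ∑' i, ‖x i‖ * ‖y i‖ := by
    refine tsum_of_norm_bounded hsum.hasSum fun i => norm_inner_le_norm _ _
  have h5 := pow_le_pow_left₀ (norm_nonneg _) h4 2
  refine h5.trans (le_add_of_nonneg_right ?_)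
  exact mul_nonneg (by norm_num) (tsum_nonneg fun _ => by positivity)

theorem summable_trExp (hρ : 0 ≤ ρ) (ht : posTrace ρ ≠ ∞) (B : H →L[ℂ] H) :
    Summable fun i => ⟪opSqrt ρ (stdBasis H i), B (opSqrt ρ (stdBasis H i))⟫_ℂ :=
  summable_inner_of_norm_sq (summable_norm_opSqrt hρ ht)
    (summable_norm_sq_apply (summable_norm_opSqrt hρ ht) B)

theorem trExp_add (hρ : 0 ≤ ρ) (ht : posTrace ρ ≠ ∞) (B C : H →L[ℂ] H) :
    trExp ρ (B + C) = trExp ρ B + trExp ρ C := by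
  rw [trExp_eq hρ ht, trExp_eq hρ ht, trExp_eq hρ ht,
    ← (summable_trExp hρ ht B).tsum_add (summable_trExp hρ ht C)]
  refine tsum_congr fun i => ?_
  rw [add_apply, inner_add_right]

theorem trExp_smul (hρ : 0 ≤ ρ) (ht : posTrace ρ ≠ ∞) (c : ℂ) (B : H →L[ℂ] H) :
    trExp ρ (c • B) = c * trExp ρ B := by
  rw [trExp_eq hρ ht, trExp_eq hρ ht, ← tsum_mul_left]
  refine tsum_congr fun i => ?_
  rw [smul_apply, inner_smul_right]

theorem tsum_norm_opSqrt_sq (hρ : 0 ≤ ρ) (h1 : posTrace ρ = 1) :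
    ∑' i, ‖opSqrt ρ (stdBasis H i)‖ ^ 2 = 1 := by
  have ht : posTrace ρ ≠ ∞ := by rw [h1]; simp
  have h2 := posTrace_eq hρ
  rw [h1, tsum_enorm_sq_eq_ofReal (summable_norm_opSqrt hρ ht)] at h2
  exact (ENNReal.ofReal_eq_one.1 h2.symm)

theorem norm_trExp_adjoint_mul_sq_le (hρ : 0 ≤ ρ) (h1 : posTrace ρ = 1) (B C : H →L[ℂ] H) {c : ℝ}
    (hC : ∀ x, ‖C x‖ ^ 2 ≤ c * ‖x‖ ^ 2) :
    ‖trExp ρ (ContinuousLinearMap.adjoint B * C)‖ ^ 2 ≤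
      (∑' i, ‖B (opSqrt ρ (stdBasis H i))‖ ^ 2) * c := by
  have ht : posTrace ρ ≠ ∞ := by rw [h1]; simp
  have hs := summable_norm_opSqrt hρ ht
  rw [trExp_adjoint_mul hρ ht]
  refine (norm_tsum_inner_sq_le (summable_norm_sq_apply hs B) (summable_norm_sq_apply hs C)).trans ?_
  refine mul_le_mul_of_nonneg_left ?_ (tsum_nonneg fun _ => by positivity)
  calc ∑' i, ‖C (opSqrt ρ (stdBasis H i))‖ ^ 2
      ≤ ∑' i, c * ‖opSqrt ρ (stdBasis H i)‖ ^ 2 :=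
        (summable_norm_sq_apply hs C).tsum_le_tsum (fun i => hC _) (hs.mul_left c)
    _ = c := by rw [tsum_mul_left, tsum_norm_opSqrt_sq hρ h1, mul_one]

end Sesquilinear

/-! ### One-particle density and pairing operators of a density matrix -/

section Reduced

variable {M : Type*} [MeasurableSpace M] {ν : Measure M}

theorem star_add_Lp (f g : OneP ν) : star (f + g) = star f + star g := by
  refine Lp.ext ?_
  filter_upwards [Lp.coeFn_star (f + g), Lp.coeFn_add f g, Lp.coeFn_star f, Lp.coeFn_star g,
    Lp.coeFn_add (star f) (star g)] with x h1 h2 h3 h4 h5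
  rw [h1, h5, Pi.star_apply, h2, Pi.add_apply, Pi.add_apply, h3, h4, star_add, Pi.star_apply,
    Pi.star_apply]

theorem star_smul_Lp (c : ℂ) (f : OneP ν) : star (c • f) = (starRingEnd ℂ) c • star f := by
  refine Lp.ext ?_
  filter_upwards [Lp.coeFn_star (c • f), Lp.coeFn_smul c f, Lp.coeFn_star f,
    Lp.coeFn_smul ((starRingEnd ℂ) c) (star f)] with x h1 h2 h3 h4
  rw [h1, h4, Pi.star_apply, h2, Pi.smul_apply, Pi.smul_apply, h3, star_smul, Pi.star_apply]
  rfl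

variable [SigmaFinite ν]

theorem norm_annF_sq_le (f : OneP ν) (Ψ : Fock ν) : ‖annF f Ψ‖ ^ 2 ≤ ‖f‖ ^ 2 * ‖Ψ‖ ^ 2 := by
  rw [← norm_creF_annF]
  exact le_add_of_nonneg_left (by positivity)

theorem norm_creF_sq_le (f : OneP ν) (Ψ : Fock ν) : ‖creF f Ψ‖ ^ 2 ≤ ‖f‖ ^ 2 * ‖Ψ‖ ^ 2 := by
  rw [← norm_creF_annF]
  exact le_add_of_nonneg_right (by positivity)

variable {ρ : Fock ν →L[ℂ] Fock ν} (hρ : IsDensityMatrix ν ρ)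
include hρ

theorem IsDensityMatrix.trace_ne_top : posTrace ρ ≠ ∞ := by rw [hρ.trace_one]; simp

theorem IsDensityMatrix.tsum_annF_le (f : OneP ν) :
    ∑' i, ‖annF f (opSqrt ρ (stdBasis (Fock ν) i))‖ ^ 2 ≤ ‖f‖ ^ 2 := by
  have hs := summable_norm_opSqrt hρ.nonneg hρ.trace_ne_top
  calc ∑' i, ‖annF f (opSqrt ρ (stdBasis (Fock ν) i))‖ ^ 2
      ≤ ∑' i, ‖f‖ ^ 2 * ‖opSqrt ρ (stdBasis (Fock ν) i)‖ ^ 2 :=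
        (summable_norm_sq_apply hs _).tsum_le_tsum (fun i => norm_annF_sq_le f _)
          (hs.mul_left _)
    _ = ‖f‖ ^ 2 := by rw [tsum_mul_left, tsum_norm_opSqrt_sq hρ.nonneg hρ.trace_one, mul_one]

theorem IsDensityMatrix.norm_trExp_le (f : OneP ν) {C : Fock ν →L[ℂ] Fock ν} {c : ℝ} (hc : 0 ≤ c)
    (hC : ∀ x, ‖C x‖ ^ 2 ≤ c ^ 2 * ‖x‖ ^ 2) : ‖trExp ρ (creF f * C)‖ ≤ ‖f‖ * c := by
  have h := norm_trExp_adjoint_mul_sq_le hρ.nonneg hρ.trace_one (annF f) C hC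
  rw [adjoint_annF] at h
  refine (pow_le_pow_iff_left₀ (norm_nonneg _) (by positivity) two_ne_zero).1 (h.trans ?_)
  rw [mul_pow]
  exact mul_le_mul_of_nonneg_right (hρ.tsum_annF_le f) (by positivity)

/-- Every density matrix has a bounded one-particle density operator. -/
theorem IsDensityMatrix.exists_gamma :
    ∃ γ : OneP ν →L[ℂ] OneP ν, ∀ f g, ⟪γ f, g⟫_ℂ = trExp ρ (creF g * annF f) := by
  have hn := hρ.nonneg
  have ht := hρ.trace_ne_top
  let B : OneP ν →L⋆[ℂ] OneP ν →L[ℂ] ℂ := LinearMap.mkContinuous₂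
    (LinearMap.mk₂'ₛₗ (starRingEnd ℂ) (RingHom.id ℂ) (fun f g => trExp ρ (creF g * annF f))
      (fun f f' g => by rw [annF_add, mul_add, trExp_add hn ht])
      (fun c f g => by rw [annF_smul, mul_smul_comm, trExp_smul hn ht, smul_eq_mul])
      (fun f g g' => by rw [creF_add, add_mul, trExp_add hn ht])
      (fun c f g => by
        rw [creF_smul, smul_mul_assoc, trExp_smul hn ht, smul_eq_mul, RingHom.id_apply])) 1
    (fun f g => by
      rw [one_mul, mul_comm]
      exact hρ.norm_trExp_le g (norm_nonneg f) (norm_annF_sq_le f))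
  exact ⟨InnerProductSpace.continuousLinearMapOfBilin B,
    fun f g => InnerProductSpace.continuousLinearMapOfBilin_apply B f g⟩

/-- Every density matrix has a bounded pairing operator. -/
theorem IsDensityMatrix.exists_alpha : ∃ T : OneP ν →L[ℂ] OneP ν,
    ∀ b a, ⟪T b, a⟫_ℂ = trExp ρ (creF a * creF (star b)) := by
  have hn := hρ.nonneg
  have ht := hρ.trace_ne_top
  -- Conjugating b makes the expectation conjugate-linear in it, so that Riesz representation yields
  -- a linear operator.
  let B : OneP ν →L⋆[ℂ] OneP ν →L[ℂ] ℂ := LinearMap.mkContinuous₂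
    (LinearMap.mk₂'ₛₗ (starRingEnd ℂ) (RingHom.id ℂ) (fun b a => trExp ρ (creF a * creF (star b)))
      (fun f f' g => by rw [star_add_Lp, creF_add, mul_add, trExp_add hn ht])
      (fun c f g => by
        rw [star_smul_Lp, creF_smul, mul_smul_comm, trExp_smul hn ht, smul_eq_mul])
      (fun f g g' => by rw [creF_add, add_mul, trExp_add hn ht])
      (fun c f g => by
        rw [creF_smul, smul_mul_assoc, trExp_smul hn ht, smul_eq_mul, RingHom.id_apply])) 1
    (fun f g => by
      rw [one_mul, mul_comm, ← norm_star_Lp f]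
      exact hρ.norm_trExp_le g (norm_nonneg _) (norm_creF_sq_le _))
  exact ⟨InnerProductSpace.continuousLinearMapOfBilin B,
    fun f g => InnerProductSpace.continuousLinearMapOfBilin_apply B f g⟩

end Reduced

/-! ### The complex conjugate of a Hilbert basis -/

section StarBasis

variable {M : Type*} [MeasurableSpace M] {ν : Measure M}

theorem exists_starBasis {κ : Type*} (e : HilbertBasis κ ℂ (OneP ν)) :
    ∃ e' : HilbertBasis κ ℂ (OneP ν), ∀ q, e' q = star (e q) := by
  have ho : Orthonormal ℂ fun q => star (e q) := by
    classical
    rw [orthonormal_iff_ite]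
    intro i j
    rw [inner_star_star, orthonormal_iff_ite.1 e.orthonormal]
    simp only [eq_comm]
  have hb : (Submodule.span ℂ (Set.range fun q => star (e q)))ᗮ = ⊥ := by
    rw [Submodule.eq_bot_iff]
    intro x hx
    have h1 : ∀ q, ⟪e q, star x⟫_ℂ = 0 := by
      intro q
      have h2 : ⟪star (e q), x⟫_ℂ = 0 := hx _ (Submodule.subset_span ⟨q, rfl⟩)
      rw [← inner_star_star, star_star, ← inner_conj_symm, h2, map_zero]
    have h3 := tsum_enorm_inner_sq e (star x)
    simp_rw [h1] at h3
    simp only [enorm_zero, zero_pow two_ne_zero, tsum_zero] at h3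
    have h4 := (pow_eq_zero_iff two_ne_zero).1 h3.symm
    rw [enorm_eq_zero] at h4
    rw [← norm_eq_zero, ← norm_star_Lp, h4, norm_zero]
  exact ⟨HilbertBasis.mkOfOrthogonalEqBot ho hb, fun q => by
    rw [HilbertBasis.coe_mkOfOrthogonalEqBot]⟩

end StarBasis

/-! ### The energy of a quasifree state bounds the Hartree–Fock functional -/

section LowerBound

variable {M : Type*} [MeasurableSpace M] {ν : Measure M} [SigmaFinite ν]
  [TopologicalSpace.SeparableSpace (OneP ν)] {ρ : Fock ν →L[ℂ] Fock ν}

theorem IsDensityMatrix.gamma_diag (hρ : IsDensityMatrix ν ρ) {γ : OneP ν →L[ℂ] OneP ν}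
    (hγ : ∀ f g, ⟪γ f, g⟫_ℂ = trExp ρ (creF g * annF f)) (f : OneP ν) :
    ⟪γ f, f⟫_ℂ = ((∑' i, ‖annF f (opSqrt ρ (stdBasis (Fock ν) i))‖ ^ 2 : ℝ) : ℂ) := by
  rw [hγ, ← adjoint_annF, trExp_adjoint_mul_self hρ.nonneg hρ.trace_ne_top]

theorem IsDensityMatrix.gamma_nonneg (hρ : IsDensityMatrix ν ρ) {γ : OneP ν →L[ℂ] OneP ν}
    (hγ : ∀ f g, ⟪γ f, g⟫_ℂ = trExp ρ (creF g * annF f)) : 0 ≤ γ := by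
  rw [ContinuousLinearMap.nonneg_iff_isPositive, ContinuousLinearMap.isPositive_iff_complex]
  intro f
  rw [hρ.gamma_diag hγ]
  exact ⟨by simp, by
    change 0 ≤ (((∑' i, ‖annF f (opSqrt ρ (stdBasis (Fock ν) i))‖ ^ 2 : ℝ) : ℂ)).re
    rw [Complex.ofReal_re]
    exact tsum_nonneg fun _ => by positivity⟩

theorem IsDensityMatrix.gamma_le_one (hρ : IsDensityMatrix ν ρ) {γ : OneP ν →L[ℂ] OneP ν}
    (hγ : ∀ f g, ⟪γ f, g⟫_ℂ = trExp ρ (creF g * annF f)) : γ ≤ 1 := by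
  rw [ContinuousLinearMap.le_def, ContinuousLinearMap.isPositive_iff_complex]
  intro f
  have h1 : ⟪(1 - γ) f, f⟫_ℂ =
      ((‖f‖ ^ 2 - ∑' i, ‖annF f (opSqrt ρ (stdBasis (Fock ν) i))‖ ^ 2 : ℝ) : ℂ) := by
    change ⟪f - γ f, f⟫_ℂ = _
    rw [inner_sub_left, hρ.gamma_diag hγ, inner_self_ofReal, Complex.ofReal_sub]
  rw [h1]
  exact ⟨congrArg _ (Complex.ofReal_re _), by
    change 0 ≤ ((‖f‖ ^ 2 - ∑' i, ‖annF f (opSqrt ρ (stdBasis (Fock ν) i))‖ ^ 2 : ℝ) : ℂ).re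
    rw [Complex.ofReal_re]
    exact sub_nonneg.2 (hρ.tsum_annF_le f)⟩

theorem inner_comm_of_nonneg {γ : OneP ν →L[ℂ] OneP ν} (hγ : 0 ≤ γ) (f g : OneP ν) :
    ⟪f, γ g⟫_ℂ = ⟪γ f, g⟫_ℂ := by
  rw [← inner_opSqrt_opSqrt hγ, inner_opSqrt, ← opSqrt_opSqrt hγ f, inner_opSqrt, inner_opSqrt]

theorem tsum_inner_sqrtVec {γ : OneP ν →L[ℂ] OneP ν} (hγ : 0 ≤ γ) (a : OneP ν) :
    ∑' i, ‖⟪a, sqrtVec γ i⟫_ℂ‖ₑ ^ 2 = ENNReal.ofReal (⟪a, γ a⟫_ℂ).re := by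
  rw [← enorm_opSqrt_sq hγ, ← tsum_enorm_inner_sq (stdBasis _)]
  refine tsum_congr fun i => ?_
  rw [sqrtVec, ← inner_opSqrt, enorm_inner_symm]

theorem tsum_inner_mul_sqrtVec {γ : OneP ν →L[ℂ] OneP ν} (hγ : 0 ≤ γ) (a b : OneP ν) :
    ∑' i, ⟪a, sqrtVec γ i⟫_ℂ * ⟪sqrtVec γ i, b⟫_ℂ = ⟪a, γ b⟫_ℂ := by
  rw [← inner_opSqrt_opSqrt hγ, ← (stdBasis _).tsum_inner_mul_inner]
  refine tsum_congr fun i => ?_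
  rw [sqrtVec, ← inner_opSqrt, inner_opSqrt _ (stdBasis _ i)]

theorem IsDensityMatrix.tsum_inner_sqrtVec (hρ : IsDensityMatrix ν ρ) {γ : OneP ν →L[ℂ] OneP ν}
    (hγ : ∀ f g, ⟪γ f, g⟫_ℂ = trExp ρ (creF g * annF f)) (a : OneP ν) :
    ∑' i, ‖⟪a, sqrtVec γ i⟫_ℂ‖ₑ ^ 2 =
      ∑' i, ‖annF a (opSqrt ρ (stdBasis (Fock ν) i))‖ₑ ^ 2 := by
  rw [BHF.tsum_inner_sqrtVec (hρ.gamma_nonneg hγ), inner_comm_of_nonneg (hρ.gamma_nonneg hγ),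
    hρ.gamma_diag hγ, Complex.ofReal_re,
    tsum_enorm_sq_eq_ofReal (tsum_annF_ne_top hρ.nonneg hρ.trace_ne_top _)]

theorem IsDensityMatrix.tsum_annF_basis {κ : Type*} [Countable κ] (e : HilbertBasis κ ℂ (OneP ν))
    (ρ : Fock ν →L[ℂ] Fock ν) :
    ∑' p, ∑' i, ‖annF (e p) (opSqrt ρ (stdBasis (Fock ν) i))‖ₑ ^ 2 =
      formTrace (numberForm ν) ρ := by
  rw [ENNReal.tsum_comm, formTrace]
  exact tsum_congr fun i => (numberForm_eq e _).symm

theorem IsDensityMatrix.posTrace_gamma (hρ : IsDensityMatrix ν ρ) {γ : OneP ν →L[ℂ] OneP ν}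
    (hγ : ∀ f g, ⟪γ f, g⟫_ℂ = trExp ρ (creF g * annF f)) :
    posTrace γ = formTrace (numberForm ν) ρ := by
  rw [← tsum_annF_basis (stdBasis _), posTrace]
  refine tsum_congr fun p => ?_
  rw [← hρ.tsum_inner_sqrtVec hγ, BHF.tsum_inner_sqrtVec (hρ.gamma_nonneg hγ)]

theorem IsQuasifree.isOnePDM (hρ : IsQuasifree ν ρ) {γ : OneP ν →L[ℂ] OneP ν}
    (hγ : ∀ f g, ⟪γ f, g⟫_ℂ = trExp ρ (creF g * annF f)) : IsOnePDM γ where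
  nonneg := hρ.toIsDensityMatrix.gamma_nonneg hγ
  le_one := hρ.toIsDensityMatrix.gamma_le_one hγ
  traceClass := by
    rw [hρ.toIsDensityMatrix.posTrace_gamma hγ]
    exact hρ.finite_number

/-- Test against Tb itself. Anticommuting the two creation operators brings c*(conj b) to the left,
and Cauchy–Schwarz with ‖c*(Tb)‖ ≤ ‖Tb‖ bounds ‖Tb‖⁴ by ‖Tb‖² times the right-hand side. Summed over
a basis, this makes the pairing operator Hilbert–Schmidt. -/
theorem IsDensityMatrix.norm_alpha_sq_le (hρ : IsDensityMatrix ν ρ) {T : OneP ν →L[ℂ] OneP ν}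
    (hT : ∀ b a, ⟪T b, a⟫_ℂ = trExp ρ (creF a * creF (star b))) (b : OneP ν) :
    ‖T b‖ₑ ^ 2 ≤ ∑' i, ‖annF (star b) (opSqrt ρ (stdBasis (Fock ν) i))‖ₑ ^ 2 := by
  have h1 : ⟪T b, T b⟫_ℂ = -trExp ρ (creF (star b) * creF (T b)) := by
    rw [hT, eq_neg_iff_add_eq_zero, ← trExp_add hρ.nonneg hρ.trace_ne_top, creF_creF]
    simp [trExp]
  have h2 := norm_trExp_adjoint_mul_sq_le hρ.nonneg hρ.trace_one (annF (star b)) (creF (T b))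
    (norm_creF_sq_le (T b))
  have h3 : ‖trExp ρ (creF (star b) * creF (T b))‖ = ‖T b‖ ^ 2 := by
    rw [← norm_neg, ← h1, inner_self_ofReal, Complex.norm_real, Real.norm_of_nonneg (by positivity)]
  rw [adjoint_annF, h3] at h2
  rw [tsum_enorm_sq_eq_ofReal (tsum_annF_ne_top hρ.nonneg hρ.trace_ne_top _), enorm_sq_eq_ofReal]
  refine ENNReal.ofReal_le_ofReal ?_
  rcases (sq_nonneg ‖T b‖).eq_or_lt with h0 | h0
  · rw [← h0]
    exact tsum_nonneg fun _ => by positivity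
  · rw [sq (‖T b‖ ^ 2)] at h2
    exact le_of_mul_le_mul_right h2 h0

/-- The pairing function of a density matrix of finite particle number. -/
theorem IsDensityMatrix.exists_pairing (hρ : IsDensityMatrix ν ρ)
    (hN : formTrace (numberForm ν) ρ ≠ ∞) :
    ∃ K : Lp ℂ 2 (ν.prod ν), ∀ a b, ‖⟪tens a b, K⟫_ℂ‖ₑ = ‖trExp ρ (annF b * annF a)‖ₑ := by
  obtain ⟨T, hT⟩ := hρ.exists_alpha
  have hHS : ∑' q, ‖T (stdBasis (OneP ν) q)‖ₑ ^ 2 ≠ ∞ := by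
    -- The bound for T e_q involves conj(e_q); these vectors again form a Hilbert basis, so the
    -- bounds add up to the expected particle number.
    obtain ⟨e', he'⟩ := exists_starBasis (stdBasis (OneP ν))
    refine ne_top_of_le_ne_top hN ?_
    rw [← tsum_annF_basis e']
    refine ENNReal.tsum_le_tsum fun q => ?_
    rw [he']
    exact hρ.norm_alpha_sq_le hT _
  obtain ⟨k, hk⟩ := exists_integralKernel (stdBasis (OneP ν)) T hHS
  refine ⟨hk.1.toLp, fun a b => ?_⟩
  have h1 := inner_kernel hk a (star b)
  rw [star_star] at h1
  rw [← h1, enorm_inner_symm, hT, star_star, ← adjoint_annF_mul,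
    trExp_adjoint hρ.nonneg hρ.trace_ne_top, ← ofReal_norm, RCLike.norm_conj, ofReal_norm]

/-- The four-point identity, summed over the families 1_A e_p and 1_B e_q, says that the right-hand
measure exceeds the left-hand one exactly by the density |K|² of the pairing function. Both sides of
that equality are finite, so rectangles decide, and the pairing part is then dropped. -/
theorem IsQuasifree.pairDensity_le (hρ : IsQuasifree ν ρ) {γ : OneP ν →L[ℂ] OneP ν}
    (hγ : ∀ f g, ⟪γ f, g⟫_ℂ = trExp ρ (creF g * annF f)) :
    pairDensity (sqrtVec γ) ≤ (2 : ℝ≥0∞) • Measure.sum fun i =>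
      fockPairMeasure (opSqrt ρ (stdBasis (Fock ν) i)) := by
  have hd := hρ.toIsDensityMatrix
  have hγ0 := hd.gamma_nonneg hγ
  have hg : ∑' i, ‖sqrtVec γ i‖ₑ ^ 2 ≠ ∞ := by
    rw [tsum_sqrtVec hγ0]
    exact (hρ.isOnePDM hγ).traceClass
  obtain ⟨K, hK⟩ := hd.exists_pairing hρ.finite_number
  have hfour : ∀ a b, ∑' i, ‖annF b (annF a (opSqrt ρ (stdBasis (Fock ν) i)))‖ₑ ^ 2 =
      pairGram (sqrtVec γ) a b + ‖⟪tens a b, K⟫_ℂ‖ₑ ^ 2 := by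
    intro a b
    have h1 := hρ.four_point a b
    rw [← hd.tsum_inner_sqrtVec hγ, ← hd.tsum_inner_sqrtVec hγ, ← pairGram_add hg,
      tsum_inner_mul_sqrtVec hγ0, inner_comm_of_nonneg hγ0, enorm_inner_symm,
      inner_comm_of_nonneg hγ0, hγ, add_right_comm, ← hK] at h1
    exact (ENNReal.add_left_inj (by simp)).1 h1
  have heq : pairDensity (sqrtVec γ) + (ν.prod ν).withDensity (fun z => ‖K z‖ₑ ^ 2) =
      (2 : ℝ≥0∞) • Measure.sum fun i => fockPairMeasure (opSqrt ρ (stdBasis (Fock ν) i)) := by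
    refine ext_prod_of_finite ?_ fun A B hA hB => ?_
    · rw [Measure.add_apply, withDensity_apply _ MeasurableSet.univ, setLIntegral_univ,
        ← enorm_sq_eq_lintegral]
      exact ENNReal.add_ne_top.2 ⟨pairDensity_univ_ne_top hg, by simp⟩
    · rw [Measure.add_apply, withDensity_apply _ (hA.prod hB), Measure.smul_apply, smul_eq_mul,
        Measure.sum_apply _ (hA.prod hB), ← ENNReal.tsum_mul_left]
      simp_rw [fockPairMeasure_prod (stdBasis (OneP ν)) hA hB]
      rw [pairDensity_prod (stdBasis (OneP ν)) hA hB, ← tsum_inner_tens_cut (stdBasis (OneP ν)) hA hB,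
        ← ENNReal.tsum_add, ENNReal.tsum_comm]
      refine tsum_congr fun p => ?_
      rw [← ENNReal.tsum_add, ENNReal.tsum_comm]
      exact tsum_congr fun q => (hfour _ _).symm
  rw [← heq]
  exact Measure.le_add_right le_rfl

variable {h : OneP ν →ₗ.[ℂ] OneP ν} {m : ℝ} {κ : Type*} [Countable κ] {φ : κ → OneP ν}
  (hφ : ∀ f, opForm h m f = ∑' k, ‖⟪φ k, f⟫_ℂ‖ₑ ^ 2) {V : M × M → ℝ} (hV : Measurable V)
include hφ hV

theorem IsQuasifree.familyForm_le (hρ : IsQuasifree ν ρ) {γ : OneP ν →L[ℂ] OneP ν}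
    (hγ : ∀ f g, ⟪γ f, g⟫_ℂ = trExp ρ (creF g * annF f)) :
    familyForm h m V (sqrtVec γ) ≤ formTrace (fockForm ν h m V) ρ := by
  have hd := hρ.toIsDensityMatrix
  simp_rw [formTrace, fockForm_eq hφ hV, familyForm, hφ]
  rw [ENNReal.tsum_add, ENNReal.tsum_comm]
  refine add_le_add (le_of_eq ?_) ?_
  · rw [ENNReal.tsum_comm (f := fun i k => ‖annF (φ k) (opSqrt ρ (stdBasis (Fock ν) i))‖ₑ ^ 2)]
    exact tsum_congr fun k => hd.tsum_inner_sqrtVec hγ _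
  · rw [← lintegral_sum_measure]
    have h1 := lintegral_mono' (hρ.pairDensity_le hγ) (le_refl fun p => ENNReal.ofReal (V p))
    rw [lintegral_smul_measure, smul_eq_mul] at h1
    calc _ ≤ 2⁻¹ * (2 * _) := mul_le_mul_right h1 _
      _ = _ := by rw [← mul_assoc, ENNReal.inv_mul_cancel (by simp) (by simp), one_mul]

theorem IsQuasifree.exists_hfFunctional_le (hV0 : ∀ᵐ p ∂(ν.prod ν), 0 ≤ V p)
    (hρ : IsQuasifree ν ρ) (μ : ℝ) :
    ∃ γ, IsOnePDM γ ∧ hfFunctional ν h m μ V γ ≤ fockEnergy ν h m μ V ρ := by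
  obtain ⟨γ, hγ⟩ := hρ.toIsDensityMatrix.exists_gamma
  have h1 := hρ.isOnePDM hγ
  refine ⟨γ, h1, ?_⟩
  rw [hfFunctional_eq hV hV0 h1.nonneg h1.traceClass, fockEnergy,
    hρ.toIsDensityMatrix.posTrace_gamma hγ]
  refine EReal.sub_le_sub ?_ le_rfl
  exact EReal.coe_ennreal_le_coe_ennreal_iff.2 (hρ.familyForm_le hφ hV hγ)

end LowerBound

end BHF

namespace BHF

set_option linter.unusedSectionVars false

/-! ### The variational principle of Lieb -/

/-- An affine function on [0,1] is at least its smaller endpoint value. The coordinates are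
therefore rounded to 0 or 1 one after another, never increasing E. -/
theorem exists_vertex_le {ι : Type*} [Fintype ι] [DecidableEq ι] (E : (ι → ℝ) → ℝ)
    (hE : ∀ x i t, E (Function.update x i t) =
      (1 - t) * E (Function.update x i 0) + t * E (Function.update x i 1))
    (x : ι → ℝ) (hx : ∀ i, 0 ≤ x i ∧ x i ≤ 1) :
    ∃ S : Finset ι, E (fun i => if i ∈ S then 1 else 0) ≤ E x := by
  have key : ∀ T : Finset ι, ∃ y : ι → ℝ, (∀ i ∈ T, y i = 0 ∨ y i = 1) ∧ (∀ i ∉ T, y i = x i) ∧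
      E y ≤ E x := by
    intro T
    induction T using Finset.induction_on with
    | empty => exact ⟨x, by simp, fun _ _ => rfl, le_rfl⟩
    | insert i T hi ih =>
      obtain ⟨y, h1, h2, h3⟩ := ih
      have h4 := hE y i (y i)
      rw [Function.update_eq_self, h2 i hi] at h4
      have hmin : E (Function.update y i 0) ≤ E y ∨ E (Function.update y i 1) ≤ E y := by
        by_contra! hcon
        obtain ⟨hx0, hx1⟩ := hx i
        rcases hx0.eq_or_lt with h0 | h0
        · rw [← h0] at h4
          linarith [hcon.1]
        · nlinarith [mul_pos h0 (sub_pos.2 hcon.2),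
            mul_nonneg (sub_nonneg.2 hx1) (sub_pos.2 hcon.1).le]
      have hgen : ∀ c : ℝ, (c = 0 ∨ c = 1) → E (Function.update y i c) ≤ E y →
          ∃ y : ι → ℝ, (∀ k ∈ insert i T, y k = 0 ∨ y k = 1) ∧ (∀ k ∉ insert i T, y k = x k) ∧
            E y ≤ E x := by
        intro c hc hle
        refine ⟨Function.update y i c, fun k hk => ?_, fun k hk => ?_, hle.trans h3⟩
        · by_cases hki : k = i
          · subst hki
            simpa using hc
          · rw [Function.update_of_ne hki]
            exact h1 k (Finset.mem_of_mem_insert_of_ne hk hki)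
        · rw [Finset.mem_insert, not_or] at hk
          rw [Function.update_of_ne hk.1]
          exact h2 k hk.2
      rcases hmin with h | h
      · exact hgen 0 (Or.inl rfl) h
      · exact hgen 1 (Or.inr rfl) h
  obtain ⟨y, h1, -, h3⟩ := key Finset.univ
  refine ⟨Finset.univ.filter fun i => y i = 1, ?_⟩
  have : (fun i => if i ∈ Finset.univ.filter fun i => y i = 1 then (1 : ℝ) else 0) = y := by
    funext i
    rcases h1 i (Finset.mem_univ i) with h | h <;> simp [h]
  rw [this]
  exact h3

/-- With vanishing diagonal coefficients there is no t² term, so the quadratic expression is affine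
in each variable separately. -/
theorem quadratic_update {ι : Type*} [Fintype ι] [DecidableEq ι] (a : ι → ℝ) (v : ι × ι → ℝ)
    (hv : ∀ i, v (i, i) = 0) (x : ι → ℝ) (i : ι) (t : ℝ) :
    (∑ l, Function.update x i t l * a l + ∑ r : ι × ι,
      Function.update x i t r.1 * Function.update x i t r.2 * v r) =
    (1 - t) * (∑ l, Function.update x i 0 l * a l + ∑ r : ι × ι,
      Function.update x i 0 r.1 * Function.update x i 0 r.2 * v r) +
    t * (∑ l, Function.update x i 1 l * a l + ∑ r : ι × ι,
      Function.update x i 1 r.1 * Function.update x i 1 r.2 * v r) := by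
  have h1 : ∀ l, Function.update x i t l * a l =
      (1 - t) * (Function.update x i 0 l * a l) + t * (Function.update x i 1 l * a l) := by
    intro l
    by_cases hl : l = i
    · subst hl
      simp
    · simp only [Function.update_of_ne hl]
      ring
  have h2 : ∀ r : ι × ι, Function.update x i t r.1 * Function.update x i t r.2 * v r =
      (1 - t) * (Function.update x i 0 r.1 * Function.update x i 0 r.2 * v r) +
        t * (Function.update x i 1 r.1 * Function.update x i 1 r.2 * v r) := by
    rintro ⟨k, l⟩
    by_cases hk : k = i
    · subst hk
      by_cases hl : l = k
      · subst hl
        simp [hv]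
      · simp only [Function.update_of_ne hl, Function.update_self]
        ring
    · by_cases hl : l = i
      · subst hl
        simp only [Function.update_of_ne hk, Function.update_self]
        ring
      · simp only [Function.update_of_ne hk, Function.update_of_ne hl]
        ring
  simp_rw [h1, h2, Finset.sum_add_distrib, ← Finset.mul_sum]
  ring

/-- Two finite families with the same one-particle density matrix `∑ᵢ |gᵢ⟩⟨gᵢ|`. -/
def SameDensity {H : Type*} [NormedAddCommGroup H] [InnerProductSpace ℂ H] {ι ι' : Type*}
    [Fintype ι] [Fintype ι'] (g : ι → H) (g' : ι' → H) : Prop :=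
  ∀ a b, ∑ i, ⟪a, g i⟫_ℂ * ⟪g i, b⟫_ℂ = ∑ i, ⟪a, g' i⟫_ℂ * ⟪g' i, b⟫_ℂ

/-! ### Diagonalizing a finite-rank density matrix -/

section Diagonalization

variable {H : Type*} [NormedAddCommGroup H] [InnerProductSpace ℂ H] [CompleteSpace H]
  {E : Type*} [NormedAddCommGroup E] [InnerProductSpace ℂ E]

/-- By Parseval both sides are ⟨L*x, L*y⟩. -/
theorem sameDensity_basis [CompleteSpace E] (L : E →L[ℂ] H) {ι ι' : Type*} [Fintype ι] [Fintype ι']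
    (b : OrthonormalBasis ι ℂ E) (b' : OrthonormalBasis ι' ℂ E) :
    SameDensity (fun i => L (b i)) (fun i => L (b' i)) := by
  intro x y
  simp_rw [← ContinuousLinearMap.adjoint_inner_left L, ← ContinuousLinearMap.adjoint_inner_right L]
  rw [b.sum_inner_mul_inner, b'.sum_inner_mul_inner]

/-- The spectral theorem is applied to L*L on the finite-dimensional space E. The images L w_l of
its eigenvectors are orthogonal with square norms x_l, at most 1 because L is a contraction. Those
that vanish are discarded, so that every weight is strictly positive. -/
theorem exists_diagonal [FiniteDimensional ℂ E] (L : E →L[ℂ] H) (hL : ∀ c, ‖L c‖ ≤ ‖c‖)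
    {ι : Type*} [Fintype ι] (b : OrthonormalBasis ι ℂ E) :
    ∃ (ι' : Type) (_ : Fintype ι') (f : ι' → H) (x : ι' → ℝ), Orthonormal ℂ f ∧
      (∀ l, 0 < x l ∧ x l ≤ 1) ∧
      SameDensity (fun i => L (b i)) (fun l => ((Real.sqrt (x l) : ℝ) : ℂ) • f l) := by
  classical
  have : CompleteSpace E := FiniteDimensional.complete ℂ E
  let T : E →ₗ[ℂ] E := (ContinuousLinearMap.adjoint L ∘L L : E →L[ℂ] E)
  have hTin : ∀ x y, ⟪x, T y⟫_ℂ = ⟪L x, L y⟫_ℂ := fun x y =>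
    ContinuousLinearMap.adjoint_inner_right L x (L y)
  have hT : T.IsSymmetric := by
    intro x y
    rw [hTin, ← inner_conj_symm, hTin, inner_conj_symm]
  set w := hT.eigenvectorBasis rfl with hw
  have hin : ∀ k l, ⟪L (w k), L (w l)⟫_ℂ = if k = l then ((hT.eigenvalues rfl l : ℝ) : ℂ) else 0 := by
    intro k l
    rw [← hTin, hw, hT.apply_eigenvectorBasis, inner_smul_right,
      orthonormal_iff_ite.1 (OrthonormalBasis.orthonormal _)]
    simp
  have hnorm : ∀ l, hT.eigenvalues rfl l = ‖L (w l)‖ ^ 2 := by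
    intro l
    have h1 := hin l l
    rw [if_pos rfl, inner_self_eq_norm_sq_to_K] at h1
    exact Complex.ofReal_injective (by rw [← h1, Complex.ofReal_pow]; rfl)
  let f : {l // L (w l) ≠ 0} → H := fun l => ((‖L (w l)‖ : ℝ) : ℂ)⁻¹ • L (w l)
  have hf : ∀ l : {l // L (w l) ≠ 0},
      ((Real.sqrt (‖L (w l)‖ ^ 2) : ℝ) : ℂ) • f l = L (w l) := by
    intro l
    have h0 : ((‖L (w l)‖ : ℝ) : ℂ) ≠ 0 := by exact_mod_cast norm_ne_zero_iff.2 l.2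
    rw [Real.sqrt_sq (norm_nonneg _)]
    simp only [f]
    rw [smul_smul, mul_inv_cancel₀ h0, one_smul]
  refine ⟨{l // L (w l) ≠ 0}, inferInstance, f, fun l => ‖L (w l)‖ ^ 2, ?_, fun l => ⟨?_, ?_⟩, ?_⟩
  · refine ⟨fun l => ?_, fun k l hkl => ?_⟩
    · simp only [f]
      rw [norm_smul, norm_inv, Complex.norm_real, norm_norm, inv_mul_cancel₀ (norm_ne_zero_iff.2 l.2)]
    · simp only [f]
      rw [inner_smul_left, inner_smul_right, hin, if_neg (fun h => hkl (Subtype.ext h)), mul_zero,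
        mul_zero]
  · have := norm_pos_iff.2 l.2
    positivity
  · have h1 := hL (w l)
    rw [w.orthonormal.1] at h1
    exact pow_le_one₀ (norm_nonneg _) h1
  · intro x y
    rw [sameDensity_basis L b w x y]
    simp_rw [hf]
    rw [← Finset.sum_subtype (Finset.univ.filter fun l => L (w l) ≠ 0) (by simp)
      (fun l => ⟪x, L (w l)⟫_ℂ * ⟪L (w l), y⟫_ℂ)]
    symm
    refine Finset.sum_filter_of_ne (p := fun l => L (w l) ≠ 0) fun l _ h0 hl => h0 ?_
    rw [hl, inner_zero_left, mul_zero]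

end Diagonalization

/-! ### The energy of a finite family, and its rounding to a Slater determinant -/

section FamilyForm

variable {M : Type*} [MeasurableSpace M] {ν : Measure M} [SigmaFinite ν]

theorem sum_enorm_inner_sq {ι : Type*} [Fintype ι] (u : ι → OneP ν) (a : OneP ν) :
    ∑ i, ‖⟪a, u i⟫_ℂ‖ₑ ^ 2 = ENNReal.ofReal (∑ i, ⟪a, u i⟫_ℂ * ⟪u i, a⟫_ℂ).re := by
  have h2 : ∑ i, ⟪a, u i⟫_ℂ * ⟪u i, a⟫_ℂ = ((∑ i, ‖⟪a, u i⟫_ℂ‖ ^ 2 : ℝ) : ℂ) := by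
    rw [Complex.ofReal_sum]
    refine Finset.sum_congr rfl fun l _ => ?_
    rw [← inner_conj_symm (u l) a, Complex.mul_conj', Complex.ofReal_pow]
  simp_rw [enorm_sq_eq_ofReal]
  rw [h2, Complex.ofReal_re, ENNReal.ofReal_sum_of_nonneg fun _ _ => by positivity]

theorem SameDensity.sum_inner_sq {ι ι' : Type*} [Fintype ι] [Fintype ι'] {g : ι → OneP ν}
    {g' : ι' → OneP ν} (h : SameDensity g g') (a : OneP ν) :
    ∑ i, ‖⟪a, g i⟫_ℂ‖ₑ ^ 2 = ∑ i, ‖⟪a, g' i⟫_ℂ‖ₑ ^ 2 := by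
  rw [sum_enorm_inner_sq g, sum_enorm_inner_sq g', h]

variable [TopologicalSpace.SeparableSpace (OneP ν)]

theorem SameDensity.sum_enorm_sq {ι ι' : Type*} [Fintype ι] [Fintype ι'] {g : ι → OneP ν}
    {g' : ι' → OneP ν} (h : SameDensity g g') : ∑ i, ‖g i‖ₑ ^ 2 = ∑ i, ‖g' i‖ₑ ^ 2 := by
  simp_rw [← tsum_enorm_inner_sq (stdBasis (OneP ν))]
  rw [← Summable.tsum_finsetSum fun _ _ => ENNReal.summable,
    ← Summable.tsum_finsetSum fun _ _ => ENNReal.summable]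
  exact tsum_congr fun p => h.sum_inner_sq _

variable {h : OneP ν →ₗ.[ℂ] OneP ν} {m : ℝ} {κ : Type*} [Countable κ] {φ : κ → OneP ν}
  (hφ : ∀ f, opForm h m f = ∑' k, ‖⟪φ k, f⟫_ℂ‖ₑ ^ 2) {V : M × M → ℝ} (hV : Measurable V)

-- The sums ∑ |⟨φ_k, g_i⟩|² and the quantities `pairGram` that fix the pair density depend on the
-- family only through ∑ |g_i⟩⟨g_i|.
include hφ in
theorem SameDensity.familyForm_eq {ι ι' : Type*} [Fintype ι] [Fintype ι'] {g : ι → OneP ν}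
    {g' : ι' → OneP ν} (hg : SameDensity g g') : familyForm h m V g = familyForm h m V g' := by
  have h1 : pairDensity g = pairDensity g' :=
    pairDensity_congr (tsum_enorm_ne_top_of_fintype g) (pairGram_congr
      (tsum_enorm_ne_top_of_fintype g) (tsum_enorm_ne_top_of_fintype g')
      (fun a => by rw [tsum_fintype, tsum_fintype]; exact hg.sum_inner_sq a)
      (fun a b => by rw [tsum_fintype, tsum_fintype]; exact hg a b))
  rw [familyForm, familyForm, h1]
  congr 1
  simp_rw [tsum_fintype, hφ]
  rw [← Summable.tsum_finsetSum fun _ _ => ENNReal.summable,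
    ← Summable.tsum_finsetSum fun _ _ => ENNReal.summable]
  exact tsum_congr fun p => hg.sum_inner_sq _

theorem wedgeSq_smul (c d : ℂ) (f g : OneP ν) :
    wedgeSq (c • f) (d • g) =ᵐ[ν.prod ν] fun z => ‖c‖ₑ ^ 2 * ‖d‖ₑ ^ 2 * wedgeSq f g z := by
  filter_upwards [ae_fst (μ := ν) (Lp.coeFn_smul c f), ae_snd (ν := ν) (Lp.coeFn_smul c f),
    ae_fst (μ := ν) (Lp.coeFn_smul d g), ae_snd (ν := ν) (Lp.coeFn_smul d g)] with z h1 h2 h3 h4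
  rw [wedgeSq, wedgeSq, h1, h2, h3, h4, ← mul_pow, ← mul_pow, ← enorm_mul, ← enorm_mul]
  simp only [Pi.smul_apply, smul_eq_mul]
  congr 2
  ring

/-- The matrix element `∫ V |f ∧ g|²`. -/
noncomputable def wedgeInt (V : M × M → ℝ) (f g : OneP ν) : ℝ≥0∞ :=
  ∫⁻ z, ENNReal.ofReal (V z) * wedgeSq f g z ∂(ν.prod ν)

theorem wedgeInt_self (V : M × M → ℝ) (f : OneP ν) : wedgeInt V f f = 0 := by
  rw [wedgeInt]
  simp [wedgeSq]

theorem wedgeInt_smul (c d : ℂ) (f g : OneP ν) :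
    wedgeInt V (c • f) (d • g) = ‖c‖ₑ ^ 2 * ‖d‖ₑ ^ 2 * wedgeInt V f g := by
  rw [wedgeInt, wedgeInt, ← lintegral_const_mul' _ _ (by finiteness)]
  refine lintegral_congr_ae ?_
  filter_upwards [wedgeSq_smul c d f g] with z hz
  rw [hz]
  ring

-- One factor 1/2 is that of the functional; the other comes from `pairDensity`, where each
-- unordered pair is counted twice.
include hV in
theorem familyForm_fintype {ι : Type*} [Fintype ι] (g : ι → OneP ν) :
    familyForm h m V g = ∑ i, opForm h m (g i) +
      2⁻¹ * (2⁻¹ * ∑ r : ι × ι, wedgeInt V (g r.1) (g r.2)) := by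
  rw [familyForm, lintegral_pairDensity g hV.ennreal_ofReal, tsum_fintype, tsum_fintype]
  rfl

include hφ in
theorem opForm_smul (c : ℂ) (f : OneP ν) : opForm h m (c • f) = ‖c‖ₑ ^ 2 * opForm h m f := by
  rw [hφ, hφ, ← ENNReal.tsum_mul_left]
  refine tsum_congr fun k => ?_
  rw [inner_smul_right, enorm_mul, mul_pow]

include hφ hV in
theorem familyForm_sqrt {ι : Type*} [Fintype ι] (f : ι → OneP ν) (x : ι → ℝ) (hx : ∀ l, 0 ≤ x l) :
    familyForm h m V (fun l => ((Real.sqrt (x l) : ℝ) : ℂ) • f l) =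
      ∑ l, ENNReal.ofReal (x l) * opForm h m (f l) + 2⁻¹ * (2⁻¹ * ∑ r : ι × ι,
        ENNReal.ofReal (x r.1) * ENNReal.ofReal (x r.2) * wedgeInt V (f r.1) (f r.2)) := by
  have h1 : ∀ l, ‖((Real.sqrt (x l) : ℝ) : ℂ)‖ₑ ^ 2 = ENNReal.ofReal (x l) := by
    intro l
    rw [enorm_sq_eq_ofReal, Complex.norm_real, Real.norm_of_nonneg (Real.sqrt_nonneg _),
      Real.sq_sqrt (hx l)]
  rw [familyForm_fintype hV]
  simp_rw [opForm_smul hφ, wedgeInt_smul, h1]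

include hφ hV in
theorem toReal_familyForm_sqrt {ι : Type*} [Fintype ι] (f : ι → OneP ν)
    (h1 : ∀ l, opForm h m (f l) ≠ ∞) (h2 : ∀ r : ι × ι, wedgeInt V (f r.1) (f r.2) ≠ ∞)
    (x : ι → ℝ) (hx : ∀ l, 0 ≤ x l) :
    familyForm h m V (fun l => ((Real.sqrt (x l) : ℝ) : ℂ) • f l) ≠ ∞ ∧
    (familyForm h m V (fun l => ((Real.sqrt (x l) : ℝ) : ℂ) • f l)).toReal =
      ∑ l, x l * (opForm h m (f l)).toReal + ∑ r : ι × ι,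
        x r.1 * x r.2 * ((1 / 4) * (wedgeInt V (f r.1) (f r.2)).toReal) := by
  have e1 : ∀ l, ENNReal.ofReal (x l) * opForm h m (f l) ≠ ∞ :=
    fun l => ENNReal.mul_ne_top ENNReal.ofReal_ne_top (h1 l)
  have e2 : ∀ r : ι × ι, ENNReal.ofReal (x r.1) * ENNReal.ofReal (x r.2) *
      wedgeInt V (f r.1) (f r.2) ≠ ∞ :=
    fun r => ENNReal.mul_ne_top (ENNReal.mul_ne_top ENNReal.ofReal_ne_top ENNReal.ofReal_ne_top) (h2 r)
  have e3 := ENNReal.sum_ne_top.2 fun (l : ι) (_ : l ∈ Finset.univ) => e1 l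
  have e4 := ENNReal.sum_ne_top.2 fun (r : ι × ι) (_ : r ∈ Finset.univ) => e2 r
  have e5 : (2⁻¹ : ℝ≥0∞) ≠ ∞ := by simp
  have e6 := ENNReal.mul_ne_top e5 (ENNReal.mul_ne_top e5 e4)
  rw [familyForm_sqrt hφ hV f x hx]
  refine ⟨ENNReal.add_ne_top.2 ⟨e3, e6⟩, ?_⟩
  rw [ENNReal.toReal_add e3 e6, ENNReal.toReal_sum fun l _ => e1 l, ENNReal.toReal_mul,
    ENNReal.toReal_mul, ENNReal.toReal_sum fun r _ => e2 r]
  congr 1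
  · refine Finset.sum_congr rfl fun l _ => ?_
    rw [ENNReal.toReal_mul, ENNReal.toReal_ofReal (hx l)]
  · rw [Finset.mul_sum, Finset.mul_sum]
    refine Finset.sum_congr rfl fun r _ => ?_
    rw [ENNReal.toReal_mul, ENNReal.toReal_mul, ENNReal.toReal_ofReal (hx _),
      ENNReal.toReal_ofReal (hx _), ENNReal.toReal_inv, ENNReal.toReal_ofNat]
    ring

theorem sameDensity_subset {ι : Type*} [Fintype ι] [DecidableEq ι] (f : ι → OneP ν) (S : Finset ι) :
    SameDensity (fun i : Fin S.card => f (S.equivFin.symm i))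
      (fun l => ((Real.sqrt (if l ∈ S then 1 else 0) : ℝ) : ℂ) • f l) := by
  intro a b
  rw [S.equivFin.symm.sum_comp fun l : S => ⟪a, f l⟫_ℂ * ⟪f l, b⟫_ℂ,
    Finset.sum_coe_sort S fun l => ⟪a, f l⟫_ℂ * ⟪f l, b⟫_ℂ]
  refine Eq.trans ?_ (Finset.sum_subset (Finset.subset_univ S) fun l _ hl => ?_)
  · refine Finset.sum_congr rfl fun l hl => ?_
    simp [hl]
  · simp [hl]

include hφ hV in
/-- Lieb's principle for finite families. -/
theorem exists_orthonormal_familyForm_le {ι : Type*} [Fintype ι] {f : ι → OneP ν}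
    (hf : Orthonormal ℂ f) (x : ι → ℝ) (hx : ∀ l, 0 < x l ∧ x l ≤ 1)
    (hfin : familyForm h m V (fun l => ((Real.sqrt (x l) : ℝ) : ℂ) • f l) ≠ ∞) (r : ℝ) :
    ∃ (N : ℕ) (u : Fin N → OneP ν), Orthonormal ℂ u ∧ familyForm h m V u ≠ ∞ ∧
      (familyForm h m V u).toReal - r * N ≤
        (familyForm h m V (fun l => ((Real.sqrt (x l) : ℝ) : ℂ) • f l)).toReal - r * ∑ l, x l := by
  classical
  have hx0 : ∀ l, 0 ≤ x l := fun l => (hx l).1.le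
  have hfin' := hfin
  rw [familyForm_sqrt hφ hV f x hx0, ENNReal.add_ne_top] at hfin'
  -- Because every weight is positive, finiteness of the total energy makes each one-body and each
  -- pair energy finite; the energy is then a real polynomial in the weights, valid at all vertices
  -- too.
  have hpos : ∀ l, ENNReal.ofReal (x l) ≠ 0 := fun l => (ENNReal.ofReal_pos.2 (hx l).1).ne'
  have h1 : ∀ l, opForm h m (f l) ≠ ∞ := by
    intro l htop
    refine ENNReal.sum_ne_top.1 hfin'.1 l (Finset.mem_univ l) ?_
    rw [htop, ENNReal.mul_top (hpos l)]
  have h2 : ∀ p : ι × ι, wedgeInt V (f p.1) (f p.2) ≠ ∞ := by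
    intro p htop
    have h3 : ∑ r : ι × ι, ENNReal.ofReal (x r.1) * ENNReal.ofReal (x r.2) *
        wedgeInt V (f r.1) (f r.2) ≠ ∞ := by
      intro h4
      apply hfin'.2
      rw [h4, ENNReal.mul_top (by simp), ENNReal.mul_top (by simp)]
    refine ENNReal.sum_ne_top.1 h3 p (Finset.mem_univ p) ?_
    rw [htop, ENNReal.mul_top (mul_ne_zero (hpos _) (hpos _))]
  -- The particle-number term is absorbed into the linear coefficients, so the rounding controls
  -- energy and number together.
  set E : (ι → ℝ) → ℝ := fun y => ∑ l, y l * ((opForm h m (f l)).toReal - r) + ∑ p : ι × ι,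
        y p.1 * y p.2 * ((1 / 4) * (wedgeInt V (f p.1) (f p.2)).toReal) with hE
  obtain ⟨S, hS⟩ := exists_vertex_le E (fun y i t => quadratic_update _
    (fun p : ι × ι => (1 / 4) * (wedgeInt V (f p.1) (f p.2)).toReal)
    (fun i => by simp [wedgeInt_self]) y i t) x fun l => ⟨hx0 l, (hx l).2⟩
  have hEeq : ∀ y : ι → ℝ, (∀ l, 0 ≤ y l) → E y =
      (familyForm h m V (fun l => ((Real.sqrt (y l) : ℝ) : ℂ) • f l)).toReal - r * ∑ l, y l := by
    intro y hy
    rw [(toReal_familyForm_sqrt hφ hV f h1 h2 y hy).2, hE]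
    simp only [mul_sub, Finset.sum_sub_distrib]
    rw [← Finset.sum_mul]
    ring
  have hy0 : ∀ l, (0 : ℝ) ≤ if l ∈ S then 1 else 0 := fun l => by split_ifs <;> norm_num
  rw [hEeq x hx0, hEeq _ hy0] at hS
  have hsd := (sameDensity_subset f S).familyForm_eq hφ (V := V)
  refine ⟨S.card, fun i => f (S.equivFin.symm i),
    hf.comp _ (Subtype.val_injective.comp S.equivFin.symm.injective), ?_, ?_⟩
  · rw [hsd]
    exact (toReal_familyForm_sqrt hφ hV f h1 h2 _ hy0).1
  · rw [hsd]
    refine le_trans (le_of_eq ?_) hS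
    simp

end FamilyForm

end BHF

namespace BHF

set_option linter.unusedSectionVars false

/-! ### Equality of the energies -/

section Energies

theorem coe_sub_real {A : ℝ≥0∞} (hA : A ≠ ∞) (c : ℝ) :
    (A : EReal) - (c : EReal) = ((A.toReal - c : ℝ) : EReal) := by
  rw [EReal.coe_sub, EReal.coe_ennreal_toReal hA]

theorem top_sub_real (c : ℝ) : ((∞ : ℝ≥0∞) : EReal) - (c : EReal) = ⊤ := by
  rw [EReal.coe_ennreal_top, EReal.top_sub_coe]

variable {M : Type*} [MeasurableSpace M] {ν : Measure M} [SigmaFinite ν]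
  [TopologicalSpace.SeparableSpace (OneP ν)]

theorem norm_opSqrt_le {γ : OneP ν →L[ℂ] OneP ν} (hγ : IsOnePDM γ) (x : OneP ν) :
    ‖opSqrt γ x‖ ≤ ‖x‖ := by
  have h1 : 0 ≤ (⟪x, (1 - γ) x⟫_ℂ).re := by
    rw [← inner_opSqrt_opSqrt (sub_nonneg.2 hγ.le_one)]
    exact inner_self_nonneg (𝕜 := ℂ)
  have h2 : (⟪x, γ x⟫_ℂ).re = ‖opSqrt γ x‖ ^ 2 := by
    rw [← inner_opSqrt_opSqrt hγ.nonneg]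
    exact inner_self_eq_norm_sq (𝕜 := ℂ) _
  have h3 : (⟪x, x⟫_ℂ).re = ‖x‖ ^ 2 := inner_self_eq_norm_sq (𝕜 := ℂ) _
  have h4 : (⟪x, (1 - γ) x⟫_ℂ).re = ‖x‖ ^ 2 - ‖opSqrt γ x‖ ^ 2 := by
    rw [← h2, ← h3, ← Complex.sub_re, ← inner_sub_right]
    rfl
  refine (pow_le_pow_iff_left₀ (norm_nonneg _) (norm_nonneg _) two_ne_zero).1 ?_
  linarith

variable {h : OneP ν →ₗ.[ℂ] OneP ν} {m : ℝ} {κ : Type*} [Countable κ] {φ : κ → OneP ν}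
  (hφ : ∀ f, opForm h m f = ∑' k, ‖⟪φ k, f⟫_ℂ‖ₑ ^ 2) {V : M × M → ℝ} (hV : Measurable V)

-- Every term of the shifted energy is nonnegative, so omitting members of the family can only lower
-- it.
include hV in
theorem familyForm_comp_le {ι ι' : Type*} [Countable ι] [Countable ι'] (g : ι → OneP ν)
    {i : ι' → ι} (hi : Function.Injective i) :
    familyForm h m V (g ∘ i) ≤ familyForm h m V g := by
  rw [familyForm, familyForm, lintegral_pairDensity _ hV.ennreal_ofReal,
    lintegral_pairDensity _ hV.ennreal_ofReal]
  refine add_le_add (ENNReal.tsum_comp_le_tsum_of_injective hi fun l => opForm h m (g l)) ?_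
  refine mul_le_mul_right (mul_le_mul_right ?_ _) _
  exact ENNReal.tsum_comp_le_tsum_of_injective (hi.prodMap hi)
    fun r : ι × ι => ∫⁻ z, ENNReal.ofReal (V z) * wedgeSq (g r.1) (g r.2) z ∂(ν.prod ν)

include hφ hV in
theorem hfEnergy_le_familyForm {N : ℕ} {u : Fin N → OneP ν} (hu : Orthonormal ℂ u)
    (hfin : familyForm h m V u ≠ ∞) (μ : ℝ) :
    hfEnergy ν h m μ V ≤ (((familyForm h m V u).toReal - (m + μ) * N : ℝ) : EReal) := by
  refine (iInf_le _ N).trans ?_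
  have h1 : hfEnergyN ν h m V N ≤ (((familyForm h m V u).toReal - m * N : ℝ) : EReal) := by
    refine (iInf₂_le u hu).trans ?_
    rw [nBodyForm_slater hφ hV, fockForm_wedge hφ hV hu, coe_sub_real hfin]
  refine (EReal.sub_le_sub h1 le_rfl).trans (le_of_eq ?_)
  rw [← EReal.coe_sub]
  congr 1
  ring

-- The vectors γ^{1/2}e_i with i in F are the images of an orthonormal basis under the contraction
-- γ^{1/2} restricted to their span. Diagonalizing this finite family and rounding its weights
-- yields a Slater determinant; the trace of the family is the sum of the weights.
include hφ hV in
theorem hfEnergy_le_truncated {γ : OneP ν →L[ℂ] OneP ν} (hγ : IsOnePDM γ)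
    (hfin : familyForm h m V (sqrtVec γ) ≠ ∞) (μ : ℝ) (F : Finset (BasisIndex (OneP ν))) :
    hfEnergy ν h m μ V ≤ (((familyForm h m V (sqrtVec γ)).toReal -
      (m + μ) * ∑ i ∈ F, ‖sqrtVec γ i‖ ^ 2 : ℝ) : EReal) := by
  classical
  set e := stdBasis (OneP ν) with he
  let W := Submodule.span ℂ (F.image e : Set (OneP ν))
  have hW : FiniteDimensional ℂ W := FiniteDimensional.span_of_finite ℂ (Finset.finite_toSet _)
  let L : W →L[ℂ] OneP ν := opSqrt γ ∘L W.subtypeL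
  let b : OrthonormalBasis F ℂ W := OrthonormalBasis.span e.orthonormal F
  have hb : ∀ i : F, L (b i) = sqrtVec γ i := fun i => by
    have h1 : ((b i : W) : OneP ν) = e i := OrthonormalBasis.span_apply e.orthonormal F i
    change opSqrt γ (b i : W) = _
    rw [h1]
    rfl
  obtain ⟨ι', _, f, x, hf, hx, hsd⟩ := exists_diagonal L
    (fun c => (norm_opSqrt_le hγ (c : OneP ν))) b
  simp only [hb] at hsd
  have h1 := hsd.familyForm_eq hφ (V := V)
  have h2 : familyForm h m V (fun i : F => sqrtVec γ i) ≤ familyForm h m V (sqrtVec γ) :=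
    familyForm_comp_le hV (sqrtVec γ) Subtype.val_injective
  have h3 : familyForm h m V (fun l => ((Real.sqrt (x l) : ℝ) : ℂ) • f l) ≠ ∞ := by
    rw [← h1]
    exact ne_top_of_le_ne_top hfin h2
  obtain ⟨N, u, hu, hu1, hu2⟩ := exists_orthonormal_familyForm_le hφ hV hf x hx h3 (m + μ)
  have h4 : ∑ i ∈ F, ‖sqrtVec γ i‖ ^ 2 = ∑ l, x l := by
    have h5 := congrArg ENNReal.toReal hsd.sum_enorm_sq
    have h6 : ∀ l, ‖((Real.sqrt (x l) : ℝ) : ℂ) • f l‖ ^ 2 = x l := fun l => by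
      rw [norm_smul, hf.1, mul_one, Complex.norm_real, Real.norm_of_nonneg (Real.sqrt_nonneg _),
        Real.sq_sqrt (hx l).1.le]
    simp_rw [enorm_sq_eq_ofReal] at h5
    rw [← ENNReal.ofReal_sum_of_nonneg fun _ _ => by positivity,
      ← ENNReal.ofReal_sum_of_nonneg fun _ _ => by positivity,
      ENNReal.toReal_ofReal (Finset.sum_nonneg fun _ _ => by positivity),
      ENNReal.toReal_ofReal (Finset.sum_nonneg fun _ _ => by positivity)] at h5
    simp_rw [h6] at h5
    rw [← h5]
    exact (Finset.sum_coe_sort F fun i => ‖sqrtVec γ i‖ ^ 2).symm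
  refine (hfEnergy_le_familyForm hφ hV hu hu1 μ).trans (EReal.coe_le_coe_iff.2 (hu2.trans ?_))
  rw [h4, ← h1]
  exact sub_le_sub_right (ENNReal.toReal_mono hfin h2) _

include hφ hV in
/-- Lieb's variational principle. -/
theorem hfEnergy_le_hfFunctional (hV0 : ∀ᵐ p ∂(ν.prod ν), 0 ≤ V p) {γ : OneP ν →L[ℂ] OneP ν}
    (hγ : IsOnePDM γ) (μ : ℝ) : hfEnergy ν h m μ V ≤ hfFunctional ν h m μ V γ := by
  rw [hfFunctional_eq hV hV0 hγ.nonneg hγ.traceClass]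
  by_cases hfin : familyForm h m V (sqrtVec γ) = ∞
  · rw [hfin, top_sub_real]
    exact le_top
  rw [coe_sub_real hfin]
  have hs := summable_norm_opSqrt hγ.nonneg hγ.traceClass
  have htr : (posTrace γ).toReal = ∑' i, ‖opSqrt γ (stdBasis (OneP ν) i)‖ ^ 2 := by
    rw [posTrace_eq hγ.nonneg, tsum_enorm_sq_eq_ofReal hs,
      ENNReal.toReal_ofReal (tsum_nonneg fun _ => by positivity)]
  -- Since m + μ may have either sign, the particle-number term is treated by a limit over F and not
  -- by monotonicity.
  have hlim : Filter.Tendsto (fun F : Finset (BasisIndex (OneP ν)) =>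
      (((familyForm h m V (sqrtVec γ)).toReal -
        (m + μ) * ∑ i ∈ F, ‖sqrtVec γ i‖ ^ 2 : ℝ) : EReal)) Filter.atTop
      (nhds (((familyForm h m V (sqrtVec γ)).toReal -
        (m + μ) * (posTrace γ).toReal : ℝ) : EReal)) := by
    refine (continuous_coe_real_ereal.tendsto _).comp ?_
    rw [htr]
    exact (hs.hasSum.const_mul (m + μ)).const_sub _
  exact ge_of_tendsto' hlim fun F => hfEnergy_le_truncated hφ hV hγ hfin μ F

include hφ hV in
theorem bhfEnergy_le_hfEnergy (μ : ℝ) : bhfEnergy ν h m μ V ≤ hfEnergy ν h m μ V := by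
  refine le_iInf fun N => ?_
  rw [EReal.le_sub_iff_add_le (Or.inl (EReal.coe_ne_bot _)) (Or.inl (EReal.coe_ne_top _))]
  refine le_iInf₂ fun f hf => ?_
  rw [← EReal.le_sub_iff_add_le (Or.inl (EReal.coe_ne_bot _)) (Or.inl (EReal.coe_ne_top _)),
    nBodyForm_slater hφ hV]
  have hn := norm_wedge hf
  have h1 : formTrace (fockForm ν h m V) (InnerProductSpace.rankOne ℂ (wedge f) (wedge f)) =
      fockForm ν h m V (wedge f) := formTrace_pureState hn fun c => fockForm_smul hφ hV c _
  by_cases hfin : fockForm ν h m V (wedge f) = ∞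
  · rw [hfin, top_sub_real, EReal.top_sub_coe]
    exact le_top
  refine (iInf₂_le _ (isQuasifree_wedge hf)).trans ((iInf_le _ (by rwa [h1])).trans ?_)
  rw [fockEnergy, h1, formTrace_pureState hn fun c => numberForm_smul c _, numberForm_wedge hf,
    coe_sub_real hfin, coe_sub_real hfin, ← EReal.coe_sub, EReal.coe_le_coe_iff,
    ENNReal.toReal_natCast]
  linarith

include hφ hV in
theorem iInf_hfFunctional_le_bhfEnergy (hV0 : ∀ᵐ p ∂(ν.prod ν), 0 ≤ V p) (μ : ℝ) :
    ⨅ (γ : OneP ν →L[ℂ] OneP ν) (_ : IsOnePDM γ), hfFunctional ν h m μ V γ ≤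
      bhfEnergy ν h m μ V := by
  refine le_iInf fun ρ => le_iInf₂ fun hρ _ => ?_
  obtain ⟨γ, hγ, hle⟩ := hρ.exists_hfFunctional_le hφ hV hV0 μ
  exact (iInf₂_le γ hγ).trans hle

end Energies

end BHF

namespace BHF

set_option linter.unusedSectionVars false

/-! ### Generalized one-particle density matrices -/

section GeneralizedPDM

variable {H : Type*} [NormedAddCommGroup H] [InnerProductSpace ℂ H] [CompleteSpace H]

theorem gammaBlock_apply (Γ : Dbl H →L[ℂ] Dbl H) (f : H) :
    gammaBlock Γ f = (Γ (WithLp.toLp 2 (f, 0))).fst := rfl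

theorem pairingBlock_apply (Γ : Dbl H →L[ℂ] Dbl H) (f : H) :
    pairingBlock Γ f = (Γ (WithLp.toLp 2 (0, f))).fst := rfl

theorem signFlip_apply (F : Dbl H) : signFlip H F = WithLp.toLp 2 (F.fst, -F.snd) := rfl

theorem flipped_apply (Γ : Dbl H →L[ℂ] Dbl H) (F : Dbl H) :
    flipped Γ F = signFlip H (Γ (signFlip H F)) := rfl

theorem averaged_apply (Γ : Dbl H →L[ℂ] Dbl H) (F : Dbl H) :
    averaged Γ F = (1 / 2 : ℂ) • (Γ F + flipped Γ F) := rfl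

theorem gammaBlock_flipped (Γ : Dbl H →L[ℂ] Dbl H) : gammaBlock (flipped Γ) = gammaBlock Γ := by
  ext f
  rw [gammaBlock_apply, gammaBlock_apply, flipped_apply, signFlip_apply, signFlip_apply]
  simp

theorem pairingBlock_flipped (Γ : Dbl H →L[ℂ] Dbl H) :
    pairingBlock (flipped Γ) = -pairingBlock Γ := by
  ext f
  have h : (WithLp.toLp 2 ((0 : H), -f)) = -(WithLp.toLp 2 ((0 : H), f)) := by
    rw [← WithLp.toLp_neg]; simp
  rw [neg_apply, pairingBlock_apply, pairingBlock_apply, flipped_apply, signFlip_apply,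
    signFlip_apply]
  change (Γ (WithLp.toLp 2 ((0 : H), -f))).fst = _
  rw [h, map_neg]
  rfl

theorem gammaBlock_averaged (Γ : Dbl H →L[ℂ] Dbl H) : gammaBlock (averaged Γ) = gammaBlock Γ := by
  ext f
  have h := congrArg (fun T => T f) (gammaBlock_flipped Γ)
  simp only [gammaBlock_apply] at h
  rw [gammaBlock_apply, gammaBlock_apply, averaged_apply, WithLp.smul_fst, WithLp.add_fst, h,
    ← two_smul ℂ, smul_smul]
  norm_num

theorem pairingBlock_averaged (Γ : Dbl H →L[ℂ] Dbl H) : pairingBlock (averaged Γ) = 0 := by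
  ext f
  have h := congrArg (fun T => T f) (pairingBlock_flipped Γ)
  simp only [neg_apply, pairingBlock_apply] at h
  rw [pairingBlock_apply, averaged_apply, WithLp.smul_fst, WithLp.add_fst, h]
  simp

theorem inner_signFlip (F G : Dbl H) : ⟪signFlip H F, G⟫_ℂ = ⟪F, signFlip H G⟫_ℂ := by
  simp [signFlip_apply, WithLp.prod_inner_apply]

theorem signFlip_signFlip (F : Dbl H) : signFlip H (signFlip H F) = F := by
  change WithLp.toLp 2 (F.fst, - -F.snd) = F
  rw [neg_neg]
  rfl

theorem signFlip_dblConj (j : H →ₗᵢ⋆[ℂ] H) (F : Dbl H) :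
    dblConj j (signFlip H F) = -signFlip H (dblConj j F) := by
  rw [signFlip_apply, signFlip_apply, ← WithLp.toLp_neg]
  simp [dblConj]

theorem dblConj_add (j : H →ₗᵢ⋆[ℂ] H) (F G : Dbl H) :
    dblConj j (F + G) = dblConj j F + dblConj j G := by
  simp only [dblConj, ← WithLp.toLp_add, WithLp.add_fst, WithLp.add_snd, map_add, Prod.mk_add_mk]

theorem dblConj_neg (j : H →ₗᵢ⋆[ℂ] H) (F : Dbl H) : dblConj j (-F) = -dblConj j F := by
  simp only [dblConj, ← WithLp.toLp_neg, WithLp.neg_fst, WithLp.neg_snd, map_neg, Prod.neg_mk]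

theorem dblConj_half_smul (j : H →ₗᵢ⋆[ℂ] H) (F : Dbl H) :
    dblConj j ((1 / 2 : ℂ) • F) = (1 / 2 : ℂ) • dblConj j F := by
  simp only [dblConj, ← WithLp.toLp_smul, WithLp.smul_fst, WithLp.smul_snd, map_smulₛₗ,
    Prod.smul_mk]
  simp [map_ofNat]

/-- Polarization: a conjugate-linear isometry preserves the four norms, up to exchanging the roles
of x and y. -/
theorem inner_conj_conj (j : H →ₗᵢ⋆[ℂ] H) (x y : H) : ⟪j x, j y⟫_ℂ = ⟪y, x⟫_ℂ := by
  have hI : j (Complex.I • y) = -(Complex.I • j y) := by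
    rw [map_smulₛₗ, starRingEnd_apply]; simp
  have hI' : j (Complex.I • x) = -(Complex.I • j x) := by
    rw [map_smulₛₗ, starRingEnd_apply]; simp
  rw [inner_eq_sum_norm_sq_div_four, inner_eq_sum_norm_sq_div_four y x]
  have h1 : ‖j x + j y‖ = ‖y + x‖ := by rw [← map_add, j.norm_map, add_comm]
  have h2 : ‖j x - j y‖ = ‖y - x‖ := by rw [← map_sub, j.norm_map, norm_sub_rev]
  have h3 : ‖j x - Complex.I • j y‖ = ‖y - Complex.I • x‖ := by
    have : j x - Complex.I • j y = j (Complex.I • (y - Complex.I • x)) := by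
      rw [smul_sub, smul_smul, Complex.I_mul_I, map_sub, hI]; simp; abel
    rw [this, j.norm_map, norm_smul]; simp
  have h4 : ‖j x + Complex.I • j y‖ = ‖y + Complex.I • x‖ := by
    have : j x + Complex.I • j y = -j (Complex.I • (y + Complex.I • x)) := by
      rw [smul_add, smul_smul, Complex.I_mul_I, map_add, hI]; simp
    rw [this, norm_neg, j.norm_map, norm_smul]; simp
  simp only [RCLike.I_to_complex] at *
  rw [h1, h2, h3, h4]

theorem inner_dblConj (j : H →ₗᵢ⋆[ℂ] H) (F G : Dbl H) :
    ⟪dblConj j F, dblConj j G⟫_ℂ = ⟪G, F⟫_ℂ := by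
  simp only [WithLp.prod_inner_apply]
  change ⟪j F.snd, j G.snd⟫_ℂ + ⟪j F.fst, j G.fst⟫_ℂ = ⟪G.fst, F.fst⟫_ℂ + ⟪G.snd, F.snd⟫_ℂ
  rw [inner_conj_conj, inner_conj_conj, add_comm]

theorem dblConj_dblConj {j : H →ₗᵢ⋆[ℂ] H} (hj : ∀ f, j (j f) = f) (F : Dbl H) :
    dblConj j (dblConj j F) = F := by
  change WithLp.toLp 2 (j (j F.fst), j (j F.snd)) = F
  rw [hj, hj]
  rfl

theorem nonneg_iff_inner {T : H →L[ℂ] H} :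
    0 ≤ T ↔ (∀ x y, ⟪T x, y⟫_ℂ = ⟪x, T y⟫_ℂ) ∧ ∀ x, 0 ≤ (⟪x, T x⟫_ℂ).re := by
  rw [ContinuousLinearMap.nonneg_iff_isPositive]
  constructor
  · intro h
    exact ⟨h.isSymmetric, fun x => by simpa using h.re_inner_nonneg_right x⟩
  · rintro ⟨h1, h2⟩
    refine ⟨h1, fun x => ?_⟩
    rw [ContinuousLinearMap.reApplyInnerSelf_apply, h1]
    exact h2 x

/-- This is T² ≤ T for 0 ≤ T ≤ 1, obtained by applying the upper bound to T^{1/2}x. -/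
theorem norm_apply_sq_le {T : H →L[ℂ] H} (h0 : 0 ≤ T)
    (h1 : ∀ x, (⟪x, T x⟫_ℂ).re ≤ ‖x‖ ^ 2) (x : H) : ‖T x‖ ^ 2 ≤ (⟪x, T x⟫_ℂ).re := by
  have h2 : ∀ y, (⟪y, T y⟫_ℂ).re = ‖opSqrt T y‖ ^ 2 := fun y => by
    rw [← inner_opSqrt_opSqrt h0, inner_self_eq_norm_sq_to_K]; norm_cast
  have h3 := h1 (opSqrt T x)
  rwa [h2, opSqrt_opSqrt h0, ← h2 x] at h3

/-- Since Γ = J(1 - Γ)J with J antiunitary, ⟨F, ΓF⟩ equals ‖F‖² minus the nonnegative number ⟨ΓJF,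
JF⟩. -/
theorem IsGenOnePDM.inner_le {j : H →ₗᵢ⋆[ℂ] H} (hj : ∀ f, j (j f) = f)
    {Γ : Dbl H →L[ℂ] Dbl H} (hΓ : IsGenOnePDM j Γ) (F : Dbl H) :
    (⟪F, Γ F⟫_ℂ).re ≤ ‖F‖ ^ 2 := by
  have h1 : ⟪F, Γ F⟫_ℂ = ⟪F, F⟫_ℂ - ⟪Γ (dblConj j F), dblConj j F⟫_ℂ := by
    conv_lhs => rw [hΓ.conj F]
    nth_rewrite 1 [← dblConj_dblConj hj F]
    rw [inner_dblConj, inner_sub_left, inner_dblConj]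
  have h2 := (nonneg_iff_inner.1 hΓ.nonneg).2 (dblConj j F)
  rw [← (nonneg_iff_inner.1 hΓ.nonneg).1] at h2
  rw [h1, Complex.sub_re, inner_self_eq_norm_sq_to_K]
  have : (((‖F‖ : ℝ) : ℂ) ^ 2).re = ‖F‖ ^ 2 := by norm_cast
  change (((‖F‖ : ℝ) : ℂ) ^ 2).re - _ ≤ _
  linarith

theorem inner_toLp_zero (f : H) (G : Dbl H) :
    ⟪(WithLp.toLp 2 (f, (0 : H)) : Dbl H), G⟫_ℂ = ⟪f, G.fst⟫_ℂ := by
  simp [WithLp.prod_inner_apply]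

theorem norm_toLp_zero (f : H) : ‖(WithLp.toLp 2 (f, (0 : H)) : Dbl H)‖ = ‖f‖ := by
  simp

theorem IsGenOnePDM.isOnePDM {j : H →ₗᵢ⋆[ℂ] H} (hj : ∀ f, j (j f) = f)
    {Γ : Dbl H →L[ℂ] Dbl H} (hΓ : IsGenOnePDM j Γ) : IsOnePDM (gammaBlock Γ) := by
  obtain ⟨hs, hp⟩ := nonneg_iff_inner.1 hΓ.nonneg
  have hs' : ∀ x y, ⟪gammaBlock Γ x, y⟫_ℂ = ⟪x, gammaBlock Γ y⟫_ℂ := fun x y => by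
    rw [gammaBlock_apply, gammaBlock_apply, ← inner_toLp_zero, ← hs, ← inner_conj_symm,
      ← inner_toLp_zero, inner_conj_symm]
  refine ⟨nonneg_iff_inner.2 ⟨hs', fun x => ?_⟩, ?_, hΓ.traceClass⟩
  · rw [gammaBlock_apply, ← inner_toLp_zero]
    exact hp _
  · rw [← sub_nonneg]
    refine nonneg_iff_inner.2 ⟨fun x y => ?_, fun x => ?_⟩
    · change ⟪x - gammaBlock Γ x, y⟫_ℂ = ⟪x, y - gammaBlock Γ y⟫_ℂ
      rw [inner_sub_left, inner_sub_right, hs']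
    · change 0 ≤ (⟪x, x - gammaBlock Γ x⟫_ℂ).re
      rw [inner_sub_right, gammaBlock_apply, ← inner_toLp_zero, Complex.sub_re,
        inner_self_eq_norm_sq_to_K]
      have h := hΓ.inner_le hj (WithLp.toLp 2 (x, 0))
      rw [norm_toLp_zero] at h
      have : (((‖x‖ : ℝ) : ℂ) ^ 2).re = ‖x‖ ^ 2 := by norm_cast
      change 0 ≤ (((‖x‖ : ℝ) : ℂ) ^ 2).re - _
      linarith

/-- The lower component of Γ(f ⊕ 0) is α*f, so Γ² ≤ Γ gives ‖α*f‖² ≤ ⟨f, γf⟩; this is then summed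
over a basis. -/
theorem IsGenOnePDM.tsum_adjoint_pairingBlock_le {j : H →ₗᵢ⋆[ℂ] H} (hj : ∀ f, j (j f) = f)
    {Γ : Dbl H →L[ℂ] Dbl H} (hΓ : IsGenOnePDM j Γ) :
    ∑' i, ‖ContinuousLinearMap.adjoint (pairingBlock Γ) (stdBasis H i)‖ₑ ^ 2 ≤
      posTrace (gammaBlock Γ) := by
  refine ENNReal.tsum_le_tsum fun i => ?_
  have h1 : ∀ f, ContinuousLinearMap.adjoint (pairingBlock Γ) f =
      (Γ (WithLp.toLp 2 (f, 0))).snd := fun f => by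
    refine ext_inner_left ℂ fun g => ?_
    rw [ContinuousLinearMap.adjoint_inner_right, pairingBlock_apply, ← inner_conj_symm,
      ← inner_toLp_zero, inner_conj_symm, (nonneg_iff_inner.1 hΓ.nonneg).1]
    simp [WithLp.prod_inner_apply]
  rw [enorm_sq_eq_ofReal, h1, gammaBlock_apply, ← inner_toLp_zero]
  refine ENNReal.ofReal_le_ofReal ((pow_le_pow_left₀ (norm_nonneg _)
    (WithLp.norm_snd_le H _) 2).trans ?_)
  exact norm_apply_sq_le hΓ.nonneg (hΓ.inner_le hj) _

/-- The unitary diag(1,-1) anticommutes with J, and the two resulting signs cancel in J(1 - Γ)J. -/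
theorem IsGenOnePDM.flipped {j : H →ₗᵢ⋆[ℂ] H} {Γ : Dbl H →L[ℂ] Dbl H} (hΓ : IsGenOnePDM j Γ) :
    IsGenOnePDM j (flipped Γ) := by
  obtain ⟨hs, hp⟩ := nonneg_iff_inner.1 hΓ.nonneg
  refine ⟨nonneg_iff_inner.2 ⟨fun x y => ?_, fun x => ?_⟩, fun F => ?_, ?_⟩
  · rw [flipped_apply, flipped_apply, inner_signFlip, hs, inner_signFlip]
  · rw [flipped_apply, ← inner_signFlip]
    exact hp _
  · obtain ⟨G, rfl⟩ : ∃ G, F = signFlip H G := ⟨signFlip H F, (signFlip_signFlip F).symm⟩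
    rw [flipped_apply, flipped_apply, signFlip_signFlip, signFlip_dblConj, map_neg,
      signFlip_signFlip, map_neg, map_neg, ← neg_sub', dblConj_neg, ← map_sub, signFlip_dblConj,
      neg_neg, ← hΓ.conj]
  · rw [gammaBlock_flipped]
    exact hΓ.traceClass

theorem IsGenOnePDM.averaged {j : H →ₗᵢ⋆[ℂ] H} {Γ : Dbl H →L[ℂ] Dbl H} (hΓ : IsGenOnePDM j Γ) :
    IsGenOnePDM j (averaged Γ) := by
  obtain ⟨hs, hp⟩ := nonneg_iff_inner.1 hΓ.nonneg
  obtain ⟨hs', hp'⟩ := nonneg_iff_inner.1 hΓ.flipped.nonneg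
  refine ⟨nonneg_iff_inner.2 ⟨fun x y => ?_, fun x => ?_⟩, fun F => ?_, ?_⟩
  · simp only [averaged_apply, inner_smul_left, inner_smul_right, inner_add_left, inner_add_right,
      hs, hs']
    rw [map_div₀, map_one, map_ofNat]
  · have h1 : ⟪x, BHF.averaged Γ x⟫_ℂ =
        ((1 / 2 : ℝ) : ℂ) * (⟪x, Γ x⟫_ℂ + ⟪x, BHF.flipped Γ x⟫_ℂ) := by
      rw [averaged_apply, inner_smul_right, inner_add_right]
      norm_num
    rw [h1, Complex.re_ofReal_mul, Complex.add_re]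
    exact mul_nonneg (by norm_num) (add_nonneg (hp x) (hp' x))
  · have h1 : dblConj j F - BHF.averaged Γ (dblConj j F) = (1 / 2 : ℂ) •
        ((dblConj j F - Γ (dblConj j F)) + (dblConj j F - BHF.flipped Γ (dblConj j F))) := by
      rw [averaged_apply]
      module
    rw [h1, dblConj_half_smul, dblConj_add, ← hΓ.conj, ← hΓ.flipped.conj, averaged_apply]
  · rw [gammaBlock_averaged]
    exact hΓ.traceClass

/-- The operator matrix `diag(γ, 1 - j γ j)`. -/
noncomputable def diagPDM (j : H →ₗᵢ⋆[ℂ] H) (γ : H →L[ℂ] H) : Dbl H →L[ℂ] Dbl H :=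
  ((WithLp.prodContinuousLinearEquiv 2 ℂ H H).symm : _ →L[ℂ] _) ∘L
    (γ.prodMap (ContinuousLinearMap.id ℂ H -
      (j.toContinuousLinearMap.comp (γ.comp j.toContinuousLinearMap) : H →L[ℂ] H))) ∘L
    (WithLp.prodContinuousLinearEquiv 2 ℂ H H : _ →L[ℂ] _)

theorem diagPDM_apply (j : H →ₗᵢ⋆[ℂ] H) (γ : H →L[ℂ] H) (F : Dbl H) :
    diagPDM j γ F = WithLp.toLp 2 (γ F.fst, F.snd - j (γ (j F.snd))) := rfl

theorem gammaBlock_diagPDM (j : H →ₗᵢ⋆[ℂ] H) (γ : H →L[ℂ] H) :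
    gammaBlock (diagPDM j γ) = γ := rfl

theorem pairingBlock_diagPDM (j : H →ₗᵢ⋆[ℂ] H) (γ : H →L[ℂ] H) :
    pairingBlock (diagPDM j γ) = 0 := by
  ext f
  rw [pairingBlock_apply, diagPDM_apply]
  simp

/-- Positivity of the lower block at f is ⟨jf, (1 - γ)jf⟩ ≥ 0, which is where γ ≤ 1 enters. -/
theorem IsOnePDM.isGenOnePDM_diagPDM {j : H →ₗᵢ⋆[ℂ] H} (hj : ∀ f, j (j f) = f) {γ : H →L[ℂ] H}
    (hγ : IsOnePDM γ) : IsGenOnePDM j (diagPDM j γ) := by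
  obtain ⟨hs, hp⟩ := nonneg_iff_inner.1 hγ.nonneg
  have hp' := (nonneg_iff_inner.1 (sub_nonneg.2 hγ.le_one)).2
  have hl : ∀ x y, ⟪j (γ (j x)), y⟫_ℂ = ⟪j y, γ (j x)⟫_ℂ := fun x y => by
    rw [← inner_conj_conj j, hj]
  have hr : ∀ x y, ⟪x, j (γ (j y))⟫_ℂ = ⟪γ (j y), j x⟫_ℂ := fun x y => by
    rw [← inner_conj_conj j, hj]
  refine ⟨nonneg_iff_inner.2 ⟨fun F G => ?_, fun F => ?_⟩, fun F => ?_, hγ.traceClass⟩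
  · rw [diagPDM_apply, diagPDM_apply, WithLp.prod_inner_apply, WithLp.prod_inner_apply]
    change ⟪γ F.fst, G.fst⟫_ℂ + ⟪F.snd - j (γ (j F.snd)), G.snd⟫_ℂ =
      ⟪F.fst, γ G.fst⟫_ℂ + ⟪F.snd, G.snd - j (γ (j G.snd))⟫_ℂ
    rw [hs, inner_sub_left, inner_sub_right, hl, hr, hs]
  · rw [diagPDM_apply, WithLp.prod_inner_apply]
    change 0 ≤ (⟪F.fst, γ F.fst⟫_ℂ + ⟪F.snd, F.snd - j (γ (j F.snd))⟫_ℂ).re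
    have h1 := hp F.fst
    have h2 : 0 ≤ (⟪j F.snd, j F.snd - γ (j F.snd)⟫_ℂ).re := hp' (j F.snd)
    rw [inner_sub_right, inner_conj_conj, ← hs] at h2
    rw [inner_sub_right, hr, Complex.add_re]
    linarith
  · rw [diagPDM_apply, diagPDM_apply]
    change _ = WithLp.toLp 2 (j (j F.fst - (j F.fst - j (γ (j (j F.fst))))),
      j (j F.snd - γ (j F.snd)))
    rw [hj, sub_sub_cancel, hj, map_sub, hj]

end GeneralizedPDM

/-! ### The pairing term -/

section Pairing

variable {M : Type*} [MeasurableSpace M] {ν : Measure M} [SigmaFinite ν]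
  [TopologicalSpace.SeparableSpace (OneP ν)]

theorem IsGenOnePDM.isIntegralKernel {j : OneP ν →ₗᵢ⋆[ℂ] OneP ν} (hj : ∀ f, j (j f) = f)
    {Γ : Dbl (OneP ν) →L[ℂ] Dbl (OneP ν)} (hΓ : IsGenOnePDM j Γ) :
    IsIntegralKernel ν (hsKernel ν (pairingBlock Γ)) (pairingBlock Γ) := by
  have h : ∃ k, IsIntegralKernel ν k (pairingBlock Γ) := by
    refine exists_integralKernel (stdBasis (OneP ν)) _ ?_
    rw [tsum_enorm_adjoint _ (stdBasis (OneP ν))]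
    exact ne_top_of_le_ne_top hΓ.traceClass (hΓ.tsum_adjoint_pairingBlock_le hj)
  rw [hsKernel, dif_pos h]
  exact h.choose_spec

/-- The exchange aligns the arguments: on the diagonal the kernel of Ex(α* ⊗ α) is conj(α(x,y))
α(x,y), so the negative part of the integral vanishes. -/
theorem pairingTerm_eq {V : M × M → ℝ} (hV : ∀ᵐ p ∂(ν.prod ν), 0 ≤ V p)
    (α : OneP ν →L[ℂ] OneP ν) :
    pairingTerm ν V α =
      ((∫⁻ p, ENNReal.ofReal (V p * ‖hsKernel ν α p.1 p.2‖ ^ 2) ∂(ν.prod ν) : ℝ≥0∞) : EReal) := by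
  have h : ∀ p : M × M,
      (exKernel (tensorKernel (adjKernel (hsKernel ν α)) (hsKernel ν α)) p p).re =
        ‖hsKernel ν α p.1 p.2‖ ^ 2 := fun p => by
    change ((starRingEnd ℂ) (hsKernel ν α p.1 p.2) * hsKernel ν α p.1 p.2).re = _
    rw [← Complex.normSq_eq_conj_mul_self, Complex.normSq_eq_norm_sq, Complex.ofReal_re]
  have h0 : ∫⁻ p, ENNReal.ofReal (-(V p * ‖hsKernel ν α p.1 p.2‖ ^ 2)) ∂(ν.prod ν) = 0 := by
    rw [← lintegral_zero (μ := ν.prod ν)]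
    refine lintegral_congr_ae ?_
    filter_upwards [hV] with p hp
    exact ENNReal.ofReal_of_nonpos (neg_nonpos.2 (mul_nonneg hp (sq_nonneg _)))
  rw [pairingTerm, mulTrace]
  simp_rw [h]
  rw [h0, EReal.coe_ennreal_zero, sub_zero]

/-- The chosen kernel of the zero operator is orthogonal to all product vectors, and these are total
in L²(M × M). -/
theorem hsKernel_zero_ae : ∀ᵐ p ∂(ν.prod ν), hsKernel ν 0 p.1 p.2 = 0 := by
  have hk : IsIntegralKernel ν (hsKernel ν 0) 0 := by
    have h : ∃ k, IsIntegralKernel ν k 0 :=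
      exists_integralKernel (stdBasis (OneP ν)) _ (by simp)
    rw [hsKernel, dif_pos h]
    exact h.choose_spec
  have h1 := tsum_inner_tens_cut (stdBasis (OneP ν)) MeasurableSet.univ MeasurableSet.univ
    (hk.1.toLp _)
  have h2 : ∀ a b : OneP ν, ⟪tens a b, hk.1.toLp _⟫_ℂ = 0 := fun a b => by
    have := inner_kernel hk a (star b)
    rw [star_star] at this
    rw [← this]
    simp
  simp only [h2, enorm_zero, ne_eq, OfNat.ofNat_ne_zero, not_false_eq_true, zero_pow, tsum_zero,
    Set.univ_prod_univ, Measure.restrict_univ] at h1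
  rw [← enorm_sq_eq_lintegral, eq_comm, sq_eq_zero_iff, enorm_eq_zero] at h1
  have h3 := hk.1.coeFn_toLp
  rw [h1] at h3
  filter_upwards [h3, Lp.coeFn_zero ℂ 2 (ν.prod ν)] with p h4 h5
  rw [h5] at h4
  exact h4.symm

theorem pairingTerm_zero {V : M × M → ℝ} (hV : ∀ᵐ p ∂(ν.prod ν), 0 ≤ V p) :
    pairingTerm ν V (0 : OneP ν →L[ℂ] OneP ν) = 0 := by
  have h0 : ∫⁻ p, ENNReal.ofReal (V p * ‖hsKernel ν 0 p.1 p.2‖ ^ 2) ∂(ν.prod ν) = 0 := by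
    rw [← lintegral_zero (μ := ν.prod ν)]
    refine lintegral_congr_ae ?_
    filter_upwards [hsKernel_zero_ae (ν := ν)] with p hp
    simp [hp]
  rw [pairingTerm_eq hV, h0, EReal.coe_ennreal_zero]

theorem pairingTerm_nonneg {V : M × M → ℝ} (hV : ∀ᵐ p ∂(ν.prod ν), 0 ≤ V p)
    (α : OneP ν →L[ℂ] OneP ν) : 0 ≤ pairingTerm ν V α := by
  rw [pairingTerm_eq hV]
  exact EReal.coe_ennreal_nonneg _

theorem bhfFunctional_of_pairingBlock_eq_zero {V : M × M → ℝ} (hV : ∀ᵐ p ∂(ν.prod ν), 0 ≤ V p)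
    (h : OneP ν →ₗ.[ℂ] OneP ν) (m μ : ℝ) {Γ : Dbl (OneP ν) →L[ℂ] Dbl (OneP ν)}
    (hΓ : pairingBlock Γ = 0) :
    bhfFunctional ν h m μ V Γ = hfFunctional ν h m μ V (gammaBlock Γ) := by
  rw [bhfFunctional, hΓ, pairingTerm_zero hV, mul_zero, add_zero]

theorem hfFunctional_gammaBlock_le {V : M × M → ℝ} (hV : ∀ᵐ p ∂(ν.prod ν), 0 ≤ V p)
    (h : OneP ν →ₗ.[ℂ] OneP ν) (m μ : ℝ) (Γ : Dbl (OneP ν) →L[ℂ] Dbl (OneP ν)) :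
    hfFunctional ν h m μ V (gammaBlock Γ) ≤ bhfFunctional ν h m μ V Γ := by
  refine le_add_of_nonneg_right (mul_nonneg ?_ (pairingTerm_nonneg hV _))
  exact_mod_cast (by norm_num : (0 : ℝ) ≤ 1 / 2)

/-- Every γ is the upper left entry of diag(γ, 1 - jγj), which has no pairing, and discarding the
pairing term of a general Γ only lowers the energy. -/
theorem iInf_bhfFunctional_eq {V : M × M → ℝ} (hV : ∀ᵐ p ∂(ν.prod ν), 0 ≤ V p)
    (h : OneP ν →ₗ.[ℂ] OneP ν) (m μ : ℝ) {j : OneP ν →ₗᵢ⋆[ℂ] OneP ν} (hj : ∀ f, j (j f) = f) :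
    ⨅ (Γ : Dbl (OneP ν) →L[ℂ] Dbl (OneP ν)) (_ : IsGenOnePDM j Γ), bhfFunctional ν h m μ V Γ =
      ⨅ (γ : OneP ν →L[ℂ] OneP ν) (_ : IsOnePDM γ), hfFunctional ν h m μ V γ := by
  refine le_antisymm (le_iInf₂ fun γ hγ => ?_) (le_iInf₂ fun Γ hΓ => ?_)
  · refine (iInf₂_le _ (hγ.isGenOnePDM_diagPDM hj)).trans ?_
    rw [bhfFunctional_of_pairingBlock_eq_zero hV h m μ (pairingBlock_diagPDM j γ),
      gammaBlock_diagPDM]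
  · exact (iInf₂_le _ (hΓ.isOnePDM hj)).trans (hfFunctional_gammaBlock_le hV h m μ Γ)

end Pairing

end BHF

/-! ### The main theorem -/

theorem mainTheorem7 {M : Type*} [MeasurableSpace M] (ν : Measure M) [SigmaFinite ν]
    [TopologicalSpace.SeparableSpace (BHF.OneP ν)]
    (h : BHF.OneP ν →ₗ.[ℂ] BHF.OneP ν) (hdense : Dense (h.domain : Set (BHF.OneP ν)))
    (hsa : IsSelfAdjoint h.closure)
    (m μ : ℝ)
    (hbdd : ∀ f : h.domain,
      0 ≤ (⟪(f : BHF.OneP ν), h f⟫_ℂ).re + m * ‖(f : BHF.OneP ν)‖ ^ 2)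
    (V : M × M → ℝ) (hVm : Measurable V) (hV : ∀ᵐ p ∂(ν.prod ν), 0 ≤ V p)
    (j : BHF.OneP ν →ₗᵢ⋆[ℂ] BHF.OneP ν) (hj : ∀ f, j (j f) = f) :
    (∀ Γ : BHF.Dbl (BHF.OneP ν) →L[ℂ] BHF.Dbl (BHF.OneP ν), BHF.IsGenOnePDM j Γ →
      (BHF.IsIntegralKernel ν (BHF.hsKernel ν (BHF.pairingBlock Γ)) (BHF.pairingBlock Γ) ∧
        BHF.pairingTerm ν V (BHF.pairingBlock Γ) =
          ((∫⁻ p, ENNReal.ofReal (V p * ‖BHF.hsKernel ν (BHF.pairingBlock Γ) p.1 p.2‖ ^ 2)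
            ∂(ν.prod ν) : ℝ≥0∞) : EReal) ∧
        0 ≤ BHF.pairingTerm ν V (BHF.pairingBlock Γ)) ∧
      (BHF.IsGenOnePDM j (BHF.flipped Γ) ∧
        BHF.IsGenOnePDM j (BHF.averaged Γ) ∧
        BHF.gammaBlock (BHF.averaged Γ) = BHF.gammaBlock Γ ∧
        BHF.pairingBlock (BHF.averaged Γ) = 0 ∧
        BHF.bhfFunctional ν h m μ V (BHF.averaged Γ) =
          BHF.hfFunctional ν h m μ V (BHF.gammaBlock Γ) ∧
        BHF.bhfFunctional ν h m μ V (BHF.averaged Γ) ≤ BHF.bhfFunctional ν h m μ V Γ)) ∧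
    BHF.bhfEnergy ν h m μ V = BHF.hfEnergy ν h m μ V ∧
    BHF.hfEnergy ν h m μ V =
      ⨅ (γ : BHF.OneP ν →L[ℂ] BHF.OneP ν) (_ : BHF.IsOnePDM γ),
        BHF.hfFunctional ν h m μ V γ ∧
    BHF.bhfEnergy ν h m μ V =
      ⨅ (Γ : BHF.Dbl (BHF.OneP ν) →L[ℂ] BHF.Dbl (BHF.OneP ν)) (_ : BHF.IsGenOnePDM j Γ),
        BHF.bhfFunctional ν h m μ V Γ := by
  have : Countable (BHF.BasisIndex (BHF.OneP ν)) := inferInstance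
  obtain ⟨φ, hφ⟩ := BHF.exists_opForm_eq_tsum hdense hsa hbdd (BHF.stdBasis (BHF.OneP ν))
  have h1 := BHF.bhfEnergy_le_hfEnergy hφ hVm μ
  have h2 : BHF.hfEnergy ν h m μ V ≤
      ⨅ (γ : BHF.OneP ν →L[ℂ] BHF.OneP ν) (_ : BHF.IsOnePDM γ), BHF.hfFunctional ν h m μ V γ :=
    le_iInf₂ fun γ hγ => BHF.hfEnergy_le_hfFunctional hφ hVm hV hγ μ
  have h3 := BHF.iInf_hfFunctional_le_bhfEnergy hφ hVm hV μ
  -- The inequalities h1, h2 and h3 close the circle, so all three quantities coincide.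
  have h4 : BHF.bhfEnergy ν h m μ V = BHF.hfEnergy ν h m μ V := h1.antisymm (h2.trans h3)
  have h5 := h2.antisymm (h3.trans h1)
  refine ⟨fun Γ hΓ => ⟨⟨hΓ.isIntegralKernel hj, BHF.pairingTerm_eq hV _,
    BHF.pairingTerm_nonneg hV _⟩, hΓ.flipped, hΓ.averaged, BHF.gammaBlock_averaged Γ,
    BHF.pairingBlock_averaged Γ, ?_, ?_⟩, h4, h5, ?_⟩
  · rw [BHF.bhfFunctional_of_pairingBlock_eq_zero hV h m μ (BHF.pairingBlock_averaged Γ),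
      BHF.gammaBlock_averaged]
  · rw [BHF.bhfFunctional_of_pairingBlock_eq_zero hV h m μ (BHF.pairingBlock_averaged Γ),
      BHF.gammaBlock_averaged]
    exact BHF.hfFunctional_gammaBlock_le hV h m μ Γ
  · rw [BHF.iInf_bhfFunctional_eq hV h m μ hj, h4, h5]
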